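/- **Setting.** Let $\mathcal A=\{H_1,\dots,H_n\}$ be an arrangement of lines in $\mathbb R^2$ in the following normal position: $H_i$ passes through $(a_i,0)$ and makes the angle $\theta_i$ with the positive $x_1$-axis, where $a_1<\dots<a_n$ and $\frac{\pi}{4}\le\theta_1\le\dots\le\theta_n\le\frac{3\pi}{4}$; all intersection points of two different lines lie in $\{1<x_2<R_0\}$; and $R>0$ is so large that all points $H_i\cap\{x_2=R_0\}$ lie in $\{-R+R_0<x_1<R-R_0\}$. Let $\alpha_i$ be a defining equation of $H_i$ that is positive on the right of $H_i$. A chamber is a connected component of $\mathbb R^2\setminus\bigcup_i H_i$, and $\mathrm{ch}_F(\mathcal A)$ is the set of chambers that do not meet $F=\{x_2=0\}$. For such a chamber $C$ let $\delta_i(C)=\pm1$ be the sign of $\alpha_i$ on $C$. Let $\overline H_i=H_i\cap([-R,R]\times[-1,1])$. The PL $3$-sphere is $$S(R,1)=\{(x,y)\mid x\in[-R,R]\times[-1,1],\ y\in T_x\mathbb R^2,\ \|y\|_\infty=\delta(x)\},$$ where $\delta(x)$ is the $\|\cdot\|_\infty$-distance from $x$ to the boundary of the rectangle. The link of a plane curve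 $\Gamma$ with cusps in the rectangle is $L(\Gamma)=\{(x,y)\in S(R,1)\mid x\in \Gamma,\ y\in T_x\Gamma\}$ (with the natural tangent line at a cusp). **The curves.** Fix $0<\varepsilon<h<1-\varepsilon$. For $p\le q$, a closed curve *joined from the lines* $H_p,\dots,H_q$ is a curve inside the strip $\{h-\varepsilon<x_2<h+\varepsilon\}$ and inside $\{|x_1|<R\}$, which for some heights $h-\varepsilon<h_l<h_u<h+\varepsilon$ is the union of the following parts, each horizontal where it meets the lines: * the horizontal segment of height $h_u$ from $H_p$ to $H_q$; * for $p\le i<q$, a curve of height less than $h_u$ that joins the points of $H_i$ and $H_{i+1}$ of height $h_l$ and lies between these lines: it has one upward cusp if $(\delta_i(C),\delta_{i+1}(C))=(+1,-1)$, one downward cusp if $(\delta_i(C),\delta_{i+1}(C))=(-1,+1)$, and is a horizontal segment if $\delta_i(C)=\delta_{i+1}(C)$; * a curve on the left of $H_p$ (and on the right of the lines $H_i$, $i<p$) that joins the points of $H_p$ of heights $h_l$ and $h_u$: it has one leftward cusp if $\delta_p(C)=+1$ and is a smooth round curve if $\delta_p(C)=-1$; * a curve on the right of $H_q$ (and on the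 left of the lines $H_i$, $i>q$) that joins the points of $H_q$ of heights $h_l$ and $h_u$: it is a smooth round curve if $\delta_q(C)=+1$ and has one rightward cusp if $\delta_q(C)=-1$. Let $\gamma(C)$ be any curve joined from the lines $H_1,\dots,H_n$, and let the reduced curve $\gamma'(C)$ be any curve joined from the lines $H_{m_1},\dots,H_{m_2}$, where $m_1=\min\{i\mid\delta_i(C)=-1\}$ and $m_2=\max\{i\mid\delta_i(C)=+1\}$. **Proposition.** For each $C\in\mathrm{ch}_F(\mathcal A)$, the divides with cusps $(\gamma'(C),\overline H_1,\dots,\overline H_n)$ and $(\gamma(C),\overline H_1,\dots,\overline H_n)$ give isotopic links in $S(R,1)$: there is an ambient isotopy of $S(R,1)$ that carries $L(\gamma'(C))$ onto $L(\gamma(C))$ and each $L(\overline H_i)$ onto itself. -/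

import Mathlib

open Set Filter Topology

noncomputable section

/-! ## The piecewise linear three-sphere, links of plane curves, isotopy

The norm of `ℝ × ℝ` is the maximum norm. A pair `(x, y) : (ℝ × ℝ) × (ℝ × ℝ)` is a tangent vector
`y` of the plane at the point `x`. -/

/-- The rectangle `[-R, R] × [-1, 1]`. -/
def rectangle (R : ℝ) : Set (ℝ × ℝ) := Icc (-R) R ×ˢ Icc (-1) 1

/-- The distance, in the maximum norm, of a point of the rectangle to the boundary of the
rectangle. -/
def boundaryDist (R : ℝ) (x : ℝ × ℝ) : ℝ :=
  min (min (x.1 + R) (R - x.1)) (min (x.2 + 1) (1 - x.2))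

/-- The piecewise linear sphere: tangent vectors at points `x` of the rectangle whose maximum norm
is the distance of `x` to the boundary of the rectangle. -/
def plSphere (R : ℝ) : Set ((ℝ × ℝ) × (ℝ × ℝ)) :=
  {z | z.1 ∈ rectangle R ∧ ‖z.2‖ = boundaryDist R z.1}

/-- The link in the piecewise linear sphere of a plane curve `C` that is smooth up to cusps and
double points: the tangent vectors of `C` which lie in the sphere. The tangent cone over the field
`ℝ` (positive and negative multiples of secants are allowed) is the tangent line at a smooth point,
the natural tangent line at a cusp, and the union of the two tangent lines at a double point. -/
def divideLink (R : ℝ) (C : Set (ℝ × ℝ)) : Set (plSphere R) :=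
  {z | z.1.1 ∈ C ∧ z.1.2 ∈ tangentConeAt ℝ C z.1.1}

/-- Two families `K`, `L` of subsets of a space `X` (the components of two links) are isotopic:
there is an ambient isotopy of `X` that starts at the identity and carries `K k` onto `L k` for
every `k`. -/
def AmbientIsotopic {X ι : Type*} [TopologicalSpace X] (K L : ι → Set X) : Prop :=
  ∃ Φ : unitInterval → (X ≃ₜ X),
    Continuous (fun p : unitInterval × X => Φ p.1 p.2) ∧
    Φ 0 = Homeomorph.refl X ∧
    ∀ k, Φ 1 '' K k = L k

/-! ## Line arrangements in normal position -/

/-- The affine linear form vanishing on the line through `(a, 0)` that makes the angle `θ` with the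
positive `x₁`-axis. For `0 < θ < π` it is positive exactly on the right side of the line. -/
def lineForm (a θ : ℝ) (x : ℝ × ℝ) : ℝ := (x.1 - a) * Real.sin θ - x.2 * Real.cos θ

/-- An arrangement of `n` lines in normal position with respect to the generic line
`F = {x₂ = 0}`. -/
structure LineArrangement (n : ℕ) where
  /-- the `i`-th line meets `F` in `(a i, 0)` -/
  a : Fin n → ℝ
  /-- the angle between the `x₁`-axis and the `i`-th line -/
  θ : Fin n → ℝ
  /-- a height above all the intersection points -/
  R₀ : ℝ
  /-- half the width of the rectangle -/
  R : ℝ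
  strictMono_a : StrictMono a
  monotone_θ : Monotone θ
  θ_mem : ∀ i, θ i ∈ Icc (Real.pi / 4) (3 * Real.pi / 4)
  R₀_pos : 0 < R₀
  R_pos : 0 < R
  intersection_mem : ∀ i j, i ≠ j → ∀ x : ℝ × ℝ,
    lineForm (a i) (θ i) x = 0 → lineForm (a j) (θ j) x = 0 → x.2 ∈ Ioo 1 R₀
  top_mem : ∀ i, ∀ x : ℝ × ℝ,
    lineForm (a i) (θ i) x = 0 → x.2 = R₀ → x.1 ∈ Ioo (-R + R₀) (R - R₀)

namespace LineArrangement

variable {n : ℕ} (A : LineArrangement n)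

/-- The defining form of the `i`-th line, positive on the right of the line. -/
def form (i : Fin n) (x : ℝ × ℝ) : ℝ := lineForm (A.a i) (A.θ i) x

/-- The part of the `i`-th line in the rectangle. -/
def segment (i : Fin n) : Set (ℝ × ℝ) := {x | A.form i x = 0} ∩ rectangle A.R

/-- The real complement of the arrangement. -/
def complement : Set (ℝ × ℝ) := {x | ∀ i, A.form i x ≠ 0}

/-- The chambers: the connected components of the real complement. -/
def chambers : Set (Set (ℝ × ℝ)) :=
  {C | ∃ x ∈ A.complement, C = connectedComponentIn A.complement x}

/-- The chambers which do not meet `F = {x₂ = 0}`. -/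
def chambersF : Set (Set (ℝ × ℝ)) :=
  {C | C ∈ A.chambers ∧ C ∩ {x | x.2 = 0} = ∅}

open Classical in
/-- The sign of the `i`-th form on a chamber `C`. -/
def chamberSign (C : Set (ℝ × ℝ)) (i : Fin n) : ℤ :=
  if ∀ x ∈ C, 0 < A.form i x then 1 else if ∀ x ∈ C, A.form i x < 0 then -1 else 0

/-- The abscissa of the point of height `h` on the `i`-th line. -/
def crossing (i : Fin n) (h : ℝ) : ℝ := A.a i + h * (Real.cos (A.θ i) / Real.sin (A.θ i))

end LineArrangement

/-! ## The curves with cusps of a chamber -/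

/-- `f` is continuous on `[s, t]`, and continuously differentiable on `(s, t)` with derivative in
`S`; the derivative tends to `F` at the left end and to `G` at the right end. With `S = (0, ∞)` or
`S = (-∞, 0)` the graph is a monotone arc; an end where the derivative tends to `0` has a tangent
in the direction of the axis of the variable, an end where it tends to `±∞` has a tangent
perpendicular to that. -/
def IsMonotoneArc (f : ℝ → ℝ) (s t : ℝ) (S : Set ℝ) (F G : Filter ℝ) : Prop :=
  s < t ∧ ContinuousOn f (Icc s t) ∧ ContDiffOn ℝ 1 f (Ioo s t) ∧
    (∀ x ∈ Ioo s t, deriv f x ∈ S) ∧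
    Tendsto (deriv f) (𝓝[>] s) F ∧ Tendsto (deriv f) (𝓝[<] t) G

/-- A curve from `(s, h)` to `(t, h)`, horizontal at both ends, with one upward cusp. -/
def IsUpwardCusp (s t h : ℝ) (M : Set (ℝ × ℝ)) : Prop :=
  ∃ (c : ℝ) (f : ℝ → ℝ), f s = h ∧ f t = h ∧
    IsMonotoneArc f s c (Ioi 0) (𝓝 0) atTop ∧ IsMonotoneArc f c t (Iio 0) atBot (𝓝 0) ∧
    M = (fun x => (x, f x)) '' Icc s t

/-- A curve from `(s, h)` to `(t, h)`, horizontal at both ends, with one downward cusp. -/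
def IsDownwardCusp (s t h : ℝ) (M : Set (ℝ × ℝ)) : Prop :=
  ∃ (c : ℝ) (f : ℝ → ℝ), f s = h ∧ f t = h ∧
    IsMonotoneArc f s c (Iio 0) (𝓝 0) atBot ∧ IsMonotoneArc f c t (Ioi 0) atTop (𝓝 0) ∧
    M = (fun x => (x, f x)) '' Icc s t

/-- A curve from `(s, hl)` to `(t, hu)`, `hl < hu`, horizontal at both ends, with one leftward
cusp. -/
def IsLeftwardCusp (s t hl hu : ℝ) (M : Set (ℝ × ℝ)) : Prop :=
  ∃ (c : ℝ) (l u : ℝ → ℝ), l c = u c ∧ l s = hl ∧ u t = hu ∧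
    IsMonotoneArc l c s (Iio 0) (𝓝 0) (𝓝 0) ∧ IsMonotoneArc u c t (Ioi 0) (𝓝 0) (𝓝 0) ∧
    M = (fun x => (x, l x)) '' Icc c s ∪ (fun x => (x, u x)) '' Icc c t

/-- A curve from `(s, hl)` to `(t, hu)`, `hl < hu`, horizontal at both ends, with one rightward
cusp. -/
def IsRightwardCusp (s t hl hu : ℝ) (M : Set (ℝ × ℝ)) : Prop :=
  ∃ (c : ℝ) (l u : ℝ → ℝ), l c = u c ∧ l s = hl ∧ u t = hu ∧
    IsMonotoneArc l s c (Ioi 0) (𝓝 0) (𝓝 0) ∧ IsMonotoneArc u t c (Iio 0) (𝓝 0) (𝓝 0) ∧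
    M = (fun x => (x, l x)) '' Icc s c ∪ (fun x => (x, u x)) '' Icc t c

/-- A smooth round curve from `(s, hl)` to `(t, hu)`, `hl < hu`, horizontal at both ends, that turns
around once, on the left. -/
def IsLeftRound (s t hl hu : ℝ) (M : Set (ℝ × ℝ)) : Prop :=
  ∃ (m : ℝ) (g : ℝ → ℝ), g hl = s ∧ g hu = t ∧
    IsMonotoneArc g hl m (Iio 0) atBot (𝓝 0) ∧ IsMonotoneArc g m hu (Ioi 0) (𝓝 0) atTop ∧
    M = (fun y => (g y, y)) '' Icc hl hu

/-- A smooth round curve from `(s, hl)` to `(t, hu)`, `hl < hu`, horizontal at both ends, that turns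
around once, on the right. -/
def IsRightRound (s t hl hu : ℝ) (M : Set (ℝ × ℝ)) : Prop :=
  ∃ (m : ℝ) (g : ℝ → ℝ), g hl = s ∧ g hu = t ∧
    IsMonotoneArc g hl m (Ioi 0) atTop (𝓝 0) ∧ IsMonotoneArc g m hu (Iio 0) (𝓝 0) atBot ∧
    M = (fun y => (g y, y)) '' Icc hl hu

namespace LineArrangement

variable {n : ℕ} (A : LineArrangement n)

/-- The left end of the curve, on the left of the `p`-th line: a leftward cusp for the sign `1`, a
round curve for the sign `-1`. It stays in the rectangle and on the right of the lines preceding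
the `p`-th one. -/
def IsLeftEnd (δ : Fin n → ℤ) (hl hu : ℝ) (p : Fin n) (M : Set (ℝ × ℝ)) : Prop :=
  ((δ p = 1 ∧ IsLeftwardCusp (A.crossing p hl) (A.crossing p hu) hl hu M) ∨
    (δ p = -1 ∧ IsLeftRound (A.crossing p hl) (A.crossing p hu) hl hu M)) ∧
  (∀ x ∈ M, x = (A.crossing p hl, hl) ∨ x = (A.crossing p hu, hu) ∨ A.form p x < 0) ∧
  ∀ x ∈ M, -A.R < x.1 ∧ ∀ i < p, 0 < A.form i x

/-- The right end of the curve, on the right of the `q`-th line: a round curve for the sign `1`, a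
rightward cusp for the sign `-1`. It stays in the rectangle and on the left of the lines following
the `q`-th one. -/
def IsRightEnd (δ : Fin n → ℤ) (hl hu : ℝ) (q : Fin n) (M : Set (ℝ × ℝ)) : Prop :=
  ((δ q = 1 ∧ IsRightRound (A.crossing q hl) (A.crossing q hu) hl hu M) ∨
    (δ q = -1 ∧ IsRightwardCusp (A.crossing q hl) (A.crossing q hu) hl hu M)) ∧
  (∀ x ∈ M, x = (A.crossing q hl, hl) ∨ x = (A.crossing q hu, hu) ∨ 0 < A.form q x) ∧
  ∀ x ∈ M, x.1 < A.R ∧ ∀ i > q, A.form i x < 0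

/-- The horizontal segment of height `h` between the `i`-th and the `j`-th line. -/
def horizontal (i j : Fin n) (h : ℝ) : Set (ℝ × ℝ) := Icc (A.crossing i h) (A.crossing j h) ×ˢ {h}

/-- The lower curve between two consecutive lines, the `i`-th and the `j`-th: it has an upward cusp
for the signs `(1, -1)`, a downward cusp for the signs `(-1, 1)`, and is a horizontal segment for
equal signs. It stays between the two lines, above the height `b` and below the height `hu` of the
upper curve. -/
def IsLowerPart (δ : Fin n → ℤ) (b hl hu : ℝ) (i j : Fin n) (M : Set (ℝ × ℝ)) : Prop :=
  ((δ i = 1 ∧ δ j = -1 ∧ IsUpwardCusp (A.crossing i hl) (A.crossing j hl) hl M) ∨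
    (δ i = -1 ∧ δ j = 1 ∧ IsDownwardCusp (A.crossing i hl) (A.crossing j hl) hl M) ∨
    (δ i = δ j ∧ M = A.horizontal i j hl)) ∧
  (∀ x ∈ M, x = (A.crossing i hl, hl) ∨ x = (A.crossing j hl, hl) ∨
    (0 < A.form i x ∧ A.form j x < 0)) ∧
  ∀ x ∈ M, b < x.2 ∧ x.2 < hu

/-- `γ` is a curve in the strip `h - ε < x₂ < h + ε` obtained, from the lines with the indices
`p, …, q` and the signs `δ`, by joining a left end, lower and upper parts between consecutive
lines, and a right end. The upper parts form a horizontal segment. -/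
def IsJoinedCurve (δ : Fin n → ℤ) (h ε : ℝ) (p q : Fin n) (γ : Set (ℝ × ℝ)) : Prop :=
  ∃ (hl hu : ℝ) (left right : Set (ℝ × ℝ)) (lower : Fin n → Set (ℝ × ℝ)),
    h - ε < hl ∧ hl < hu ∧ hu < h + ε ∧
    A.IsLeftEnd δ hl hu p left ∧ A.IsRightEnd δ hl hu q right ∧
    (∀ i j : Fin n, p ≤ i → j ≤ q → (i : ℕ) + 1 = j →
      A.IsLowerPart δ (h - ε) hl hu i j (lower i)) ∧
    γ = left ∪ A.horizontal p q hu ∪ (⋃ i ∈ Ico p q, lower i) ∪ right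

/-- `γ` is a curve `γ(C)`: it is joined from parts for all the lines. -/
def IsChamberCurve (C : Set (ℝ × ℝ)) (h ε : ℝ) (γ : Set (ℝ × ℝ)) : Prop :=
  ∃ p q : Fin n, IsBot p ∧ IsTop q ∧ A.IsJoinedCurve (A.chamberSign C) h ε p q γ

/-- `γ` is a reduced curve `γ'(C)`: it is joined from parts for the lines from the first one with
sign `-1` to the last one with sign `1`. -/
def IsReducedChamberCurve (C : Set (ℝ × ℝ)) (h ε : ℝ) (γ : Set (ℝ × ℝ)) : Prop :=
  ∃ m₁ m₂ : Fin n, IsLeast {i | A.chamberSign C i = -1} m₁ ∧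
    IsGreatest {i | A.chamberSign C i = 1} m₂ ∧
    A.IsJoinedCurve (A.chamberSign C) h ε m₁ m₂ γ

/-- The components of the link of the divide with cusps `(γ, H̄₁, …, H̄ₙ)`; the component with
index `0` is the link of `γ`, the others are the knots of the segments. -/
def links (γ : Set (ℝ × ℝ)) : Fin (n + 1) → Set (plSphere A.R) :=
  fun k => divideLink A.R ((Fin.cons γ A.segment : Fin (n + 1) → Set (ℝ × ℝ)) k)

end LineArrangement

end

/-! The link of a curve depends only on its lift, the set of its points together with their tangent
angles modulo π. Over the interior of the rectangle the sphere is a product with the circle of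
angles, and over the boundary the circles collapse to points. Hence a motion of points with angles
that is periodic in the angle and supported over an open set inside the rectangle descends to an
ambient isotopy of the sphere (`AngleIsotopy.ambientIsotopic`). In the lift a cusp is no
singularity: each part of a joined curve is a graph with a continuous angle (the lemmas
`exists_strand`).

The cusps are placed so that the lower curve can be given the angle 0 at a line of sign 1 and π at a
line of sign -1. The left end then reaches the upper segment with the angle 0, the right end with π.
So the whole curve is described, up to isotopy off the lines, by one function `ω` of the abscissa
which interpolates these angles (`IsAngle`).

A chamber that misses F has a line of sign -1 before a line of sign 1, so m₁ < m₂
(`lt_of_mem_chambersF`). All lines before m₁ have sign 1 and all lines after m₂ have sign -1. Thus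
`ω` may be 0 up to a point just before the line m₁ and π from a point just after the line m₂. There
the ends of the reduced curve can be pulled outwards across the remaining lines with horizontal
direction. The lines have angles between π/4 and 3π/4, so their lifts avoid the horizontal
directions: a displacement damped by `max 0 (cos 2u)` moves the end fully and the lifts of the lines
not at all (`isotopicRel_horizontal_push`).

The motion takes place in a chart in which the lines are vertical. It exists since no two lines meet
at heights in [0, 1], which makes the cotangent a Lipschitz function of the base point with constant
less than 1 (`exists_isSlope`, `straighten`). Both curves are first normalized in the convex regions
between the lines (`isotopicRel_boxCurve`), then pulled out to wedges over a common interval with a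
common `ω` (`isotopicRel_boxCurve_wedge`). Two such wedges differ by vertical motions, which
preserve vertical lines with any angle on them (`isotopicRel_wedge`). -/

noncomputable section

/-! ## Tent functions and pushes of an interval -/

/-- The piecewise linear function that is `1` at `p` and `0` outside `(l, h)`. -/
def tent (l p h x : ℝ) : ℝ := max 0 (min ((x - l) / (p - l)) ((h - x) / (h - p)))

lemma tent_nonneg (l p h x : ℝ) : 0 ≤ tent l p h x := le_max_left _ _

section Tent

variable {l p q h x : ℝ}

lemma tent_of_le_left (hp : l < p) (hx : x ≤ l) : tent l p h x = 0 := by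
  refine max_eq_left ((min_le_left _ _).trans ?_)
  exact div_nonpos_of_nonpos_of_nonneg (by linarith) (by linarith)

lemma tent_of_right_le (hp : p < h) (hx : h ≤ x) : tent l p h x = 0 := by
  refine max_eq_left ((min_le_right _ _).trans ?_)
  exact div_nonpos_of_nonpos_of_nonneg (by linarith) (by linarith)

/-- The value depends on the parameter `s` alone and not on the position of the top `p`. Hence
moving the top preserves the values of the tent along the motion, which is what inverts a push
explicitly. -/
lemma tent_left (hl : l < p) (hh : p < h) {s : ℝ} (h0 : 0 ≤ s) (h1 : s ≤ 1) :
    tent l p h (l + s * (p - l)) = s := by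
  have e1 : (l + s * (p - l) - l) / (p - l) = s := by
    field_simp [(sub_pos.2 hl).ne']; ring
  have e2 : s ≤ (h - (l + s * (p - l))) / (h - p) := by
    rw [le_div_iff₀ (sub_pos.2 hh)]; nlinarith
  rw [tent, e1, min_eq_left e2, max_eq_right h0]

lemma tent_right (hl : l < p) (hh : p < h) {s : ℝ} (h0 : 0 ≤ s) (h1 : s ≤ 1) :
    tent l p h (h - s * (h - p)) = s := by
  have e1 : (h - (h - s * (h - p))) / (h - p) = s := by
    field_simp [(sub_pos.2 hh).ne']; ring
  have e2 : s ≤ (h - s * (h - p) - l) / (p - l) := by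
    rw [le_div_iff₀ (sub_pos.2 hl)]; nlinarith
  rw [tent, e1, min_eq_right e2, max_eq_right h0]

lemma tent_self (hl : l < p) (hh : p < h) : tent l p h p = 1 := by
  have := tent_left hl hh zero_le_one le_rfl
  rwa [one_mul, add_sub_cancel] at this

lemma tent_le_one (hl : l < p) (hh : p < h) : tent l p h x ≤ 1 := by
  refine max_le zero_le_one ?_
  rcases le_total x p with hx | hx
  · exact (min_le_left _ _).trans ((div_le_one (sub_pos.2 hl)).2 (by linarith))
  · exact (min_le_right _ _).trans ((div_le_one (sub_pos.2 hh)).2 (by linarith))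

lemma tent_cases (hl : l < p) (hh : p < h) (x : ℝ) :
    x ≤ l ∨ (∃ s, 0 ≤ s ∧ s ≤ 1 ∧ x = l + s * (p - l)) ∨
      (∃ s, 0 ≤ s ∧ s ≤ 1 ∧ x = h - s * (h - p)) ∨ h ≤ x := by
  have h1 := sub_pos.2 hl
  have h2 := sub_pos.2 hh
  rcases le_total x l with hx | hx
  · exact Or.inl hx
  rcases le_total h x with hx' | hx'
  · exact Or.inr (Or.inr (Or.inr hx'))
  rcases le_total x p with hxp | hxp
  · refine Or.inr (Or.inl ⟨(x - l) / (p - l), div_nonneg (by linarith) h1.le, ?_, ?_⟩)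
    · exact (div_le_one h1).2 (by linarith)
    · field_simp; ring
  · refine Or.inr (Or.inr (Or.inl ⟨(h - x) / (h - p), div_nonneg (by linarith) h2.le, ?_, ?_⟩))
    · exact (div_le_one h2).2 (by linarith)
    · field_simp; ring

/-- Moving `x` by the tent that moves `p` to `q` does not change the value of the tent. -/
lemma tent_push (hl : l < p) (hh : p < h) (hl' : l < q) (hh' : q < h) (x : ℝ) :
    tent l q h (x + (q - p) * tent l p h x) = tent l p h x := by
  rcases tent_cases hl hh x with hx | ⟨s, h0, h1, rfl⟩ | ⟨s, h0, h1, rfl⟩ | hx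
  · simp [tent_of_le_left hl hx, tent_of_le_left hl' hx]
  · rw [tent_left hl hh h0 h1]
    convert tent_left hl' hh' h0 h1 using 2
    ring
  · rw [tent_right hl hh h0 h1]
    convert tent_right hl' hh' h0 h1 using 2
    ring
  · simp [tent_of_right_le hh hx, tent_of_right_le hh' hx]

/-- This bound and the three after it locate the images of the pieces of the interval cut at `p`;
`push_mem_uIcc` needs no more than them. -/
lemma push_le_iff (hl : l < p) (hh : p < h) (hl' : l < q) (hh' : q < h) (hx : x ≤ p) :
    x + (q - p) * tent l p h x ≤ q := by
  rcases tent_cases hl hh x with hx | ⟨s, h0, h1, rfl⟩ | ⟨s, h0, h1, rfl⟩ | hx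
  · simp only [tent_of_le_left hl hx]; linarith
  · rw [tent_left hl hh h0 h1]; nlinarith
  · rw [tent_right hl hh h0 h1]; nlinarith
  · linarith

lemma le_push (hl : l < p) (hh : p < h) (hl' : l < q) (hh' : q < h) (hx : p ≤ x) :
    q ≤ x + (q - p) * tent l p h x := by
  rcases tent_cases hl hh x with hx | ⟨s, h0, h1, rfl⟩ | ⟨s, h0, h1, rfl⟩ | hx
  · linarith
  · rw [tent_left hl hh h0 h1]; nlinarith
  · rw [tent_right hl hh h0 h1]; nlinarith
  · simp only [tent_of_right_le hh hx]; linarith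

lemma push_le_right (hl : l < p) (hh : p < h) (hh' : q < h) (hx : x ≤ h) :
    x + (q - p) * tent l p h x ≤ h := by
  rcases tent_cases hl hh x with hx | ⟨s, h0, h1, rfl⟩ | ⟨s, h0, h1, rfl⟩ | hx
  · simp only [tent_of_le_left hl hx]; linarith
  · rw [tent_left hl hh h0 h1]; nlinarith
  · rw [tent_right hl hh h0 h1]; nlinarith
  · simp only [tent_of_right_le hh hx]; linarith

lemma left_le_push (hl : l < p) (hh : p < h) (hl' : l < q) (hx : l ≤ x) :
    l ≤ x + (q - p) * tent l p h x := by
  rcases tent_cases hl hh x with hx | ⟨s, h0, h1, rfl⟩ | ⟨s, h0, h1, rfl⟩ | hx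
  · simp only [tent_of_le_left hl hx]; linarith
  · rw [tent_left hl hh h0 h1]; nlinarith
  · rw [tent_right hl hh h0 h1]; nlinarith
  · simp only [tent_of_right_le hh hx]; linarith

end Tent

/-- Multiplied by a factor which vanishes where the tent degenerates, a tent with variable corners
is continuous. -/
lemma continuous_mul_tent {Y : Type*} [TopologicalSpace Y] {D L P H V : Y → ℝ}
    (hD : Continuous D) (hP : Continuous P) (hV : Continuous V)
    (hne : ∀ y, D y ≠ 0 → ContinuousAt L y ∧ ContinuousAt H y ∧ L y < P y ∧ P y < H y) :
    Continuous fun y => D y * tent (L y) (P y) (H y) (V y) := by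
  rw [continuous_iff_continuousAt]
  intro y
  by_cases hy : D y = 0
  -- At a zero of `D` the corners may collide or jump. The tent is at most 1 wherever `D` is
  -- nonzero, so the product is squeezed by `D`.
  · have hle : ∀ y', ‖D y' * tent (L y') (P y') (H y') (V y')‖ ≤ ‖D y'‖ := by
      intro y'
      by_cases hy' : D y' = 0
      · simp [hy']
      · obtain ⟨-, -, h1, h2⟩ := hne y' hy'
        rw [norm_mul, Real.norm_of_nonneg (tent_nonneg _ _ _ _)]
        exact mul_le_of_le_one_right (norm_nonneg _) (tent_le_one h1 h2)
    have h0 : Tendsto (fun y' => ‖D y'‖) (𝓝 y) (𝓝 0) := by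
      have := (hD.norm.tendsto y)
      rwa [hy, norm_zero] at this
    have := squeeze_zero_norm hle h0
    rw [ContinuousAt, hy, zero_mul]
    exact this
  · obtain ⟨hL, hH, h1, h2⟩ := hne y hy
    refine hD.continuousAt.mul ?_
    unfold tent
    refine Tendsto.max tendsto_const_nhds (Tendsto.min ?_ ?_)
    · exact (hV.continuousAt.sub hL).div (hP.continuousAt.sub hL) (sub_pos.2 h1).ne'
    · exact (hH.sub hV.continuousAt).div (hH.sub hP.continuousAt) (sub_pos.2 h2).ne'

/-! ## Isotopies of the bundle of angles over the plane -/

/-- A point of the plane together with an angle. -/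
abbrev AngledPoint : Type := (ℝ × ℝ) × ℝ

/-- An isotopy of the bundle of angles that is periodic in the angle and the identity over the
complement of `U`. -/
structure AngleIsotopy (U : Set (ℝ × ℝ)) where
  toFun : unitInterval → AngledPoint → AngledPoint
  invFun : unitInterval → AngledPoint → AngledPoint
  continuous_toFun : Continuous fun p : unitInterval × AngledPoint => toFun p.1 p.2
  continuous_invFun : Continuous fun p : unitInterval × AngledPoint => invFun p.1 p.2
  left_inv : ∀ t e, invFun t (toFun t e) = e
  right_inv : ∀ t e, toFun t (invFun t e) = e
  map_zero : ∀ e, toFun 0 e = e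
  map_period : ∀ t x u, toFun t (x, u + 2 * Real.pi) =
    ((toFun t (x, u)).1, (toFun t (x, u)).2 + 2 * Real.pi)
  eq_self : ∀ t e, e.1 ∉ U → toFun t e = e

namespace AngleIsotopy

variable {U V : Set (ℝ × ℝ)}

lemma inv_eq_self (Φ : AngleIsotopy U) (t : unitInterval) (e : AngledPoint) (he : e.1 ∉ U) :
    Φ.invFun t e = e := by
  conv_lhs => rw [← Φ.eq_self t e he]
  exact Φ.left_inv t e

lemma inv_zero (Φ : AngleIsotopy U) (e : AngledPoint) : Φ.invFun 0 e = e := by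
  conv_lhs => rw [← Φ.map_zero e]
  exact Φ.left_inv 0 e

lemma inv_period (Φ : AngleIsotopy U) (t : unitInterval) (x : ℝ × ℝ) (u : ℝ) :
    Φ.invFun t (x, u + 2 * Real.pi) =
      ((Φ.invFun t (x, u)).1, (Φ.invFun t (x, u)).2 + 2 * Real.pi) := by
  have h := Φ.map_period t (Φ.invFun t (x, u)).1 (Φ.invFun t (x, u)).2
  rw [Prod.mk.eta, Φ.right_inv] at h
  rw [← Φ.left_inv t ((Φ.invFun t (x, u)).1, (Φ.invFun t (x, u)).2 + 2 * Real.pi), h]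

/-- Points over the complement are fixed by the map and by its inverse, so nothing enters or leaves
the region. -/
lemma mem_iff_mem (Φ : AngleIsotopy U) (t : unitInterval) (e : AngledPoint) :
    (Φ.toFun t e).1 ∈ U ↔ e.1 ∈ U := by
  constructor
  · intro h
    by_contra hn
    exact hn (by rwa [Φ.eq_self t e hn] at h)
  · intro h
    by_contra hn
    have := Φ.inv_eq_self t _ hn
    rw [Φ.left_inv] at this
    exact hn (this ▸ h)

/-- The constant isotopy. -/
def refl (U : Set (ℝ × ℝ)) : AngleIsotopy U where
  toFun _ e := e
  invFun _ e := e
  continuous_toFun := continuous_snd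
  continuous_invFun := continuous_snd
  left_inv _ _ := rfl
  right_inv _ _ := rfl
  map_zero _ := rfl
  map_period _ _ _ := rfl
  eq_self _ _ _ := rfl

/-- The inverse isotopy. -/
def symm (Φ : AngleIsotopy U) : AngleIsotopy U where
  toFun := Φ.invFun
  invFun := Φ.toFun
  continuous_toFun := Φ.continuous_invFun
  continuous_invFun := Φ.continuous_toFun
  left_inv := Φ.right_inv
  right_inv := Φ.left_inv
  map_zero := Φ.inv_zero
  map_period := Φ.inv_period
  eq_self := Φ.inv_eq_self

/-- The pointwise composition of two isotopies. -/
def trans (Φ Ψ : AngleIsotopy U) : AngleIsotopy U where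
  toFun t e := Ψ.toFun t (Φ.toFun t e)
  invFun t e := Φ.invFun t (Ψ.invFun t e)
  continuous_toFun := Ψ.continuous_toFun.comp (continuous_fst.prodMk Φ.continuous_toFun)
  continuous_invFun := Φ.continuous_invFun.comp (continuous_fst.prodMk Ψ.continuous_invFun)
  left_inv t e := by rw [Ψ.left_inv, Φ.left_inv]
  right_inv t e := by rw [Φ.right_inv, Ψ.right_inv]
  map_zero e := by rw [Φ.map_zero, Ψ.map_zero]
  map_period t x u := by rw [Φ.map_period, Ψ.map_period]
  eq_self t e he := by rw [Φ.eq_self t e he, Ψ.eq_self t e he]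

/-- Enlarging the region where the isotopy may differ from the identity. -/
def mono (Φ : AngleIsotopy U) (h : U ⊆ V) : AngleIsotopy V :=
  { Φ with eq_self := fun t e he => Φ.eq_self t e fun h' => he (h h') }

/-- Change of the coordinates of the plane. -/
def conj (Φ : AngleIsotopy U) (j : (ℝ × ℝ) ≃ₜ (ℝ × ℝ)) : AngleIsotopy (j '' U) where
  -- Only the base point is transformed. The angle is still that of the original plane, so `j` need
  -- not be differentiable.
  toFun t e := (j (Φ.toFun t (j.symm e.1, e.2)).1, (Φ.toFun t (j.symm e.1, e.2)).2)
  invFun t e := (j (Φ.invFun t (j.symm e.1, e.2)).1, (Φ.invFun t (j.symm e.1, e.2)).2)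
  continuous_toFun := by
    have h : Continuous fun p : unitInterval × AngledPoint =>
        Φ.toFun p.1 (j.symm p.2.1, p.2.2) :=
      Φ.continuous_toFun.comp (f := fun p : unitInterval × AngledPoint =>
        (p.1, ((j.symm p.2.1, p.2.2) : AngledPoint))) (by fun_prop)
    fun_prop
  continuous_invFun := by
    have h : Continuous fun p : unitInterval × AngledPoint =>
        Φ.invFun p.1 (j.symm p.2.1, p.2.2) :=
      Φ.continuous_invFun.comp (f := fun p : unitInterval × AngledPoint =>
        (p.1, ((j.symm p.2.1, p.2.2) : AngledPoint))) (by fun_prop)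
    fun_prop
  left_inv t e := by simp [Φ.left_inv]
  right_inv t e := by simp [Φ.right_inv]
  map_zero e := by simp [Φ.map_zero]
  map_period t x u := by simp [Φ.map_period]
  eq_self t e he := by
    rw [Φ.eq_self]
    · simp
    · exact fun h => he ⟨_, h, by simp⟩

/-- The rotation of the fibres by `D`. -/
def rotate (D : ℝ × ℝ → ℝ) (hD : Continuous D) (hU : ∀ x ∉ U, D x = 0) : AngleIsotopy U where
  toFun t e := (e.1, e.2 + t * D e.1)
  invFun t e := (e.1, e.2 - t * D e.1)
  continuous_toFun := by fun_prop
  continuous_invFun := by fun_prop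
  left_inv t e := by simp
  right_inv t e := by simp
  map_zero e := by simp
  map_period t x u := by ext <;> simp; ring
  eq_self t e he := by simp [hU _ he]

/-- The conditions under which the points `(r, p r)` can be pushed by `d (r, u)`, depending on the
angle `u`, within the interval from `l r` to `h r`. -/
structure PushData (p l h : ℝ → ℝ) (d : ℝ × ℝ → ℝ) : Prop where
  cont_p : Continuous p
  cont_d : Continuous d
  period : ∀ r u, d (r, u + 2 * Real.pi) = d (r, u)
  cont_l : ∀ r u, d (r, u) ≠ 0 → ContinuousAt l r
  cont_h : ∀ r u, d (r, u) ≠ 0 → ContinuousAt h r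
  lt_p : ∀ r u, d (r, u) ≠ 0 → l r < p r
  p_lt : ∀ r u, d (r, u) ≠ 0 → p r < h r
  lt_q : ∀ r u, d (r, u) ≠ 0 → l r < p r + d (r, u)
  q_lt : ∀ r u, d (r, u) ≠ 0 → p r + d (r, u) < h r

variable {p l h : ℝ → ℝ} {d : ℝ × ℝ → ℝ}

/-- The moved top is a convex combination of `p` and `p + d`, and both of these lie between the
corners. -/
lemma PushData.between (H : PushData p l h d) (r u : ℝ) (hd : d (r, u) ≠ 0) (t : unitInterval) :
    l r < p r + t * d (r, u) ∧ p r + t * d (r, u) < h r := by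
  have h1 := H.lt_p r u hd
  have h2 := H.p_lt r u hd
  have h3 := H.lt_q r u hd
  have h4 := H.q_lt r u hd
  have t0 := t.2.1
  have t1 := t.2.2
  rcases le_total 0 (d (r, u)) with hd0 | hd0
  · have e1 := mul_nonneg t0 hd0
    have e2 := mul_le_of_le_one_left hd0 t1
    constructor <;> linarith
  · have e1 := mul_nonpos_of_nonneg_of_nonpos t0 hd0
    have e2 := mul_le_mul_of_nonpos_right t1 hd0
    constructor <;> linarith

/-- By `tent_push`, the displacement can be read off from the image with the tent whose top is the
moved point. This identity and the next one make the two formulas in `push` mutually inverse. -/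
lemma PushData.tent_eq (H : PushData p l h d) (t : unitInterval) (r v u : ℝ) :
    d (r, u) * tent (l r) (p r + t * d (r, u)) (h r)
      (v + t * (d (r, u) * tent (l r) (p r) (h r) v)) =
    d (r, u) * tent (l r) (p r) (h r) v := by
  by_cases hd : d (r, u) = 0
  · simp [hd]
  have hb := H.between r u hd t
  have := tent_push (H.lt_p r u hd) (H.p_lt r u hd) hb.1 hb.2 v
  rw [show v + t * (d (r, u) * tent (l r) (p r) (h r) v) =
    v + (p r + t * d (r, u) - p r) * tent (l r) (p r) (h r) v by ring, this]

lemma PushData.tent_eq' (H : PushData p l h d) (t : unitInterval) (r v u : ℝ) :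
    d (r, u) * tent (l r) (p r) (h r)
      (v - t * (d (r, u) * tent (l r) (p r + t * d (r, u)) (h r) v)) =
    d (r, u) * tent (l r) (p r + t * d (r, u)) (h r) v := by
  by_cases hd : d (r, u) = 0
  · simp [hd]
  have hb := H.between r u hd t
  have := tent_push hb.1 hb.2 (H.lt_p r u hd) (H.p_lt r u hd) v
  rw [show v - t * (d (r, u) * tent (l r) (p r + t * d (r, u)) (h r) v) =
    v + (p r - (p r + t * d (r, u))) * tent (l r) (p r + t * d (r, u)) (h r) v by ring, this]

/-- Pushing the points `((r, p r), u)` to `((r, p r + d (r, u)), u)`. -/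
def push (H : PushData p l h d)
    (hU : ∀ r u v, d (r, u) ≠ 0 → l r < v → v < h r → (r, v) ∈ U) : AngleIsotopy U where
  toFun t e := ((e.1.1, e.1.2 + t * (d (e.1.1, e.2) * tent (l e.1.1) (p e.1.1) (h e.1.1) e.1.2)),
    e.2)
  invFun t e := ((e.1.1, e.1.2 - t * (d (e.1.1, e.2) *
    tent (l e.1.1) (p e.1.1 + t * d (e.1.1, e.2)) (h e.1.1) e.1.2)), e.2)
  continuous_toFun := by
    have hp := H.cont_p
    have hd := H.cont_d
    have hc := continuous_mul_tent (Y := unitInterval × AngledPoint)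
      (D := fun e => d (e.2.1.1, e.2.2)) (L := fun e => l e.2.1.1) (P := fun e => p e.2.1.1)
      (H := fun e => h e.2.1.1) (V := fun e => e.2.1.2) (by fun_prop) (by fun_prop) (by fun_prop)
      (fun e he => ⟨(H.cont_l _ _ he).comp (f := fun e : unitInterval × AngledPoint => e.2.1.1)
        (by fun_prop), (H.cont_h _ _ he).comp (f := fun e : unitInterval × AngledPoint => e.2.1.1)
        (by fun_prop), H.lt_p _ _ he, H.p_lt _ _ he⟩)
    fun_prop
  continuous_invFun := by
    have hp := H.cont_p
    have hd := H.cont_d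
    have hc := continuous_mul_tent (Y := unitInterval × AngledPoint)
      (D := fun e => d (e.2.1.1, e.2.2)) (L := fun e => l e.2.1.1)
      (P := fun e => p e.2.1.1 + e.1 * d (e.2.1.1, e.2.2))
      (H := fun e => h e.2.1.1) (V := fun e => e.2.1.2) (by fun_prop) (by fun_prop) (by fun_prop)
      (fun e he => ⟨(H.cont_l _ _ he).comp (f := fun e : unitInterval × AngledPoint => e.2.1.1)
        (by fun_prop), (H.cont_h _ _ he).comp (f := fun e : unitInterval × AngledPoint => e.2.1.1)
        (by fun_prop), (H.between _ _ he _).1, (H.between _ _ he _).2⟩)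
    fun_prop
  left_inv t e := by
    obtain ⟨⟨r, v⟩, u⟩ := e
    simp only [H.tent_eq t r v u, add_sub_cancel_right]
  right_inv t e := by
    obtain ⟨⟨r, v⟩, u⟩ := e
    simp only [H.tent_eq' t r v u, sub_add_cancel]
  map_zero e := by simp
  map_period t x u := by simp [H.period]
  eq_self t e he := by
    obtain ⟨⟨r, v⟩, u⟩ := e
    by_cases hd : d (r, u) = 0
    · simp [hd]
    · have : tent (l r) (p r) (h r) v = 0 := by
        rcases le_or_gt v (l r) with hv | hv
        · exact tent_of_le_left (H.lt_p r u hd) hv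
        rcases le_or_gt (h r) v with hv' | hv'
        · exact tent_of_right_le (H.p_lt r u hd) hv'
        exact absurd (hU r u v hd hv hv') he
      simp [this]

end AngleIsotopy

/-- `S` can be carried onto `S'` by an isotopy over `U` which carries each of the sets in `Λ` onto
itself. -/
def IsotopicRel (U : Set (ℝ × ℝ)) (Λ : Set (Set AngledPoint)) (S S' : Set AngledPoint) : Prop :=
  ∃ Φ : AngleIsotopy U, (∀ e, Φ.toFun 1 e ∈ S' ↔ e ∈ S) ∧
    ∀ A ∈ Λ, ∀ e, Φ.toFun 1 e ∈ A ↔ e ∈ A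

/-! ### Calculus of relative isotopies -/

namespace IsotopicRel

variable {U V : Set (ℝ × ℝ)} {Λ : Set (Set AngledPoint)} {S S' S'' R : Set AngledPoint}

lemma refl (U : Set (ℝ × ℝ)) (Λ : Set (Set AngledPoint)) (S : Set AngledPoint) :
    IsotopicRel U Λ S S := ⟨AngleIsotopy.refl U, fun _ => Iff.rfl, fun _ _ _ => Iff.rfl⟩

lemma symm (h : IsotopicRel U Λ S S') : IsotopicRel U Λ S' S := by
  obtain ⟨Φ, h1, h2⟩ := h
  refine ⟨Φ.symm, fun e => ?_, fun A hA e => ?_⟩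
  · rw [← h1]; simp [AngleIsotopy.symm, Φ.right_inv]
  · rw [← h2 A hA]; simp [AngleIsotopy.symm, Φ.right_inv]

lemma trans (h : IsotopicRel U Λ S S') (h' : IsotopicRel U Λ S' S'') : IsotopicRel U Λ S S'' := by
  obtain ⟨Φ, h1, h2⟩ := h
  obtain ⟨Ψ, h1', h2'⟩ := h'
  refine ⟨Φ.trans Ψ, fun e => ?_, fun A hA e => ?_⟩
  · rw [← h1, ← h1']; rfl
  · exact (h2' A hA _).trans (h2 A hA e)

lemma mono (h : IsotopicRel U Λ S S') (hUV : U ⊆ V) : IsotopicRel V Λ S S' := by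
  obtain ⟨Φ, h1, h2⟩ := h
  exact ⟨Φ.mono hUV, h1, h2⟩

/-- Sets over the complement of `U` may be added to both sides and to the preserved sets. -/
lemma union (h : IsotopicRel U ∅ S S') (hR : ∀ e ∈ R, e.1 ∉ U) (hΛ : ∀ A ∈ Λ, ∀ e ∈ A, e.1 ∉ U) :
    IsotopicRel U Λ (R ∪ S) (R ∪ S') := by
  obtain ⟨Φ, h1, -⟩ := h
  have key : ∀ B : Set AngledPoint, (∀ e ∈ B, e.1 ∉ U) → ∀ e, Φ.toFun 1 e ∈ B ↔ e ∈ B := by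
    intro B hB e
    constructor
    · intro he
      have := mt (Φ.mem_iff_mem 1 e).2 (hB _ he)
      rwa [Φ.eq_self 1 e this] at he
    · intro he
      rwa [Φ.eq_self 1 e (hB e he)]
  refine ⟨Φ, fun e => ?_, fun A hA => key A (hΛ A hA)⟩
  rw [mem_union, mem_union, key R hR, h1]

lemma conj (h : IsotopicRel U Λ S S') (j : (ℝ × ℝ) ≃ₜ (ℝ × ℝ)) :
    IsotopicRel (j '' U) ((fun B => {e | (j.symm e.1, e.2) ∈ B}) '' Λ)
      {e | (j.symm e.1, e.2) ∈ S} {e | (j.symm e.1, e.2) ∈ S'} := by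
  obtain ⟨Φ, h1, h2⟩ := h
  refine ⟨Φ.conj j, fun e => ?_, ?_⟩
  · simp [AngleIsotopy.conj, h1]
  · rintro _ ⟨A, hA, rfl⟩ e
    simp [AngleIsotopy.conj, h2 A hA]

lemma of_mapsTo (Φ : AngleIsotopy U) (h1 : ∀ e ∈ S, Φ.toFun 1 e ∈ S')
    (h2 : ∀ e ∈ S', Φ.invFun 1 e ∈ S) (hΛ : ∀ A ∈ Λ, ∀ e, Φ.toFun 1 e ∈ A ↔ e ∈ A) :
    IsotopicRel U Λ S S' :=
  ⟨Φ, fun e => ⟨fun h => by simpa [Φ.left_inv] using h2 _ h, h1 e⟩, hΛ⟩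

end IsotopicRel

/-! ## Strands -/

/-- The lift of the curve `c`, parametrized by `I`, with the angle `σ`, which matters up to multiples
of `π`. -/
def strand (c : ℝ → ℝ × ℝ) (σ : ℝ → ℝ) (I : Set ℝ) : Set AngledPoint :=
  {e | ∃ r ∈ I, e.1 = c r ∧ ∃ k : ℤ, e.2 = σ r + k * Real.pi}

lemma strand_congr {c c' : ℝ → ℝ × ℝ} {σ σ' : ℝ → ℝ} {I : Set ℝ} (hc : ∀ r ∈ I, c r = c' r)
    (hσ : ∀ r ∈ I, σ r = σ' r) : strand c σ I = strand c' σ' I := by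
  ext e
  constructor
  · rintro ⟨r, hr, h1, k, h2⟩
    exact ⟨r, hr, by rw [h1, hc r hr], k, by rw [h2, hσ r hr]⟩
  · rintro ⟨r, hr, h1, k, h2⟩
    exact ⟨r, hr, by rw [h1, hc r hr], k, by rw [h2, hσ r hr]⟩

lemma strand_union (c : ℝ → ℝ × ℝ) (σ : ℝ → ℝ) (I J : Set ℝ) :
    strand c σ (I ∪ J) = strand c σ I ∪ strand c σ J := by
  ext e
  constructor
  · rintro ⟨r, hr | hr, h⟩
    · exact Or.inl ⟨r, hr, h⟩
    · exact Or.inr ⟨r, hr, h⟩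
  · rintro (⟨r, hr, h⟩ | ⟨r, hr, h⟩)
    · exact ⟨r, Or.inl hr, h⟩
    · exact ⟨r, Or.inr hr, h⟩

lemma strand_comp (c : ℝ → ℝ × ℝ) (σ φ : ℝ → ℝ) (I : Set ℝ) :
    strand (c ∘ φ) (σ ∘ φ) I = strand c σ (φ '' I) := by
  ext e
  constructor
  · rintro ⟨r, hr, h⟩
    exact ⟨φ r, ⟨r, hr, rfl⟩, h⟩
  · rintro ⟨_, ⟨r, hr, rfl⟩, h⟩
    exact ⟨r, hr, h⟩

/-- Pushes and rotations need functions on the whole line; functions given on an interval are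
extended by their end values. -/
lemma continuous_comp_clamp {f : ℝ → ℝ} {a b : ℝ} (hab : a ≤ b) (hf : ContinuousOn f (Icc a b)) :
    Continuous fun r => f (max a (min b r)) :=
  hf.comp_continuous (by fun_prop) fun r => ⟨le_max_left _ _, max_le hab (min_le_left _ _)⟩

lemma clamp_of_mem {a b r : ℝ} (hr : r ∈ Icc a b) : max a (min b r) = r := by
  rw [min_eq_right hr.2, max_eq_right hr.1]

lemma clamp_cases {a b : ℝ} (hab : a ≤ b) (r : ℝ) :
    (r ∈ Ioo a b ∧ max a (min b r) = r) ∨ (r ∉ Ioo a b ∧ (max a (min b r) = a ∨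
      max a (min b r) = b)) := by
  by_cases hr : r ∈ Ioo a b
  · exact Or.inl ⟨hr, clamp_of_mem ⟨hr.1.le, hr.2.le⟩⟩
  · refine Or.inr ⟨hr, ?_⟩
    rcases le_or_gt r a with h | h
    · left; rw [min_eq_right (h.trans hab), max_eq_left h]
    · have : b ≤ r := by by_contra hc; exact hr ⟨h, not_le.1 hc⟩
      right; rw [min_eq_left this, max_eq_right hab]

/-- A strand over a graph can be pushed to another graph with the same ends, within the region
between the graphs of `l` and `h`. Sets which depend on the abscissa and the angle only in that
region are preserved. -/
lemma isotopicRel_strand_push {a b : ℝ} (hab : a < b) {g g' l h : ℝ → ℝ} (σ : ℝ → ℝ)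
    {Λ : Set (Set AngledPoint)}
    (hg : ContinuousOn g (Icc a b)) (hg' : ContinuousOn g' (Icc a b))
    (hl : ContinuousOn l (Ioo a b)) (hh : ContinuousOn h (Ioo a b))
    (hlg : ∀ r ∈ Ioo a b, l r < g r ∧ g r < h r) (hlg' : ∀ r ∈ Ioo a b, l r < g' r ∧ g' r < h r)
    (hga : g a = g' a) (hgb : g b = g' b)
    (hΛ : ∀ B ∈ Λ, ∀ r ∈ Ioo a b, ∀ v ∈ Ioo (l r) (h r), ∀ v' ∈ Ioo (l r) (h r), ∀ u,
      ((r, v), u) ∈ B → ((r, v'), u) ∈ B) :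
    IsotopicRel {x | x.1 ∈ Ioo a b ∧ l x.1 < x.2 ∧ x.2 < h x.1} Λ
      (strand (fun r => (r, g r)) σ (Icc a b)) (strand (fun r => (r, g' r)) σ (Icc a b)) := by
  set κ : ℝ → ℝ := fun r => max a (min b r) with hκ
  have hκI : ∀ r ∈ Icc a b, κ r = r := fun r hr => clamp_of_mem hr
  -- Since the ends agree, the clamped difference vanishes off the open interval, which bounds the
  -- support of the motion.
  have hdiff : ∀ (φ φ' : ℝ → ℝ), φ a = φ' a → φ b = φ' b → ∀ r, φ' (κ r) - φ (κ r) ≠ 0 →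
      r ∈ Ioo a b := by
    intro φ φ' h1 h2 r hr
    rcases clamp_cases hab.le r with h | ⟨-, h | h⟩
    · exact h.1
    · exact absurd (by simp only [hκ, h, h1, sub_self]) hr
    · exact absurd (by simp only [hκ, h, h2, sub_self]) hr
  have hcg := continuous_comp_clamp hab.le hg
  have hcg' := continuous_comp_clamp hab.le hg'
  have hIcc : ∀ r, r ∈ Ioo a b → r ∈ Icc a b := fun r hr => Ioo_subset_Icc_self hr
  have H : AngleIsotopy.PushData (fun r => g (κ r)) l h
      (fun x => g' (κ x.1) - g (κ x.1)) := by
    refine ⟨hcg, ?_, fun _ _ => rfl, ?_, ?_, ?_, ?_, ?_, ?_⟩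
    · exact (hcg'.comp continuous_fst).sub (hcg.comp continuous_fst)
    all_goals
      intro r u hd
      have hr := hdiff g g' hga hgb r hd
      have hr' := hκI r (hIcc r hr)
    · exact hl.continuousAt (Ioo_mem_nhds hr.1 hr.2)
    · exact hh.continuousAt (Ioo_mem_nhds hr.1 hr.2)
    · simpa only [hr'] using (hlg r hr).1
    · simpa only [hr'] using (hlg r hr).2
    · simpa only [hr', add_sub_cancel] using (hlg' r hr).1
    · simpa only [hr', add_sub_cancel] using (hlg' r hr).2
  refine IsotopicRel.of_mapsTo (AngleIsotopy.push H fun r u v hd h1 h2 =>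
    ⟨hdiff g g' hga hgb r hd, h1, h2⟩) ?_ ?_ ?_
  · rintro ⟨x, u⟩ ⟨r, hr, rfl, k, hk⟩
    refine ⟨r, hr, ?_, k, hk⟩
    simp only [AngleIsotopy.push, hκI r hr, Icc.coe_one, one_mul, Prod.mk.injEq, true_and]
    by_cases hd : g' r - g r = 0
    · rw [hd]; linarith
    · have hr' := hdiff g g' hga hgb r (by rwa [hκI r hr])
      rw [tent_self (hlg r hr').1 (hlg r hr').2]; ring
  · rintro ⟨x, u⟩ ⟨r, hr, rfl, k, hk⟩
    refine ⟨r, hr, ?_, k, hk⟩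
    simp only [AngleIsotopy.push, hκI r hr, Icc.coe_one, one_mul, Prod.mk.injEq, true_and,
      add_sub_cancel]
    by_cases hd : g' r - g r = 0
    · rw [hd]; linarith
    · have hr' := hdiff g g' hga hgb r (by rwa [hκI r hr])
      rw [tent_self (hlg' r hr').1 (hlg' r hr').2]; ring
  · intro B hB e
    set Φ : AngleIsotopy {x : ℝ × ℝ | x.1 ∈ Ioo a b ∧ l x.1 < x.2 ∧ x.2 < h x.1} :=
      AngleIsotopy.push H fun r u v hd h1 h2 => ⟨hdiff g g' hga hgb r hd, h1, h2⟩
    by_cases he : e.1 ∈ {x : ℝ × ℝ | x.1 ∈ Ioo a b ∧ l x.1 < x.2 ∧ x.2 < h x.1}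
    · have he' := (Φ.mem_iff_mem 1 e).2 he
      exact ⟨hΛ B hB _ he.1 _ he'.2 _ he.2 _, hΛ B hB _ he.1 _ he.2 _ he'.2 _⟩
    · rw [Φ.eq_self 1 e he]

/-- Two strands over graphs in the region between the graphs of `l` and `h`, with equal ends and
equal angles at the ends, are isotopic within the region. -/
lemma isotopicRel_strand_graph {a b : ℝ} (hab : a < b) {g g' σ σ' l h : ℝ → ℝ}
    (hg : ContinuousOn g (Icc a b)) (hg' : ContinuousOn g' (Icc a b))
    (hσ : ContinuousOn σ (Icc a b)) (hσ' : ContinuousOn σ' (Icc a b))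
    (hl : ContinuousOn l (Ioo a b)) (hh : ContinuousOn h (Ioo a b))
    (hlg : ∀ r ∈ Ioo a b, l r < g r ∧ g r < h r) (hlg' : ∀ r ∈ Ioo a b, l r < g' r ∧ g' r < h r)
    (hga : g a = g' a) (hgb : g b = g' b) (hσa : σ a = σ' a) (hσb : σ b = σ' b) :
    IsotopicRel {x | x.1 ∈ Ioo a b ∧ l x.1 < x.2 ∧ x.2 < h x.1} ∅
      (strand (fun r => (r, g r)) σ (Icc a b)) (strand (fun r => (r, g' r)) σ' (Icc a b)) := by
  set κ : ℝ → ℝ := fun r => max a (min b r) with hκ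
  have hκI : ∀ r ∈ Icc a b, κ r = r := fun r hr => clamp_of_mem hr
  have hdiff : ∀ (φ φ' : ℝ → ℝ), φ a = φ' a → φ b = φ' b → ∀ r, φ' (κ r) - φ (κ r) ≠ 0 →
      r ∈ Ioo a b := by
    intro φ φ' h1 h2 r hr
    rcases clamp_cases hab.le r with h | ⟨-, h | h⟩
    · exact h.1
    · exact absurd (by simp only [hκ, h, h1, sub_self]) hr
    · exact absurd (by simp only [hκ, h, h2, sub_self]) hr
  have hcg' := continuous_comp_clamp hab.le hg'
  have hcσ := continuous_comp_clamp hab.le hσ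
  have hcσ' := continuous_comp_clamp hab.le hσ'
  have hIcc : ∀ r, r ∈ Ioo a b → r ∈ Icc a b := fun r hr => Ioo_subset_Icc_self hr
  have step1 := isotopicRel_strand_push hab σ (Λ := ∅) hg hg' hl hh hlg hlg' hga hgb (by simp)
  refine step1.trans ?_
  -- The graphs now coincide and only the angles differ. The fibres are rotated by the difference of
  -- the angles, tapered off by a tent with its top on the graph.
  have hD : Continuous fun x : ℝ × ℝ => (σ' (κ x.1) - σ (κ x.1)) *
      tent (l x.1) (g' (κ x.1)) (h x.1) x.2 := by
    refine continuous_mul_tent ((hcσ'.comp continuous_fst).sub (hcσ.comp continuous_fst))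
      (hcg'.comp continuous_fst) continuous_snd ?_
    intro x hx
    have hr := hdiff σ σ' hσa hσb x.1 hx
    refine ⟨(hl.continuousAt (Ioo_mem_nhds hr.1 hr.2)).comp continuousAt_fst,
      (hh.continuousAt (Ioo_mem_nhds hr.1 hr.2)).comp continuousAt_fst, ?_⟩
    rw [hκI _ (hIcc _ hr)]
    exact hlg' _ hr
  have hval : ∀ r ∈ Icc a b, (σ' (κ r) - σ (κ r)) * tent (l r) (g' (κ r)) (h r) (g' r) =
      σ' r - σ r := by
    intro r hr
    by_cases hd : σ' (κ r) - σ (κ r) = 0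
    · rw [hd, zero_mul, ← hd, hκI r hr]
    · have hr' := hdiff σ σ' hσa hσb r hd
      rw [hκI r hr, tent_self (hlg' r hr').1 (hlg' r hr').2, mul_one]
  refine IsotopicRel.of_mapsTo (AngleIsotopy.rotate _ hD fun x hx => ?_) ?_ ?_ (by simp)
  · by_cases hd : σ' (κ x.1) - σ (κ x.1) = 0
    · rw [hd, zero_mul]
    · have hr := hdiff σ σ' hσa hσb x.1 hd
      have hb := hlg' _ hr
      rw [hκI _ (hIcc _ hr)]
      rcases le_or_gt x.2 (l x.1) with hv | hv
      · rw [tent_of_le_left hb.1 hv, mul_zero]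
      rcases le_or_gt (h x.1) x.2 with hv' | hv'
      · rw [tent_of_right_le hb.2 hv', mul_zero]
      exact absurd ⟨hr, hv, hv'⟩ hx
  · rintro ⟨x, u⟩ ⟨r, hr, rfl, k, hk⟩
    refine ⟨r, hr, rfl, k, ?_⟩
    simp only [AngleIsotopy.rotate, Icc.coe_one, one_mul, hval r hr] at hk ⊢
    rw [hk]; ring
  · rintro ⟨x, u⟩ ⟨r, hr, rfl, k, hk⟩
    refine ⟨r, hr, rfl, k, ?_⟩
    simp only [AngleIsotopy.rotate, Icc.coe_one, one_mul, hval r hr] at hk ⊢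
    rw [hk]; ring

/-! ## From angles to the piecewise linear sphere -/

/-- The vector of maximum norm `1` in the direction of the angle `u`. -/
def angleDir (u : ℝ) : ℝ × ℝ :=
  (max |Real.cos u| |Real.sin u|)⁻¹ • (Real.cos u, Real.sin u)

lemma max_abs_cos_sin_pos (u : ℝ) : 0 < max |Real.cos u| |Real.sin u| := by
  by_contra h
  have h1 : |Real.cos u| ≤ 0 := (le_max_left _ _).trans (not_lt.1 h)
  have h2 : |Real.sin u| ≤ 0 := (le_max_right _ _).trans (not_lt.1 h)
  have := Real.sin_sq_add_cos_sq u
  rw [abs_nonpos_iff.1 h1, abs_nonpos_iff.1 h2] at this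
  norm_num at this

lemma norm_cos_sin (u : ℝ) : ‖((Real.cos u, Real.sin u) : ℝ × ℝ)‖ =
    max |Real.cos u| |Real.sin u| := rfl

lemma norm_angleDir (u : ℝ) : ‖angleDir u‖ = 1 := by
  have := max_abs_cos_sin_pos u
  rw [angleDir, norm_smul, norm_cos_sin, Real.norm_of_nonneg (inv_nonneg.2 this.le),
    inv_mul_cancel₀ this.ne']

lemma continuous_angleDir : Continuous angleDir := by
  unfold angleDir
  refine Continuous.smul (Continuous.inv₀ (by fun_prop) fun u => (max_abs_cos_sin_pos u).ne') ?_
  fun_prop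

lemma angleDir_add_int_mul (u : ℝ) (k : ℤ) : angleDir (u + k * (2 * Real.pi)) = angleDir u := by
  simp only [angleDir, Real.cos_add_int_mul_two_pi, Real.sin_add_int_mul_two_pi]

/-- The angle comes from a compact interval so that the sphere becomes a quotient of a compact box.
-/
lemma exists_smul_angleDir (y : ℝ × ℝ) : ∃ u ∈ Icc 0 (2 * Real.pi), y = ‖y‖ • angleDir u := by
  have hpi := Real.pi_pos
  have key : ∃ a : ℝ, y = ‖y‖ • angleDir a ∧ -Real.pi < a ∧ a ≤ Real.pi := by
    refine ⟨Complex.arg ⟨y.1, y.2⟩, ?_, Complex.neg_pi_lt_arg _, Complex.arg_le_pi _⟩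
    set z : ℂ := ⟨y.1, y.2⟩
    by_cases hz : z = 0
    · have h1 : y.1 = 0 := congrArg Complex.re hz
      have h2 : y.2 = 0 := congrArg Complex.im hz
      have : y = 0 := Prod.ext h1 h2
      rw [this]; simp
    · have h1 : ‖z‖ * Real.cos z.arg = y.1 := Complex.norm_mul_cos_arg z
      have h2 : ‖z‖ * Real.sin z.arg = y.2 := Complex.norm_mul_sin_arg z
      have hy : y = ‖z‖ • (Real.cos z.arg, Real.sin z.arg) := by
        ext
        · simp [← h1]
        · simp [← h2]
      have hn : ‖y‖ = ‖z‖ * max |Real.cos z.arg| |Real.sin z.arg| := by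
        conv_lhs => rw [hy]
        rw [norm_smul, norm_cos_sin, norm_norm]
      have hp := max_abs_cos_sin_pos z.arg
      rw [hn, angleDir, smul_smul, mul_assoc, mul_inv_cancel₀ hp.ne', mul_one]
      exact hy
  obtain ⟨a, ha, h1, h2⟩ := key
  rcases le_or_gt 0 a with h | h
  · exact ⟨a, ⟨h, by linarith⟩, ha⟩
  · refine ⟨a + (1 : ℤ) * (2 * Real.pi), ⟨?_, ?_⟩, ?_⟩
    · push_cast; linarith
    · push_cast; linarith
    · rwa [angleDir_add_int_mul]

/-- Both vectors are positive multiples of Euclidean unit vectors. Comparing Euclidean norms makes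
the two factors equal, and then sine and cosine agree. -/
lemma exists_int_of_angleDir_eq {u v : ℝ} (h : angleDir u = angleDir v) :
    ∃ k : ℤ, u = v + k * (2 * Real.pi) := by
  have hu := max_abs_cos_sin_pos u
  have hv := max_abs_cos_sin_pos v
  set a := (max |Real.cos u| |Real.sin u|)⁻¹ with ha
  set b := (max |Real.cos v| |Real.sin v|)⁻¹ with hb
  have ha0 : 0 < a := inv_pos.2 hu
  have hb0 : 0 < b := inv_pos.2 hv
  have h1 : a * Real.cos u = b * Real.cos v := congrArg Prod.fst h
  have h2 : a * Real.sin u = b * Real.sin v := congrArg Prod.snd h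
  have hab : a = b := by
    have e : a ^ 2 = b ^ 2 := by
      calc a ^ 2 = (a * Real.cos u) ^ 2 + (a * Real.sin u) ^ 2 := by
            rw [mul_pow, mul_pow, ← mul_add, Real.cos_sq_add_sin_sq, mul_one]
        _ = (b * Real.cos v) ^ 2 + (b * Real.sin v) ^ 2 := by rw [h1, h2]
        _ = b ^ 2 := by rw [mul_pow, mul_pow, ← mul_add, Real.cos_sq_add_sin_sq, mul_one]
    exact (pow_left_inj₀ ha0.le hb0.le two_ne_zero).1 e
  rw [hab] at h1 h2
  have hA : (u : Real.Angle) = v :=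
    Real.Angle.cos_sin_inj (mul_left_cancel₀ hb0.ne' h1) (mul_left_cancel₀ hb0.ne' h2)
  obtain ⟨k, hk⟩ := Real.Angle.angle_eq_iff_two_pi_dvd_sub.1 hA
  exact ⟨k, by linarith⟩

lemma continuous_boundaryDist (R : ℝ) : Continuous (boundaryDist R) := by
  unfold boundaryDist
  fun_prop

lemma boundaryDist_nonneg {R : ℝ} {x : ℝ × ℝ} (hx : x ∈ rectangle R) : 0 ≤ boundaryDist R x := by
  obtain ⟨h1, h2⟩ := hx
  simp only [boundaryDist, le_min_iff]
  exact ⟨⟨by linarith [h1.1], by linarith [h1.2]⟩, by linarith [h2.1], by linarith [h2.2]⟩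

lemma boundaryDist_pos {R : ℝ} {x : ℝ × ℝ} (hx : x ∈ Ioo (-R) R ×ˢ Ioo (-1 : ℝ) 1) :
    0 < boundaryDist R x := by
  obtain ⟨h1, h2⟩ := hx
  simp only [boundaryDist, lt_min_iff]
  exact ⟨⟨by linarith [h1.1], by linarith [h1.2]⟩, by linarith [h2.1], by linarith [h2.2]⟩

/-- The point of the sphere over the point `e.1` of the rectangle in the direction of the angle
`e.2`. -/
def spherePoint (R : ℝ) (e : AngledPoint) (he : e.1 ∈ rectangle R) : plSphere R :=
  ⟨(e.1, boundaryDist R e.1 • angleDir e.2), he, by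
    rw [norm_smul, norm_angleDir, mul_one, Real.norm_of_nonneg (boundaryDist_nonneg he)]⟩

lemma exists_spherePoint (R : ℝ) (w : plSphere R) :
    ∃ u ∈ Icc 0 (2 * Real.pi), w = spherePoint R (w.1.1, u) w.2.1 := by
  obtain ⟨u, hu, h⟩ := exists_smul_angleDir w.1.2
  refine ⟨u, hu, Subtype.ext (Prod.ext rfl (h.trans ?_))⟩
  exact congrArg (· • angleDir u) w.2.2

namespace AngleIsotopy

variable {U : Set (ℝ × ℝ)} {R : ℝ}

lemma map_add_int_mul (Φ : AngleIsotopy U) (t : unitInterval) (x : ℝ × ℝ) (u : ℝ) (k : ℤ) :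
    Φ.toFun t (x, u + k * (2 * Real.pi)) =
      ((Φ.toFun t (x, u)).1, (Φ.toFun t (x, u)).2 + k * (2 * Real.pi)) := by
  induction k using Int.induction_on with
  | zero => simp
  | succ i ih =>
    have := Φ.map_period t x (u + (i : ℤ) * (2 * Real.pi))
    rw [ih] at this
    rw [show u + ((i + 1 : ℤ) : ℝ) * (2 * Real.pi) =
      u + (i : ℤ) * (2 * Real.pi) + 2 * Real.pi by push_cast; ring, this]
    refine Prod.ext rfl ?_
    push_cast; ring
  | pred i ih =>
    have := Φ.map_period t x (u + ((-(i : ℤ) - 1 : ℤ) : ℝ) * (2 * Real.pi))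
    rw [show u + ((-(i : ℤ) - 1 : ℤ) : ℝ) * (2 * Real.pi) + 2 * Real.pi =
      u + ((-(i : ℤ) : ℤ) : ℝ) * (2 * Real.pi) by push_cast; ring, ih] at this
    have h1 := congrArg Prod.fst this
    have h2 := congrArg Prod.snd this
    simp only at h1 h2
    refine Prod.ext h1.symm ?_
    push_cast at h2 ⊢
    linarith

lemma mem_rectangle (hU : U ⊆ Ioo (-R) R ×ˢ Ioo (-1 : ℝ) 1) (Φ : AngleIsotopy U) (t : unitInterval) {e : AngledPoint}
    (he : e.1 ∈ rectangle R) : (Φ.toFun t e).1 ∈ rectangle R := by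
  by_cases h : e.1 ∈ U
  · have := hU ((Φ.mem_iff_mem t e).2 h)
    exact ⟨Ioo_subset_Icc_self this.1, Ioo_subset_Icc_self this.2⟩
  · rwa [Φ.eq_self t e h]

variable (hU : U ⊆ Ioo (-R) R ×ˢ Ioo (-1 : ℝ) 1)

/-- The isotopy of the sphere induced by an isotopy of the bundle of angles. -/
def sphereMap (Φ : AngleIsotopy U) (t : unitInterval) (w : plSphere R) : plSphere R :=
  spherePoint R (Φ.toFun t (w.1.1, (exists_spherePoint R w).choose))
    (Φ.mem_rectangle hU t w.2.1)

/-- The chosen angle is immaterial. If the distance to the boundary is nonzero, two angles of a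
vector differ by a multiple of 2π and periodicity applies; if it is zero, the isotopy fixes the
point and the fibre is a single zero vector. -/
lemma sphereMap_spherePoint (Φ : AngleIsotopy U) (t : unitInterval) (e : AngledPoint)
    (he : e.1 ∈ rectangle R) : Φ.sphereMap hU t (spherePoint R e he) =
      spherePoint R (Φ.toFun t e) (Φ.mem_rectangle hU t he) := by
  obtain ⟨x, u⟩ := e
  set w := spherePoint R (x, u) he with hw
  obtain ⟨-, hu'⟩ := (exists_spherePoint R w).choose_spec
  set u' := (exists_spherePoint R w).choose with hu'_def
  have hdef : Φ.sphereMap hU t w = spherePoint R (Φ.toFun t (x, u')) (Φ.mem_rectangle hU t he) := rfl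
  rw [hdef]
  have hval : boundaryDist R x • angleDir u = boundaryDist R x • angleDir u' :=
    congrArg (fun w : plSphere R => w.1.2) hu'
  by_cases hd : boundaryDist R x = 0
  · have hx : x ∉ U := fun h => (boundaryDist_pos (hU h)).ne' hd
    apply Subtype.ext
    simp only [spherePoint, Φ.eq_self t (x, u) hx, Φ.eq_self t (x, u') hx, hd, zero_smul]
  · obtain ⟨k, hk⟩ := exists_int_of_angleDir_eq (smul_right_injective _ hd hval)
    apply Subtype.ext
    simp only [spherePoint, hk, Φ.map_add_int_mul, angleDir_add_int_mul]

/-- The angle of a vector cannot be chosen continuously. Continuity is therefore tested on a compact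
box of points with angles, whose map onto the sphere (times the time interval) is closed and hence a
quotient map. -/
lemma continuous_sphereMap (Φ : AngleIsotopy U) :
    Continuous fun p : unitInterval × plSphere R => Φ.sphereMap hU p.1 p.2 := by
  let Z : Set AngledPoint := rectangle R ×ˢ Icc 0 (2 * Real.pi)
  have hZ : IsCompact Z := (isCompact_Icc.prod isCompact_Icc).prod isCompact_Icc
  have : CompactSpace Z := isCompact_iff_compactSpace.1 hZ
  have hcont : ∀ {Y : Type} [TopologicalSpace Y] (f : Y → AngledPoint) (hf : Continuous f)
      (hm : ∀ y, (f y).1 ∈ rectangle R), Continuous fun y => spherePoint R (f y) (hm y) := by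
    intro Y _ f hf hm
    refine Continuous.subtype_mk ?_ _
    exact (continuous_fst.comp hf).prodMk
      (((continuous_boundaryDist R).comp (continuous_fst.comp hf)).smul
        (continuous_angleDir.comp (continuous_snd.comp hf)))
  let q : unitInterval × Z → unitInterval × plSphere R :=
    fun p => (p.1, spherePoint R p.2.1 p.2.2.1)
  have hq : Continuous q := continuous_fst.prodMk
    (hcont (fun p : unitInterval × Z => p.2.1) (by fun_prop) fun p => p.2.2.1)
  have hsurj : Function.Surjective q := by
    rintro ⟨t, w⟩
    obtain ⟨u, hu, h⟩ := exists_spherePoint R w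
    exact ⟨(t, ⟨(w.1.1, u), w.2.1, hu⟩), Prod.ext rfl h.symm⟩
  have hquot : IsQuotientMap q := hq.isClosedMap.isQuotientMap hq hsurj
  rw [hquot.continuous_iff]
  have : ((fun p : unitInterval × plSphere R => Φ.sphereMap hU p.1 p.2) ∘ q) =
      fun p : unitInterval × Z => spherePoint R (Φ.toFun p.1 p.2.1)
        (Φ.mem_rectangle hU p.1 p.2.2.1) := by
    funext p
    exact Φ.sphereMap_spherePoint hU p.1 p.2.1 p.2.2.1
  rw [this]
  exact hcont (fun p : unitInterval × Z => Φ.toFun p.1 p.2.1)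
    (Φ.continuous_toFun.comp (f := fun p : unitInterval × Z => (p.1, p.2.1)) (by fun_prop)) _

lemma sphereMap_symm_sphereMap (Φ : AngleIsotopy U) (t : unitInterval) (w : plSphere R) :
    Φ.symm.sphereMap hU t (Φ.sphereMap hU t w) = w := by
  obtain ⟨u, -, h⟩ := exists_spherePoint R w
  conv_lhs => rw [h]
  rw [sphereMap_spherePoint, sphereMap_spherePoint]
  conv_rhs => rw [h]
  congr 1
  exact Φ.left_inv t _

/-- The homeomorphisms of the sphere induced by an isotopy of the bundle of angles. -/
def sphereHomeomorph (Φ : AngleIsotopy U) (t : unitInterval) : plSphere R ≃ₜ plSphere R where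
  toFun := Φ.sphereMap hU t
  invFun := Φ.symm.sphereMap hU t
  left_inv := Φ.sphereMap_symm_sphereMap hU t
  right_inv := Φ.symm.sphereMap_symm_sphereMap hU t
  continuous_toFun := (Φ.continuous_sphereMap hU).comp (by fun_prop : Continuous fun w => (t, w))
  continuous_invFun := (Φ.symm.continuous_sphereMap hU).comp
    (by fun_prop : Continuous fun w => (t, w))

/-- An isotopy of the bundle of angles that carries the links `K` to the links `L` gives an
ambient isotopy of the sphere. -/
theorem ambientIsotopic (hU : U ⊆ Ioo (-R) R ×ˢ Ioo (-1 : ℝ) 1) (Φ : AngleIsotopy U) {ι : Type*} {K L : ι → Set (plSphere R)}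
    (h : ∀ k e, e.1 ∈ U → ∀ h1 h2,
      spherePoint R (Φ.toFun 1 e) h1 ∈ L k ↔ spherePoint R e h2 ∈ K k)
    (h' : ∀ k, ∀ w : plSphere R, w.1.1 ∉ U → (w ∈ L k ↔ w ∈ K k)) : AmbientIsotopic K L := by
  refine ⟨fun t => Φ.sphereHomeomorph hU t, Φ.continuous_sphereMap hU, ?_, fun k => ?_⟩
  · ext1 w
    obtain ⟨u, -, hw⟩ := exists_spherePoint R w
    change Φ.sphereMap hU 0 w = w
    conv_lhs => rw [hw]
    rw [sphereMap_spherePoint]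
    conv_rhs => rw [hw]
    congr 1
    exact Φ.map_zero _
  · have key : ∀ w, Φ.sphereHomeomorph hU 1 w ∈ L k ↔ w ∈ K k := by
      intro w
      obtain ⟨u, -, hw⟩ := exists_spherePoint R w
      change Φ.sphereMap hU 1 w ∈ L k ↔ w ∈ K k
      by_cases hx : w.1.1 ∈ U
      · have := h k (w.1.1, u) hx (Φ.mem_rectangle hU 1 w.2.1) w.2.1
        rw [← sphereMap_spherePoint hU Φ 1 _ w.2.1, ← hw] at this
        exact this
      · have : Φ.sphereMap hU 1 w = w := by
          conv_lhs => rw [hw]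
          rw [sphereMap_spherePoint]
          conv_rhs => rw [hw]
          congr 1
          exact Φ.eq_self _ _ hx
        rw [this, h' k w hx]
    ext w
    constructor
    · rintro ⟨w, hw, rfl⟩
      exact (key w).2 hw
    · intro hw
      refine ⟨(Φ.sphereHomeomorph hU 1).symm w, (key _).1 ?_, ?_⟩ <;> simp [hw]

end AngleIsotopy

/-! ## Tangent cones of plane curves -/

/-- Secants that approach within a union lie frequently in one of the two sets, and "frequently"
suffices for a tangent direction. -/
lemma tangentConeAt_union {E : Type*} [NormedAddCommGroup E] [NormedSpace ℝ E] (s t : Set E)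
    (x : E) : tangentConeAt ℝ (s ∪ t) x = tangentConeAt ℝ s x ∪ tangentConeAt ℝ t x := by
  apply subset_antisymm
  · intro y hy
    obtain ⟨α, l, hl, c, d, hd, hm, hcd⟩ := exists_fun_of_mem_tangentConeAt hy
    have : (∃ᶠ n in l, x + d n ∈ s) ∨ ∃ᶠ n in l, x + d n ∈ t := by
      rw [← frequently_or_distrib]
      exact hm.frequently
    rcases this with h | h
    · exact Or.inl (mem_tangentConeAt_of_frequently l c d hd h hcd)
    · exact Or.inr (mem_tangentConeAt_of_frequently l c d hd h hcd)
  · exact union_subset (tangentConeAt_mono subset_union_left) (tangentConeAt_mono subset_union_right)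

/-- The points of `M` with the angles of the tangent directions of `M`. -/
def tangentLift (M : Set (ℝ × ℝ)) : Set AngledPoint :=
  {e | e.1 ∈ M ∧ angleDir e.2 ∈ tangentConeAt ℝ M e.1}

/-- This is why closedness is carried along: a tangent direction of one part of a union is then
based at a point of that part. -/
lemma mem_of_mem_tangentConeAt {M : Set (ℝ × ℝ)} (hM : IsClosed M) {x y : ℝ × ℝ}
    (h : y ∈ tangentConeAt ℝ M x) : x ∈ M := by
  rw [← hM.closure_eq]
  exact mem_closure_of_nonempty_tangentConeAt ⟨y, h⟩

lemma tangentLift_union {M N : Set (ℝ × ℝ)} (hM : IsClosed M) (hN : IsClosed N) :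
    tangentLift (M ∪ N) = tangentLift M ∪ tangentLift N := by
  ext e
  simp only [tangentLift, mem_union, mem_ofPred_eq, tangentConeAt_union]
  constructor
  · rintro ⟨-, h | h⟩
    · exact Or.inl ⟨mem_of_mem_tangentConeAt hM h, h⟩
    · exact Or.inr ⟨mem_of_mem_tangentConeAt hN h, h⟩
  · rintro (⟨h1, h2⟩ | ⟨h1, h2⟩)
    · exact ⟨Or.inl h1, Or.inl h2⟩
    · exact ⟨Or.inr h1, Or.inr h2⟩

lemma tangentLift_empty : tangentLift ∅ = ∅ := by
  ext e; simp [tangentLift]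

lemma tangentLift_biUnion {ι : Type*} (s : Set ι) (hs : s.Finite) (M : ι → Set (ℝ × ℝ))
    (hM : ∀ i ∈ s, IsClosed (M i)) :
    tangentLift (⋃ i ∈ s, M i) = ⋃ i ∈ s, tangentLift (M i) := by
  induction s, hs using Set.Finite.induction_on with
  | empty => simp [tangentLift_empty]
  | insert ha hs ih =>
    rw [biUnion_insert, biUnion_insert, tangentLift_union (hM _ (mem_insert _ _))
      (hs.isClosed_biUnion fun i hi => hM i (mem_insert_of_mem _ hi)),
      ih fun i hi => hM i (mem_insert_of_mem _ hi)]

/-- The secants of the curve `c`, parametrized by `I`, through `c r` approach the direction of the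
angle `φ₀`. -/
def HasTangentAngle (c : ℝ → ℝ × ℝ) (I : Set ℝ) (r φ₀ : ℝ) : Prop :=
  ∃ ρ φ : ℝ → ℝ, (∀ y ∈ I, y ≠ r → ρ y ≠ 0 ∧
    c y = c r + ρ y • (Real.cos (φ y), Real.sin (φ y))) ∧
    Tendsto φ (𝓝[I \ {r}] r) (𝓝 φ₀)

lemma angleDir_add_int_mul_pi (u : ℝ) (m : ℤ) :
    ∃ a : ℝ, angleDir (u + m * Real.pi) = a • (Real.cos u, Real.sin u) := by
  refine ⟨(max |Real.cos (u + m * Real.pi)| |Real.sin (u + m * Real.pi)|)⁻¹ * (-1) ^ m, ?_⟩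
  rw [angleDir, ← smul_smul]
  congr 1
  rw [Real.cos_add_int_mul_pi, Real.sin_add_int_mul_pi]
  rfl

/-- Every secant is parallel to its direction `φ`, so in the limit a tangent vector is parallel to
`φ₀`; conversely, rescaled secants converge to any multiple of this direction. The coordinate `k`
turns convergence of points of the curve into convergence of parameters. -/
lemma mem_tangentConeAt_iff_of_hasTangentAngle {c : ℝ → ℝ × ℝ} {I : Set ℝ} {r φ₀ : ℝ} (hr : r ∈ I)
    (hI : (𝓝[I \ {r}] r).NeBot) {k : ℝ × ℝ → ℝ} (hk : Continuous k) (hkc : ∀ y ∈ I, k (c y) = y)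
    (hc : ContinuousOn c I) (h : HasTangentAngle c I r φ₀) (u : ℝ) :
    angleDir u ∈ tangentConeAt ℝ (c '' I) (c r) ↔ ∃ m : ℤ, u = φ₀ + m * Real.pi := by
  obtain ⟨ρ, φ, hρ, hφ⟩ := h
  have hmem : ∀ᶠ y in 𝓝[I \ {r}] r, y ∈ I \ {r} := eventually_mem_nhdsWithin
  constructor
  · intro hu
    obtain ⟨α, l, hl, a, d, hd, hm, had⟩ := exists_fun_of_mem_tangentConeAt hu
    classical
    -- The approximating increments may vanish, that is, the parameter may equal `r`; the angle
    -- needs a value there as well.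
    let ψ : ℝ → ℝ := fun y => if y = r then φ₀ else φ y
    have hψ : Tendsto ψ (𝓝[I] r) (𝓝 φ₀) := by
      have h1 : Tendsto ψ (𝓝[I \ {r}] r) (𝓝 φ₀) := by
        refine hφ.congr' ?_
        filter_upwards [hmem] with y hy
        exact (if_neg hy.2).symm
      have h2 : Tendsto ψ (𝓝[{r}] r) (𝓝 φ₀) := by
        rw [nhdsWithin_singleton]
        have : ψ r = φ₀ := if_pos rfl
        exact tendsto_pure_left.2 fun s hs => by rw [this]; exact mem_of_mem_nhds hs
      have := h1.sup h2
      rw [← nhdsWithin_union] at this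
      refine this.mono_left (nhdsWithin_mono _ ?_)
      intro y hy
      by_cases hyr : y = r
      · exact Or.inr hyr
      · exact Or.inl ⟨hy, hyr⟩
    have hy : Tendsto (fun n => k (c r + d n)) l (𝓝[I] r) := by
      refine tendsto_nhdsWithin_iff.2 ⟨?_, ?_⟩
      · have : Tendsto (fun n => c r + d n) l (𝓝 (c r)) := by
          simpa using hd.const_add (c r)
        have := (hk.tendsto (c r)).comp this
        rwa [hkc r hr] at this
      · filter_upwards [hm] with n hn
        obtain ⟨y, hy, hyc⟩ := hn
        rw [← hyc, hkc y hy]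
        exact hy
    have hψn := hψ.comp hy
    -- The cross product of the secant with its own direction.
    have hzero : ∀ᶠ n in l, (a n • d n).1 * Real.sin (ψ (k (c r + d n))) -
        (a n • d n).2 * Real.cos (ψ (k (c r + d n))) = 0 := by
      filter_upwards [hm] with n hn
      obtain ⟨y, hy, hyc⟩ := hn
      rw [← hyc, hkc y hy]
      by_cases hyr : y = r
      · have : d n = 0 := by rw [hyr] at hyc; simpa using hyc.symm
        simp [this]
      · have h1 := (hρ y hy hyr).2
        have h2 : d n = ρ y • (Real.cos (φ y), Real.sin (φ y)) := by
          rw [h1] at hyc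
          exact (add_left_cancel hyc).symm
        simp only [ψ, if_neg hyr, h2, Prod.smul_mk, smul_eq_mul]
        ring
    have hlim : Tendsto (fun n => (a n • d n).1 * Real.sin (ψ (k (c r + d n))) -
        (a n • d n).2 * Real.cos (ψ (k (c r + d n)))) l
        (𝓝 ((angleDir u).1 * Real.sin φ₀ - (angleDir u).2 * Real.cos φ₀)) := by
      have h1 := (continuous_fst.tendsto _).comp had
      have h2 := (continuous_snd.tendsto _).comp had
      have h3 := (Real.continuous_sin.tendsto _).comp hψn
      have h4 := (Real.continuous_cos.tendsto _).comp hψn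
      exact (h1.mul h3).sub (h2.mul h4)
    have hval := tendsto_nhds_unique hlim (tendsto_const_nhds.congr' (hzero.mono fun n hn => hn.symm))
    have hsin : Real.sin (φ₀ - u) = 0 := by
      have hp := max_abs_cos_sin_pos u
      simp only [angleDir, Prod.smul_mk, smul_eq_mul] at hval
      rw [Real.sin_sub]
      have : (max |Real.cos u| |Real.sin u|)⁻¹ *
          (Real.sin φ₀ * Real.cos u - Real.cos φ₀ * Real.sin u) = 0 := by
        rw [← hval]; ring
      rcases mul_eq_zero.1 this with h | h
      · exact absurd h (inv_pos.2 hp).ne'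
      · exact h
    obtain ⟨m, hm⟩ := Real.sin_eq_zero_iff.1 hsin
    exact ⟨-m, by push_cast; linarith⟩
  · rintro ⟨m, rfl⟩
    obtain ⟨a, ha⟩ := angleDir_add_int_mul_pi φ₀ m
    rw [ha]
    refine mem_tangentConeAt_of_seq (𝓝[I \ {r}] r) (fun y => a / ρ y) (fun y => c y - c r) ?_ ?_ ?_
    · have h1 : Tendsto c (𝓝[I \ {r}] r) (𝓝 (c r)) :=
        (hc r hr).mono_left (nhdsWithin_mono _ sdiff_subset)
      simpa using h1.sub_const (c r)
    · filter_upwards [hmem] with y hy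
      exact ⟨y, hy.1, by simp⟩
    · have h1 : Tendsto (fun y => a • ((Real.cos (φ y), Real.sin (φ y)) : ℝ × ℝ)) (𝓝[I \ {r}] r)
          (𝓝 (a • (Real.cos φ₀, Real.sin φ₀))) := by
        refine Tendsto.const_smul (Tendsto.prodMk_nhds ?_ ?_) a
        · exact (Real.continuous_cos.tendsto _).comp hφ
        · exact (Real.continuous_sin.tendsto _).comp hφ
      refine h1.congr' ?_
      filter_upwards [hmem] with y hy
      obtain ⟨h1, h2⟩ := hρ y hy.1 hy.2
      rw [h2, add_sub_cancel_left, smul_smul, div_mul_cancel₀ _ h1]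

/-- The angle `σ` is a lift of the tangent directions of the curve `M` parametrized by `c` on
`I`. -/
def IsTangentStrand (M : Set (ℝ × ℝ)) (c : ℝ → ℝ × ℝ) (σ : ℝ → ℝ) (I : Set ℝ) : Prop :=
  IsClosed M ∧ M = c '' I ∧ tangentLift M = strand c σ I

lemma isTangentStrand_of_hasTangentAngle {c : ℝ → ℝ × ℝ} {σ : ℝ → ℝ} {a b : ℝ} (hab : a < b)
    {k : ℝ × ℝ → ℝ} (hk : Continuous k) (hkc : ∀ y ∈ Icc a b, k (c y) = y)
    (hc : ContinuousOn c (Icc a b)) (h : ∀ r ∈ Icc a b, HasTangentAngle c (Icc a b) r (σ r)) :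
    IsTangentStrand (c '' Icc a b) c σ (Icc a b) := by
  refine ⟨(isCompact_Icc.image_of_continuousOn hc).isClosed, rfl, ?_⟩
  have hne : ∀ r ∈ Icc a b, (𝓝[Icc a b \ {r}] r).NeBot := by
    intro r hr
    rcases lt_or_eq_of_le hr.2 with h' | h'
    · have : (𝓝[>] r).NeBot := inferInstance
      rw [← nhdsWithin_Ioo_eq_nhdsGT h'] at this
      exact this.mono (nhdsWithin_mono _ fun y hy =>
        ⟨⟨hr.1.trans hy.1.le, hy.2.le⟩, fun e => hy.1.ne' e⟩)
    · have : (𝓝[<] r).NeBot := inferInstance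
      have har : a < r := by rwa [h']
      rw [← nhdsWithin_Ioo_eq_nhdsLT har] at this
      exact this.mono (nhdsWithin_mono _ fun y hy =>
        ⟨⟨hy.1.le, hy.2.le.trans hr.2⟩, fun e => hy.2.ne e⟩)
  ext ⟨x, u⟩
  constructor
  · rintro ⟨⟨r, hr, rfl⟩, hu⟩
    obtain ⟨m, hm⟩ :=
      (mem_tangentConeAt_iff_of_hasTangentAngle hr (hne r hr) hk hkc hc (h r hr) u).1 hu
    exact ⟨r, hr, rfl, m, hm⟩
  · rintro ⟨r, hr, hx, m, hm⟩
    simp only at hx hm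
    subst hx
    exact ⟨⟨r, hr, rfl⟩,
      (mem_tangentConeAt_iff_of_hasTangentAngle hr (hne r hr) hk hkc hc (h r hr) u).2 ⟨m, hm⟩⟩

lemma add_slope_smul {m y r : ℝ} (h : y ≠ r) : (y - r) * √(1 + m ^ 2) ≠ 0 ∧
    ((y - r) * √(1 + m ^ 2)) • ((Real.cos (Real.arctan m), Real.sin (Real.arctan m)) : ℝ × ℝ) =
      (y - r, (y - r) * m) := by
  have hs : 0 < √(1 + m ^ 2) := Real.sqrt_pos.2 (by positivity)
  refine ⟨mul_ne_zero (sub_ne_zero.2 h) hs.ne', ?_⟩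
  rw [Real.cos_arctan, Real.sin_arctan, Prod.smul_mk, smul_eq_mul, smul_eq_mul]
  congr 1 <;> field_simp

lemma hasTangentAngle_graph {f : ℝ → ℝ} {I : Set ℝ} {r φ : ℝ}
    (h : Tendsto (fun y => Real.arctan (slope f r y)) (𝓝[I \ {r}] r) (𝓝 φ)) :
    HasTangentAngle (fun x => (x, f x)) I r φ := by
  refine ⟨fun y => (y - r) * √(1 + slope f r y ^ 2), fun y => Real.arctan (slope f r y), ?_, h⟩
  intro y _ hy
  obtain ⟨h1, h2⟩ := add_slope_smul (m := slope f r y) hy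
  refine ⟨h1, ?_⟩
  rw [h2]
  have := sub_smul_slope f r y
  simp only [smul_eq_mul, vsub_eq_sub] at this
  ext <;> simp [this]

/-- Reflection in the diagonal replaces an angle by its difference from π/2. -/
lemma hasTangentAngle_graph_swap {f : ℝ → ℝ} {I : Set ℝ} {r φ : ℝ}
    (h : Tendsto (fun y => Real.arctan (slope f r y)) (𝓝[I \ {r}] r) (𝓝 φ)) :
    HasTangentAngle (fun y => (f y, y)) I r (Real.pi / 2 - φ) := by
  refine ⟨fun y => (y - r) * √(1 + slope f r y ^ 2),
    fun y => Real.pi / 2 - Real.arctan (slope f r y), ?_, h.const_sub _⟩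
  intro y _ hy
  obtain ⟨h1, h2⟩ := add_slope_smul (m := slope f r y) hy
  refine ⟨h1, ?_⟩
  rw [Real.cos_pi_div_two_sub, Real.sin_pi_div_two_sub]
  have h3 := congrArg Prod.fst h2
  have h4 := congrArg Prod.snd h2
  simp only [Prod.smul_mk, smul_eq_mul] at h3 h4
  have := sub_smul_slope f r y
  simp only [smul_eq_mul, vsub_eq_sub] at this
  ext
  · simp [h4, this]
  · simp [h3]

/-! ## Arcs with a continuous slope -/

/-- The tangent angles of a continuous function whose derivative is continuous in the interior and
has limits, possibly infinite, at the ends. -/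
lemma exists_angle_of_arc {f : ℝ → ℝ} {s t : ℝ} {S : Set ℝ} {F G : Filter ℝ} {φ ψ : ℝ}
    (h : IsMonotoneArc f s t S F G) (hF : Tendsto Real.arctan F (𝓝 φ))
    (hG : Tendsto Real.arctan G (𝓝 ψ)) :
    ∃ σ : ℝ → ℝ, ContinuousOn σ (Icc s t) ∧ σ s = φ ∧ σ t = ψ ∧ ∀ r ∈ Icc s t,
      Tendsto (fun y => Real.arctan (slope f r y)) (𝓝[Icc s t \ {r}] r) (𝓝 (σ r)) := by
  obtain ⟨hst, hc, hd, -, hs, ht⟩ := h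
  have hdc : ContinuousOn (deriv f) (Ioo s t) := hd.continuousOn_deriv_of_isOpen isOpen_Ioo le_rfl
  have hdiff : DifferentiableOn ℝ f (Ioo s t) := hd.differentiableOn one_ne_zero
  have hac : ContinuousOn (fun x => Real.arctan (deriv f x)) (Ioo s t) :=
    Real.continuous_arctan.comp_continuousOn hdc
  -- Passing to `arctan` makes infinite slopes finite, so vertical end tangents need no separate
  -- treatment.
  have has : Tendsto (fun x => Real.arctan (deriv f x)) (𝓝[>] s) (𝓝 φ) := hF.comp hs
  have hat : Tendsto (fun x => Real.arctan (deriv f x)) (𝓝[<] t) (𝓝 ψ) := hG.comp ht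
  refine ⟨extendFrom (Ioo s t) fun x => Real.arctan (deriv f x),
    continuousOn_Icc_extendFrom_Ioo hac has hat, eq_lim_at_left_extendFrom_Ioo hst has,
    eq_lim_at_right_extendFrom_Ioo hst hat, fun r hr => ?_⟩
  rcases eq_or_lt_of_le hr.1 with rfl | hsr
  · rw [eq_lim_at_left_extendFrom_Ioo hst has, Metric.tendsto_nhds]
    intro ε hε
    have h1 := (Metric.tendsto_nhds.1 has) ε hε
    obtain ⟨δ, hδ, h1⟩ := mem_nhdsGT_iff_exists_Ioo_subset.1 h1
    rw [eventually_nhdsWithin_iff]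
    filter_upwards [Iio_mem_nhds hδ] with y hy hyI
    have hsy : s < y := lt_of_le_of_ne hyI.1.1 (fun e => hyI.2 e.symm)
    -- By the mean value theorem the secant slope is a derivative at a point even closer to the end,
    -- so both have the same limit.
    obtain ⟨x, hx, hxe⟩ := exists_deriv_eq_slope f hsy (hc.mono (Icc_subset_Icc_right hyI.1.2))
      (hdiff.mono (Ioo_subset_Ioo_right hyI.1.2))
    have := h1 (⟨hx.1, hx.2.trans hy⟩ : x ∈ Ioo s δ)
    rw [slope_def_field, ← hxe]
    exact this
  rcases eq_or_lt_of_le hr.2 with rfl | hrt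
  · rw [eq_lim_at_right_extendFrom_Ioo hst hat, Metric.tendsto_nhds]
    intro ε hε
    have h1 := (Metric.tendsto_nhds.1 hat) ε hε
    obtain ⟨δ, hδ, h1⟩ := mem_nhdsLT_iff_exists_Ioo_subset.1 h1
    rw [eventually_nhdsWithin_iff]
    filter_upwards [Ioi_mem_nhds hδ] with y hy hyI
    have hsy : y < r := lt_of_le_of_ne hyI.1.2 hyI.2
    obtain ⟨x, hx, hxe⟩ := exists_deriv_eq_slope f hsy (hc.mono (Icc_subset_Icc_left hyI.1.1))
      (hdiff.mono (Ioo_subset_Ioo_left hyI.1.1))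
    have := h1 (⟨lt_trans hy hx.1, hx.2⟩ : x ∈ Ioo δ r)
    rw [slope_comm, slope_def_field, ← hxe]
    exact this
  · rw [extendFrom_extends hac r ⟨hsr, hrt⟩]
    have h1 : HasDerivAt f (deriv f r) r :=
      (hdiff.differentiableAt (Ioo_mem_nhds hsr hrt)).hasDerivAt
    exact ((Real.continuous_arctan.tendsto _).comp h1.tendsto_slope).mono_left
      (nhdsWithin_mono _ fun y hy => hy.2)

lemma exists_isTangentStrand_of_arc {f : ℝ → ℝ} {s t : ℝ} {S : Set ℝ} {F G : Filter ℝ} {φ ψ : ℝ}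
    (h : IsMonotoneArc f s t S F G) (hF : Tendsto Real.arctan F (𝓝 φ))
    (hG : Tendsto Real.arctan G (𝓝 ψ)) :
    ∃ σ : ℝ → ℝ, ContinuousOn σ (Icc s t) ∧ σ s = φ ∧ σ t = ψ ∧
      IsTangentStrand ((fun x => (x, f x)) '' Icc s t) (fun x => (x, f x)) σ (Icc s t) := by
  obtain ⟨σ, h1, h2, h3, h4⟩ := exists_angle_of_arc h hF hG
  exact ⟨σ, h1, h2, h3, isTangentStrand_of_hasTangentAngle h.1 continuous_fst (fun _ _ => rfl)
    (continuousOn_id.prodMk h.2.1) fun r hr => hasTangentAngle_graph (h4 r hr)⟩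

lemma exists_isTangentStrand_of_arc_swap {f : ℝ → ℝ} {s t : ℝ} {S : Set ℝ} {F G : Filter ℝ}
    {φ ψ : ℝ} (h : IsMonotoneArc f s t S F G) (hF : Tendsto Real.arctan F (𝓝 φ))
    (hG : Tendsto Real.arctan G (𝓝 ψ)) :
    ∃ σ : ℝ → ℝ, ContinuousOn σ (Icc s t) ∧ σ s = Real.pi / 2 - φ ∧ σ t = Real.pi / 2 - ψ ∧
      IsTangentStrand ((fun x => (f x, x)) '' Icc s t) (fun x => (f x, x)) σ (Icc s t) := by
  obtain ⟨σ, h1, h2, h3, h4⟩ := exists_angle_of_arc h hF hG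
  exact ⟨fun r => Real.pi / 2 - σ r, by fun_prop, by simp only [h2], by simp only [h3],
    isTangentStrand_of_hasTangentAngle h.1 continuous_snd (fun _ _ => rfl)
    (h.2.1.prodMk continuousOn_id) fun r hr => hasTangentAngle_graph_swap (h4 r hr)⟩

lemma isTangentStrand_horizontal {s t : ℝ} (hst : s < t) (h : ℝ) :
    IsTangentStrand (Icc s t ×ˢ {h}) (fun x => (x, h)) (fun _ => 0) (Icc s t) := by
  have h1 : (Icc s t ×ˢ {h} : Set (ℝ × ℝ)) = (fun x => (x, h)) '' Icc s t := by
    ext ⟨x, y⟩; simp [eq_comm]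
  rw [h1]
  refine isTangentStrand_of_hasTangentAngle hst continuous_fst (fun _ _ => rfl)
    (by fun_prop) fun r hr => hasTangentAngle_graph (f := fun _ => h) ?_
  simp only [slope_fun_def_field, sub_self, zero_div, Real.arctan_zero]
  exact tendsto_const_nhds

/-! ## Joining and turning strands -/

lemma strand_add_int_mul_pi (c : ℝ → ℝ × ℝ) (σ : ℝ → ℝ) (I : Set ℝ) (m : ℤ) :
    strand c (fun r => σ r + m * Real.pi) I = strand c σ I := by
  ext e
  constructor
  · rintro ⟨r, hr, h1, k, h2⟩
    exact ⟨r, hr, h1, m + k, by rw [h2]; push_cast; ring⟩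
  · rintro ⟨r, hr, h1, k, h2⟩
    exact ⟨r, hr, h1, k - m, by rw [h2]; push_cast; ring⟩

lemma IsTangentStrand.add_int_mul_pi {M : Set (ℝ × ℝ)} {c : ℝ → ℝ × ℝ} {σ : ℝ → ℝ} {I : Set ℝ}
    (h : IsTangentStrand M c σ I) (m : ℤ) :
    IsTangentStrand M c (fun r => σ r + m * Real.pi) I :=
  ⟨h.1, h.2.1, by rw [strand_add_int_mul_pi, h.2.2]⟩

lemma IsTangentStrand.congr {M : Set (ℝ × ℝ)} {c c' : ℝ → ℝ × ℝ} {σ σ' : ℝ → ℝ} {I : Set ℝ}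
    (h : IsTangentStrand M c σ I) (hc : ∀ r ∈ I, c r = c' r) (hσ : ∀ r ∈ I, σ r = σ' r) :
    IsTangentStrand M c' σ' I :=
  ⟨h.1, by rw [h.2.1]; exact image_congr hc, by rw [h.2.2, strand_congr hc hσ]⟩

lemma IsTangentStrand.union {M N : Set (ℝ × ℝ)} {c : ℝ → ℝ × ℝ} {σ : ℝ → ℝ} {I J : Set ℝ}
    (h : IsTangentStrand M c σ I) (h' : IsTangentStrand N c σ J) :
    IsTangentStrand (M ∪ N) c σ (I ∪ J) :=
  ⟨h.1.union h'.1, by rw [image_union, h.2.1, h'.2.1], by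
    rw [tangentLift_union h.1 h'.1, h.2.2, h'.2.2, strand_union]⟩

lemma exists_continuousOn_join {f g : ℝ → ℝ} {a b d : ℝ} (hab : a ≤ b) (hbd : b ≤ d)
    (hf : ContinuousOn f (Icc a b)) (hg : ContinuousOn g (Icc b d)) (hfg : f b = g b) :
    ∃ k : ℝ → ℝ, ContinuousOn k (Icc a d) ∧ (∀ r ∈ Icc a b, f r = k r) ∧
      ∀ r ∈ Icc b d, g r = k r := by
  classical
  let k : ℝ → ℝ := fun r => if r ≤ b then f r else g r
  have h1 : ∀ r ∈ Icc a b, f r = k r := fun r hr => (if_pos hr.2).symm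
  have h2 : ∀ r ∈ Icc b d, g r = k r := by
    intro r hr
    by_cases h : r ≤ b
    · have : r = b := le_antisymm h hr.1
      simp only [k, this, hfg, ite_self]
    · exact (if_neg h).symm
  refine ⟨k, ?_, h1, h2⟩
  rw [← Icc_union_Icc_eq_Icc hab hbd]
  exact (hf.congr fun r hr => (h1 r hr).symm).union_of_isClosed
    (hg.congr fun r hr => (h2 r hr).symm) isClosed_Icc isClosed_Icc

/-- A graph of an injective function is a graph over the other axis. -/
lemma IsTangentStrand.exists_swap {M : Set (ℝ × ℝ)} {f σ : ℝ → ℝ} {a b : ℝ}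
    (h : IsTangentStrand M (fun x => (x, f x)) σ (Icc a b)) (hf : ContinuousOn f (Icc a b))
    (hσ : ContinuousOn σ (Icc a b)) (hinj : InjOn f (Icc a b)) :
    ∃ g τ : ℝ → ℝ, ContinuousOn g (f '' Icc a b) ∧ ContinuousOn τ (f '' Icc a b) ∧
      (∀ x ∈ Icc a b, g (f x) = x ∧ τ (f x) = σ x) ∧
      IsTangentStrand M (fun y => (g y, y)) τ (f '' Icc a b) := by
  classical
  let g : ℝ → ℝ := Function.invFunOn f (Icc a b)
  have hgf : ∀ x ∈ Icc a b, g (f x) = x := fun x hx => hinj.leftInvOn_invFunOn hx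
  -- The inverse is continuous since `f` maps closed subsets of the compact interval to closed sets.
  have hg : ContinuousOn g (f '' Icc a b) := by
    rw [continuousOn_iff_isClosed]
    intro t ht
    refine ⟨f '' (t ∩ Icc a b), ?_, ?_⟩
    · exact ((isCompact_Icc.inter_left ht).image_of_continuousOn
        (hf.mono inter_subset_right)).isClosed
    · ext y
      constructor
      · rintro ⟨h1, x, hx, rfl⟩
        rw [mem_preimage, hgf x hx] at h1
        exact ⟨⟨x, ⟨h1, hx⟩, rfl⟩, x, hx, rfl⟩
      · rintro ⟨⟨x, ⟨h1, hx⟩, rfl⟩, h2⟩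
        refine ⟨?_, h2⟩
        rwa [mem_preimage, hgf x hx]
  have hmaps : MapsTo g (f '' Icc a b) (Icc a b) := by
    rintro _ ⟨x, hx, rfl⟩
    rwa [hgf x hx]
  have key : ∀ x ∈ Icc a b, (g (f x), f x) = (x, f x) ∧ σ (g (f x)) = σ x := fun x hx => by
    rw [hgf x hx]; exact ⟨rfl, rfl⟩
  refine ⟨g, σ ∘ g, hg, hσ.comp hg hmaps, fun x hx => ⟨hgf x hx, (key x hx).2⟩, h.1, ?_, ?_⟩
  · rw [h.2.1, image_image]
    exact (image_congr fun x hx => (key x hx).1).symm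
  · rw [h.2.2, ← strand_comp]
    exact (strand_congr (fun x hx => (key x hx).1) fun x hx => (key x hx).2).symm

lemma IsMonotoneArc.strictMonoOn {f : ℝ → ℝ} {s t : ℝ} {F G : Filter ℝ}
    (h : IsMonotoneArc f s t (Ioi 0) F G) : StrictMonoOn f (Icc s t) :=
  strictMonoOn_of_deriv_pos (convex_Icc s t) h.2.1 fun x hx => h.2.2.2.1 x (by
    rwa [interior_Icc] at hx)

lemma IsMonotoneArc.strictAntiOn {f : ℝ → ℝ} {s t : ℝ} {F G : Filter ℝ}
    (h : IsMonotoneArc f s t (Iio 0) F G) : StrictAntiOn f (Icc s t) :=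
  strictAntiOn_of_deriv_neg (convex_Icc s t) h.2.1 fun x hx => h.2.2.2.1 x (by
    rwa [interior_Icc] at hx)

/-- Two graphs with a common end, over intervals which continue each other in the second
coordinate. -/
lemma exists_join_swap {M N : Set (ℝ × ℝ)} {g₁ σ₁ g₂ σ₂ : ℝ → ℝ} {a b d : ℝ} (hab : a ≤ b)
    (hbd : b ≤ d) (hg₁ : ContinuousOn g₁ (Icc a b)) (hσ₁ : ContinuousOn σ₁ (Icc a b))
    (hg₂ : ContinuousOn g₂ (Icc b d)) (hσ₂ : ContinuousOn σ₂ (Icc b d)) (hg : g₁ b = g₂ b)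
    (hσ : σ₁ b = σ₂ b) (h₁ : IsTangentStrand M (fun y => (g₁ y, y)) σ₁ (Icc a b))
    (h₂ : IsTangentStrand N (fun y => (g₂ y, y)) σ₂ (Icc b d)) :
    ∃ g σ : ℝ → ℝ, ContinuousOn g (Icc a d) ∧ ContinuousOn σ (Icc a d) ∧ g a = g₁ a ∧
      g d = g₂ d ∧ σ a = σ₁ a ∧ σ d = σ₂ d ∧
      IsTangentStrand (M ∪ N) (fun y => (g y, y)) σ (Icc a d) := by
  obtain ⟨g, hgc, hg1, hg2⟩ := exists_continuousOn_join hab hbd hg₁ hg₂ hg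
  obtain ⟨σ, hσc, hσ1, hσ2⟩ := exists_continuousOn_join hab hbd hσ₁ hσ₂ hσ
  have ha : a ∈ Icc a b := left_mem_Icc.2 hab
  have hd : d ∈ Icc b d := right_mem_Icc.2 hbd
  refine ⟨g, σ, hgc, hσc, (hg1 a ha).symm, (hg2 d hd).symm, (hσ1 a ha).symm, (hσ2 d hd).symm, ?_⟩
  rw [← Icc_union_Icc_eq_Icc hab hbd]
  exact (h₁.congr (fun r hr => by rw [hg1 r hr]) hσ1).union
    (h₂.congr (fun r hr => by rw [hg2 r hr]) hσ2)

lemma exists_join {f σ₁ σ₂ : ℝ → ℝ} {M N : Set (ℝ × ℝ)} {a b d : ℝ} (hab : a ≤ b) (hbd : b ≤ d)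
    (hσ₁ : ContinuousOn σ₁ (Icc a b)) (hσ₂ : ContinuousOn σ₂ (Icc b d)) (hσ : σ₁ b = σ₂ b)
    (h₁ : IsTangentStrand M (fun x => (x, f x)) σ₁ (Icc a b))
    (h₂ : IsTangentStrand N (fun x => (x, f x)) σ₂ (Icc b d)) :
    ∃ σ : ℝ → ℝ, ContinuousOn σ (Icc a d) ∧ σ a = σ₁ a ∧ σ d = σ₂ d ∧
      IsTangentStrand (M ∪ N) (fun x => (x, f x)) σ (Icc a d) := by
  obtain ⟨σ, hσc, hσ1, hσ2⟩ := exists_continuousOn_join hab hbd hσ₁ hσ₂ hσ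
  have ha : a ∈ Icc a b := left_mem_Icc.2 hab
  have hd : d ∈ Icc b d := right_mem_Icc.2 hbd
  refine ⟨σ, hσc, (hσ1 a ha).symm, (hσ2 d hd).symm, ?_⟩
  rw [← Icc_union_Icc_eq_Icc hab hbd]
  exact (h₁.congr (fun r _ => rfl) hσ1).union (h₂.congr (fun r _ => rfl) hσ2)

lemma tendsto_arctan_nhds_zero : Tendsto Real.arctan (𝓝 0) (𝓝 0) := by
  simpa using Real.continuous_arctan.tendsto 0

lemma tendsto_arctan_atTop_nhds : Tendsto Real.arctan atTop (𝓝 (Real.pi / 2)) :=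
  Real.tendsto_arctan_atTop.mono_right nhdsWithin_le_nhds

lemma tendsto_arctan_atBot_nhds : Tendsto Real.arctan atBot (𝓝 (-(Real.pi / 2))) :=
  Real.tendsto_arctan_atBot.mono_right nhdsWithin_le_nhds

/-- The angle rises from 0 to π/2 at the cusp. The next arc starts with the angle -π/2, which is the
same line; adding π continues the lift, and the total turn is π. -/
lemma IsUpwardCusp.exists_strand {s t h : ℝ} {M : Set (ℝ × ℝ)} (H : IsUpwardCusp s t h M) :
    ∃ f σ : ℝ → ℝ, ContinuousOn f (Icc s t) ∧ ContinuousOn σ (Icc s t) ∧ f s = h ∧ f t = h ∧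
      σ s = 0 ∧ σ t = Real.pi ∧ IsTangentStrand M (fun x => (x, f x)) σ (Icc s t) := by
  obtain ⟨c, f, hs, ht, h1, h2, rfl⟩ := H
  obtain ⟨σ₁, hc1, ha1, hb1, hM1⟩ :=
    exists_isTangentStrand_of_arc h1 tendsto_arctan_nhds_zero tendsto_arctan_atTop_nhds
  obtain ⟨σ₂, hc2, ha2, hb2, hM2⟩ :=
    exists_isTangentStrand_of_arc h2 tendsto_arctan_atBot_nhds tendsto_arctan_nhds_zero
  have hM2' := hM2.add_int_mul_pi 1
  simp only [Int.cast_one, one_mul] at hM2'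
  obtain ⟨σ, hσ, hσs, hσt, hM⟩ := exists_join h1.1.le h2.1.le hc1 (by fun_prop)
    (by rw [hb1, ha2]; ring) hM1 hM2'
  rw [← image_union, Icc_union_Icc_eq_Icc h1.1.le h2.1.le] at hM
  refine ⟨f, σ, ?_, hσ, hs, ht, by rw [hσs, ha1], by rw [hσt, hb2, zero_add], hM⟩
  rw [← Icc_union_Icc_eq_Icc h1.1.le h2.1.le]
  exact h1.2.1.union_of_isClosed h2.2.1 isClosed_Icc isClosed_Icc

/-- Here π is added on the arc before the cusp: the angle falls from π through π/2 to 0. -/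
lemma IsDownwardCusp.exists_strand {s t h : ℝ} {M : Set (ℝ × ℝ)} (H : IsDownwardCusp s t h M) :
    ∃ f σ : ℝ → ℝ, ContinuousOn f (Icc s t) ∧ ContinuousOn σ (Icc s t) ∧ f s = h ∧ f t = h ∧
      σ s = Real.pi ∧ σ t = 0 ∧ IsTangentStrand M (fun x => (x, f x)) σ (Icc s t) := by
  obtain ⟨c, f, hs, ht, h1, h2, rfl⟩ := H
  obtain ⟨σ₁, hc1, ha1, hb1, hM1⟩ :=
    exists_isTangentStrand_of_arc h1 tendsto_arctan_nhds_zero tendsto_arctan_atBot_nhds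
  obtain ⟨σ₂, hc2, ha2, hb2, hM2⟩ :=
    exists_isTangentStrand_of_arc h2 tendsto_arctan_atTop_nhds tendsto_arctan_nhds_zero
  have hM1' := hM1.add_int_mul_pi 1
  simp only [Int.cast_one, one_mul] at hM1'
  obtain ⟨σ, hσ, hσs, hσt, hM⟩ := exists_join h1.1.le h2.1.le (by fun_prop) hc2
    (by rw [hb1, ha2]; ring) hM1' hM2
  rw [← image_union, Icc_union_Icc_eq_Icc h1.1.le h2.1.le] at hM
  refine ⟨f, σ, ?_, hσ, hs, ht, by rw [hσs, ha1, zero_add], by rw [hσt, hb2], hM⟩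
  rw [← Icc_union_Icc_eq_Icc h1.1.le h2.1.le]
  exact h1.2.1.union_of_isClosed h2.2.1 isClosed_Icc isClosed_Icc

/-- Read upwards, the tangent turns from π through the vertical to 0. On the right the turn goes
from 0 to π. -/
lemma IsLeftRound.exists_strand {s t hl hu : ℝ} {M : Set (ℝ × ℝ)} (H : IsLeftRound s t hl hu M) :
    ∃ g σ : ℝ → ℝ, ContinuousOn g (Icc hl hu) ∧ ContinuousOn σ (Icc hl hu) ∧ g hl = s ∧ g hu = t ∧
      σ hl = Real.pi ∧ σ hu = 0 ∧ IsTangentStrand M (fun y => (g y, y)) σ (Icc hl hu) := by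
  obtain ⟨m, g, hs, ht, h1, h2, rfl⟩ := H
  obtain ⟨σ₁, hc1, ha1, hb1, hM1⟩ :=
    exists_isTangentStrand_of_arc_swap h1 tendsto_arctan_atBot_nhds tendsto_arctan_nhds_zero
  obtain ⟨σ₂, hc2, ha2, hb2, hM2⟩ :=
    exists_isTangentStrand_of_arc_swap h2 tendsto_arctan_nhds_zero tendsto_arctan_atTop_nhds
  obtain ⟨g', σ, hg, hσ, hgs, hgt, hσs, hσt, hM⟩ := exists_join_swap h1.1.le h2.1.le h1.2.1 hc1
    h2.2.1 hc2 rfl (by rw [hb1, ha2]) hM1 hM2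
  rw [← image_union, Icc_union_Icc_eq_Icc h1.1.le h2.1.le] at hM
  exact ⟨g', σ, hg, hσ, by rw [hgs, hs], by rw [hgt, ht], by rw [hσs, ha1]; ring,
    by rw [hσt, hb2]; ring, hM⟩

lemma IsRightRound.exists_strand {s t hl hu : ℝ} {M : Set (ℝ × ℝ)} (H : IsRightRound s t hl hu M) :
    ∃ g σ : ℝ → ℝ, ContinuousOn g (Icc hl hu) ∧ ContinuousOn σ (Icc hl hu) ∧ g hl = s ∧ g hu = t ∧
      σ hl = 0 ∧ σ hu = Real.pi ∧ IsTangentStrand M (fun y => (g y, y)) σ (Icc hl hu) := by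
  obtain ⟨m, g, hs, ht, h1, h2, rfl⟩ := H
  obtain ⟨σ₁, hc1, ha1, hb1, hM1⟩ :=
    exists_isTangentStrand_of_arc_swap h1 tendsto_arctan_atTop_nhds tendsto_arctan_nhds_zero
  obtain ⟨σ₂, hc2, ha2, hb2, hM2⟩ :=
    exists_isTangentStrand_of_arc_swap h2 tendsto_arctan_nhds_zero tendsto_arctan_atBot_nhds
  obtain ⟨g', σ, hg, hσ, hgs, hgt, hσs, hσt, hM⟩ := exists_join_swap h1.1.le h2.1.le h1.2.1 hc1
    h2.2.1 hc2 rfl (by rw [hb1, ha2]) hM1 hM2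
  rw [← image_union, Icc_union_Icc_eq_Icc h1.1.le h2.1.le] at hM
  exact ⟨g', σ, hg, hσ, by rw [hgs, hs], by rw [hgt, ht], by rw [hσs, ha1]; ring,
    by rw [hσt, hb2]; ring, hM⟩

/-- The tangent is horizontal at the cusp and at both ends, so the total turn is 0. Both arcs are
monotone; over the vertical axis they become one graph. -/
lemma IsLeftwardCusp.exists_strand {s t hl hu : ℝ} {M : Set (ℝ × ℝ)}
    (H : IsLeftwardCusp s t hl hu M) :
    ∃ g σ : ℝ → ℝ, ContinuousOn g (Icc hl hu) ∧ ContinuousOn σ (Icc hl hu) ∧ g hl = s ∧ g hu = t ∧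
      σ hl = 0 ∧ σ hu = 0 ∧ IsTangentStrand M (fun y => (g y, y)) σ (Icc hl hu) := by
  obtain ⟨c, l, u, hlu, hs, ht, h1, h2, rfl⟩ := H
  obtain ⟨σ₁, hc1, ha1, hb1, hM1⟩ :=
    exists_isTangentStrand_of_arc h1 tendsto_arctan_nhds_zero tendsto_arctan_nhds_zero
  obtain ⟨σ₂, hc2, ha2, hb2, hM2⟩ :=
    exists_isTangentStrand_of_arc h2 tendsto_arctan_nhds_zero tendsto_arctan_nhds_zero
  obtain ⟨g₁, τ₁, hg1, hτ1, he1, hM1'⟩ := hM1.exists_swap h1.2.1 hc1 h1.strictAntiOn.injOn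
  obtain ⟨g₂, τ₂, hg2, hτ2, he2, hM2'⟩ := hM2.exists_swap h2.2.1 hc2 h2.strictMonoOn.injOn
  rw [h1.2.1.image_Icc_of_antitoneOn h1.1.le h1.strictAntiOn.antitoneOn, hs] at hg1 hτ1 hM1'
  rw [h2.2.1.image_Icc_of_monotoneOn h2.1.le h2.strictMonoOn.monotoneOn, ht, ← hlu] at hg2 hτ2 hM2'
  have m1 := left_mem_Icc.2 h1.1.le
  have m2 := right_mem_Icc.2 h1.1.le
  have m3 := left_mem_Icc.2 h2.1.le
  have m4 := right_mem_Icc.2 h2.1.le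
  obtain ⟨e1, e2⟩ := he1 c m1
  obtain ⟨e3, e4⟩ := he2 c m3
  obtain ⟨e5, e6⟩ := he1 s m2
  obtain ⟨e7, e8⟩ := he2 t m4
  rw [← hlu] at e3 e4
  rw [hs] at e5 e6
  rw [ht] at e7 e8
  obtain ⟨g', σ, hg, hσ, hgs, hgt, hσs, hσt, hM⟩ := exists_join_swap
    (hs ▸ h1.strictAntiOn.antitoneOn m1 m2 h1.1.le)
    (hlu ▸ ht ▸ h2.strictMonoOn.monotoneOn m3 m4 h2.1.le) hg1 hτ1 hg2 hτ2 (by rw [e1, e3])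
    (by rw [e2, e4, ha1, ha2]) hM1' hM2'
  exact ⟨g', σ, hg, hσ, by rw [hgs, e5], by rw [hgt, e7], by rw [hσs, e6, hb1],
    by rw [hσt, e8, hb2], hM⟩

/-- As on the left the total turn is 0; the angle is raised by π so that, as for the right round
curve, it is π at the top. -/
lemma IsRightwardCusp.exists_strand {s t hl hu : ℝ} {M : Set (ℝ × ℝ)}
    (H : IsRightwardCusp s t hl hu M) :
    ∃ g σ : ℝ → ℝ, ContinuousOn g (Icc hl hu) ∧ ContinuousOn σ (Icc hl hu) ∧ g hl = s ∧ g hu = t ∧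
      σ hl = Real.pi ∧ σ hu = Real.pi ∧
      IsTangentStrand M (fun y => (g y, y)) σ (Icc hl hu) := by
  obtain ⟨c, l, u, hlu, hs, ht, h1, h2, rfl⟩ := H
  obtain ⟨σ₁, hc1, ha1, hb1, hM1⟩ :=
    exists_isTangentStrand_of_arc h1 tendsto_arctan_nhds_zero tendsto_arctan_nhds_zero
  obtain ⟨σ₂, hc2, ha2, hb2, hM2⟩ :=
    exists_isTangentStrand_of_arc h2 tendsto_arctan_nhds_zero tendsto_arctan_nhds_zero
  obtain ⟨g₁, τ₁, hg1, hτ1, he1, hM1'⟩ := hM1.exists_swap h1.2.1 hc1 h1.strictMonoOn.injOn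
  obtain ⟨g₂, τ₂, hg2, hτ2, he2, hM2'⟩ := hM2.exists_swap h2.2.1 hc2 h2.strictAntiOn.injOn
  rw [h1.2.1.image_Icc_of_monotoneOn h1.1.le h1.strictMonoOn.monotoneOn, hs] at hg1 hτ1 hM1'
  rw [h2.2.1.image_Icc_of_antitoneOn h2.1.le h2.strictAntiOn.antitoneOn, ht, ← hlu] at hg2 hτ2 hM2'
  have m1 := left_mem_Icc.2 h1.1.le
  have m2 := right_mem_Icc.2 h1.1.le
  have m3 := left_mem_Icc.2 h2.1.le
  have m4 := right_mem_Icc.2 h2.1.le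
  obtain ⟨e1, e2⟩ := he1 c m2
  obtain ⟨e3, e4⟩ := he2 c m4
  obtain ⟨e5, e6⟩ := he1 s m1
  obtain ⟨e7, e8⟩ := he2 t m3
  rw [← hlu] at e3 e4
  rw [hs] at e5 e6
  rw [ht] at e7 e8
  obtain ⟨g', σ, hg, hσ, hgs, hgt, hσs, hσt, hM⟩ := exists_join_swap
    (hs ▸ h1.strictMonoOn.monotoneOn m1 m2 h1.1.le)
    (hlu ▸ ht ▸ h2.strictAntiOn.antitoneOn m3 m4 h2.1.le) hg1 hτ1 hg2 hτ2 (by rw [e1, e3])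
    (by rw [e2, e4, hb1, hb2]) hM1' hM2'
  have hM' := hM.add_int_mul_pi 1
  simp only [Int.cast_one, one_mul] at hM'
  exact ⟨g', fun y => σ y + Real.pi, hg, by fun_prop, by rw [hgs, e5], by rw [hgt, e7],
    by simp only [hσs, e6, ha1, zero_add], by simp only [hσt, e8, ha2, zero_add], hM'⟩

/-! ## Strands in convex regions -/

/-- Two strands over graphs in a convex open region, with equal ends and equal angles at the ends,
are isotopic within the region. -/
lemma isotopicRel_strand_of_convex {a b : ℝ} (hab : a < b) {g g' σ σ' : ℝ → ℝ}
    {W : Set (ℝ × ℝ)} (hW : IsOpen W) (hWc : Convex ℝ W) (hWne : ∃ x, x ∉ W)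
    (hg : ContinuousOn g (Icc a b)) (hg' : ContinuousOn g' (Icc a b))
    (hσ : ContinuousOn σ (Icc a b)) (hσ' : ContinuousOn σ' (Icc a b))
    (hgW : ∀ r ∈ Ioo a b, (r, g r) ∈ W) (hgW' : ∀ r ∈ Ioo a b, (r, g' r) ∈ W)
    (hga : g a = g' a) (hgb : g b = g' b) (hσa : σ a = σ' a) (hσb : σ b = σ' b) :
    IsotopicRel W ∅ (strand (fun r => (r, g r)) σ (Icc a b))
      (strand (fun r => (r, g' r)) σ' (Icc a b)) := by
  have hne : (Wᶜ).Nonempty := hWne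
  -- A margin: shifting either graph vertically by less than `η` stays in `W`, so the band between
  -- the graphs can be widened by `η`.
  let η : ℝ → ℝ := fun r => min (Metric.infDist (r, g r) Wᶜ) (Metric.infDist (r, g' r) Wᶜ)
  have hηc : ContinuousOn η (Ioo a b) := by
    have h1 : ContinuousOn (fun r => (r, g r)) (Ioo a b) :=
      continuousOn_id.prodMk (hg.mono Ioo_subset_Icc_self)
    have h2 : ContinuousOn (fun r => (r, g' r)) (Ioo a b) :=
      continuousOn_id.prodMk (hg'.mono Ioo_subset_Icc_self)
    exact ((Metric.continuous_infDist_pt Wᶜ).comp_continuousOn h1).inf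
      ((Metric.continuous_infDist_pt Wᶜ).comp_continuousOn h2)
  have hpos : ∀ x ∈ W, 0 < Metric.infDist x Wᶜ := fun x hx =>
    (hW.isClosed_compl.notMem_iff_infDist_pos hne).1 fun h => h hx
  have hη : ∀ r ∈ Ioo a b, 0 < η r := fun r hr =>
    lt_min (hpos _ (hgW r hr)) (hpos _ (hgW' r hr))
  have hball : ∀ r v τ, |τ| < Metric.infDist ((r, v) : ℝ × ℝ) Wᶜ → (r, v + τ) ∈ W := by
    intro r v τ hτ
    by_contra hn
    have h1 : Metric.infDist ((r, v) : ℝ × ℝ) Wᶜ ≤ _ := Metric.infDist_le_dist_of_mem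
      (mem_compl hn)
    have h2 : dist ((r, v) : ℝ × ℝ) (r, v + τ) = |τ| := by
      simp [Prod.dist_eq]
    linarith
  refine (isotopicRel_strand_graph hab hg hg' hσ hσ' (l := fun r => min (g r) (g' r) - η r)
    (h := fun r => max (g r) (g' r) + η r) ?_ ?_ ?_ ?_ hga hgb hσa hσb).mono ?_
  · exact ((hg.mono Ioo_subset_Icc_self).inf (hg'.mono Ioo_subset_Icc_self)).sub hηc
  · exact ((hg.mono Ioo_subset_Icc_self).sup (hg'.mono Ioo_subset_Icc_self)).add hηc
  · intro r hr
    have := hη r hr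
    exact ⟨by linarith [min_le_left (g r) (g' r)], by linarith [le_max_left (g r) (g' r)]⟩
  · intro r hr
    have := hη r hr
    exact ⟨by linarith [min_le_right (g r) (g' r)], by linarith [le_max_right (g r) (g' r)]⟩
  · rintro ⟨r, v⟩ ⟨hr, h1, h2⟩
    simp only at hr h1 h2
    have hη0 := hη r hr
    have hτ : ∀ τ, |τ| < η r → (r, g r + τ) ∈ W ∧ (r, g' r + τ) ∈ W := fun τ h =>
      ⟨hball _ _ _ (h.trans_le (min_le_left _ _)), hball _ _ _ (h.trans_le (min_le_right _ _))⟩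
    -- Both graphs are shifted by the same `τ`; convexity then fills in the vertical segment between
    -- the shifted points.
    have hseg : ∀ τ w, |τ| < η r → w ∈ Icc (min (g r) (g' r)) (max (g r) (g' r)) →
        (r, w + τ) ∈ W := by
      intro τ w h hw
      have hw' : w ∈ segment ℝ (g r) (g' r) := by rwa [segment_eq_uIcc]
      obtain ⟨s, t, hs, ht, hst, rfl⟩ := hw'
      have := hWc (hτ τ h).1 (hτ τ h).2 hs ht hst
      convert this using 1
      ext
      · simp [← add_mul, hst]
      · simp only [smul_eq_mul, Prod.snd_add, Prod.smul_snd]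
        linear_combination (-τ) * hst
    rcases lt_or_ge v (min (g r) (g' r)) with h3 | h3
    · have := hseg (v - min (g r) (g' r)) (min (g r) (g' r))
        (by rw [abs_lt]; constructor <;> linarith) ⟨le_rfl, min_le_max⟩
      simpa using this
    rcases lt_or_ge (max (g r) (g' r)) v with h4 | h4
    · have := hseg (v - max (g r) (g' r)) (max (g r) (g' r))
        (by rw [abs_lt]; constructor <;> linarith) ⟨min_le_max, le_rfl⟩
      simpa using this
    · simpa using hseg 0 v (by simpa using hη0) ⟨h3, h4⟩

/-- The version of `isotopicRel_strand_of_convex` for graphs over the second coordinate. -/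
lemma isotopicRel_strand_swap_of_convex {a b : ℝ} (hab : a < b) {g g' σ σ' : ℝ → ℝ}
    {W : Set (ℝ × ℝ)} (hW : IsOpen W) (hWc : Convex ℝ W) (hWne : ∃ x, x ∉ W)
    (hg : ContinuousOn g (Icc a b)) (hg' : ContinuousOn g' (Icc a b))
    (hσ : ContinuousOn σ (Icc a b)) (hσ' : ContinuousOn σ' (Icc a b))
    (hgW : ∀ r ∈ Ioo a b, (g r, r) ∈ W) (hgW' : ∀ r ∈ Ioo a b, (g' r, r) ∈ W)
    (hga : g a = g' a) (hgb : g b = g' b) (hσa : σ a = σ' a) (hσb : σ b = σ' b) :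
    IsotopicRel W ∅ (strand (fun r => (g r, r)) σ (Icc a b))
      (strand (fun r => (g' r, r)) σ' (Icc a b)) := by
  have hc : Convex ℝ (Prod.swap ⁻¹' W : Set (ℝ × ℝ)) :=
    hWc.linear_preimage (LinearEquiv.prodComm ℝ ℝ ℝ).toLinearMap
  have := (isotopicRel_strand_of_convex hab (hW.preimage continuous_swap) hc
    (hWne.imp' Prod.swap fun x hx => by simpa using hx) hg hg' hσ hσ' hgW hgW'
    hga hgb hσa hσb).conj (Homeomorph.prodComm ℝ ℝ)
  have key : ∀ (f ρ : ℝ → ℝ), {e : AngledPoint | ((Homeomorph.prodComm ℝ ℝ).symm e.1, e.2) ∈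
      strand (fun r => (r, f r)) ρ (Icc a b)} = strand (fun r => (f r, r)) ρ (Icc a b) := by
    intro f ρ
    ext ⟨⟨x, y⟩, u⟩
    simp [strand, and_comm]
  rw [key, key, image_empty] at this
  refine this.mono ?_
  rintro _ ⟨x, hx, rfl⟩
  exact hx

/-! ## Line arrangements in normal position -/

namespace LineArrangement

variable {n : ℕ} (A : LineArrangement n)

lemma sin_pos (i : Fin n) : 0 < Real.sin (A.θ i) :=
  Real.sin_pos_of_pos_of_lt_pi (by linarith [(A.θ_mem i).1, Real.pi_pos])
    (by linarith [(A.θ_mem i).2, Real.pi_pos])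

/-- The condition on the angles in the form used twice: it bounds the cotangent by 1, and it keeps
the lines away from the horizontal directions in `isotopicRel_horizontal_push`. -/
lemma cos_two_mul_nonpos (i : Fin n) : Real.cos (2 * A.θ i) ≤ 0 :=
  Real.cos_nonpos_of_pi_div_two_le_of_le (by linarith [(A.θ_mem i).1])
    (by linarith [(A.θ_mem i).2])

/-- The cotangent of the angle of the `i`-th line. -/
def cot (i : Fin n) : ℝ := Real.cos (A.θ i) / Real.sin (A.θ i)

lemma crossing_eq (i : Fin n) (z : ℝ) : A.crossing i z = A.a i + z * A.cot i := rfl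

lemma abs_cot_le_one (i : Fin n) : |A.cot i| ≤ 1 := by
  have h1 := A.sin_pos i
  have h2 := A.cos_two_mul_nonpos i
  rw [Real.cos_two_mul] at h2
  rw [cot, abs_div, abs_of_pos h1, div_le_one h1]
  refine abs_le_of_sq_le_sq ?_ h1.le
  nlinarith [Real.sin_sq_add_cos_sq (A.θ i)]

/-- Since the sine is positive, the sign of the form compares the abscissa with that of the line at
the same height. -/
lemma form_eq (i : Fin n) (x : ℝ × ℝ) :
    A.form i x = Real.sin (A.θ i) * (x.1 - A.crossing i x.2) := by
  have := (A.sin_pos i).ne'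
  rw [form, lineForm, crossing]
  field_simp
  ring

lemma form_pos_iff {i : Fin n} {x : ℝ × ℝ} : 0 < A.form i x ↔ A.crossing i x.2 < x.1 := by
  rw [form_eq, mul_pos_iff_of_pos_left (A.sin_pos i), sub_pos]

lemma form_neg_iff {i : Fin n} {x : ℝ × ℝ} : A.form i x < 0 ↔ x.1 < A.crossing i x.2 := by
  rw [form_eq]
  have := A.sin_pos i
  constructor <;> intro h <;> nlinarith

lemma form_eq_zero_iff {i : Fin n} {x : ℝ × ℝ} : A.form i x = 0 ↔ x.1 = A.crossing i x.2 := by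
  rw [form_eq, mul_eq_zero, sub_eq_zero, or_iff_right (A.sin_pos i).ne']

lemma continuous_form (i : Fin n) : Continuous (A.form i) := by
  unfold form lineForm
  fun_prop

lemma form_combo (i : Fin n) (x y : ℝ × ℝ) {s t : ℝ} (hst : s + t = 1) :
    A.form i (s • x + t • y) = s * A.form i x + t * A.form i y := by
  simp only [form, lineForm, Prod.fst_add, Prod.smul_fst, Prod.snd_add, Prod.smul_snd, smul_eq_mul]
  linear_combination (A.a i * Real.sin (A.θ i)) * hst

lemma convex_form_pos (i : Fin n) : Convex ℝ {x | 0 < A.form i x} := by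
  intro x hx y hy s t hs ht hst
  simp only [mem_ofPred_eq] at *
  rw [form_combo _ _ _ _ hst]
  rcases hs.eq_or_lt with rfl | hs'
  · rw [zero_add] at hst; simpa [hst] using hy
  · have := mul_pos hs' hx
    have := mul_nonneg ht hy.le
    linarith

lemma convex_form_neg (i : Fin n) : Convex ℝ {x | A.form i x < 0} := by
  intro x hx y hy s t hs ht hst
  simp only [mem_ofPred_eq] at *
  rw [form_combo _ _ _ _ hst]
  rcases hs.eq_or_lt with rfl | hs'
  · rw [zero_add] at hst; simpa [hst] using hy
  · have := mul_neg_of_pos_of_neg hs' hx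
    have := mul_nonpos_of_nonneg_of_nonpos ht hy.le
    linarith

/-- The slopes of two lines differ by less than the distance of their points on the axis. -/
lemma cot_sub_lt {i j : Fin n} (hij : i < j) :
    0 ≤ A.cot i - A.cot j ∧ A.cot i - A.cot j < A.a j - A.a i := by
  have ha := A.strictMono_a hij
  by_cases h0 : A.cot i - A.cot j = 0
  · exact ⟨h0.ge, by linarith⟩
  -- The height of the intersection point of the two lines. It exceeds 1 by normal position, which
  -- makes the denominator positive and smaller than the numerator.
  set z := (A.a j - A.a i) / (A.cot i - A.cot j) with hz
  have hcr : A.crossing j z = A.crossing i z := by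
    rw [crossing_eq, crossing_eq]
    have : z * (A.cot i - A.cot j) = A.a j - A.a i := div_mul_cancel₀ _ h0
    linarith
  have := A.intersection_mem i j hij.ne (A.crossing i z, z)
    ((A.form_eq_zero_iff (x := (A.crossing i z, z))).2 rfl)
    ((A.form_eq_zero_iff (x := (A.crossing i z, z))).2 hcr.symm)
  have hz1 : 1 < z := this.1
  have hpos : 0 < A.cot i - A.cot j := by
    by_contra hn
    have : z ≤ 0 := div_nonpos_of_nonneg_of_nonpos (by linarith) (not_lt.1 hn)
    linarith
  exact ⟨hpos.le, (one_lt_div hpos).1 hz1⟩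

lemma crossing_lt {i j : Fin n} (hij : i < j) {z : ℝ} (hz : z ∈ Icc (0 : ℝ) 1) :
    A.crossing i z < A.crossing j z := by
  obtain ⟨h1, h2⟩ := A.cot_sub_lt hij
  rw [crossing_eq, crossing_eq]
  have := mul_le_of_le_one_left h1 hz.2
  linarith [mul_sub z (A.cot i) (A.cot j)]

/-- At the height `R₀` the line is more than `R₀` away from both vertical sides. Descending to the
height `z` moves it sideways by at most `R₀ - z`, since its cotangent is at most 1 in absolute
value. -/
lemma crossing_mem (hR₀ : 1 < A.R₀) (i : Fin n) {z : ℝ} (hz : z ∈ Icc (0 : ℝ) 1) :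
    A.crossing i z ∈ Ioo (-A.R) A.R := by
  have h := A.top_mem i (A.crossing i A.R₀, A.R₀)
    ((A.form_eq_zero_iff (x := (A.crossing i A.R₀, A.R₀))).2 rfl) rfl
  simp only [crossing_eq, mem_Ioo] at h ⊢
  obtain ⟨h1, h2⟩ := abs_le.1 (A.abs_cot_le_one i)
  have hd : 0 ≤ A.R₀ - z := by linarith [hz.2]
  have e1 := mul_le_mul_of_nonneg_left h1 hd
  have e2 := mul_le_mul_of_nonneg_left h2 hd
  constructor <;> nlinarith [hz.1]

/-! ### Chambers -/

/-- A chamber is connected and avoids the zeros of the form, so the intermediate value theorem rules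
out the default value 0. -/
lemma chamberSign_cases {C : Set (ℝ × ℝ)} (hC : C ∈ A.chambers) (i : Fin n) :
    (A.chamberSign C i = 1 ∧ ∀ x ∈ C, 0 < A.form i x) ∨
      (A.chamberSign C i = -1 ∧ ∀ x ∈ C, A.form i x < 0) := by
  obtain ⟨x₀, hx₀, rfl⟩ := hC
  set C := connectedComponentIn A.complement x₀
  have hx₀C : x₀ ∈ C := mem_connectedComponentIn hx₀
  have hsub : C ⊆ A.complement := connectedComponentIn_subset _ _
  have hpre : IsPreconnected C := isPreconnected_connectedComponentIn
  by_cases h1 : ∀ x ∈ C, 0 < A.form i x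
  · exact Or.inl ⟨if_pos h1, h1⟩
  · have h2 : ∀ x ∈ C, A.form i x < 0 := by
      push Not at h1
      obtain ⟨y, hy, hy0⟩ := h1
      intro x hx
      by_contra hn
      obtain ⟨w, hw, hw0⟩ := hpre.intermediate_value hy hx
        (A.continuous_form i).continuousOn ⟨hy0, not_lt.1 hn⟩
      exact hsub hw i hw0
    exact Or.inr ⟨by rw [chamberSign, if_neg h1, if_pos h2], h2⟩

lemma exists_mem_chamber {C : Set (ℝ × ℝ)} (hC : C ∈ A.chambers) : ∃ x, x ∈ C := by
  obtain ⟨x, hx, rfl⟩ := hC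
  exact ⟨x, mem_connectedComponentIn hx⟩

/-- A chamber which does not meet the horizontal axis has a sign `-1` before a sign `1`. -/
lemma lt_of_mem_chambersF {C : Set (ℝ × ℝ)} (hC : C ∈ A.chambersF) {m₁ m₂ : Fin n}
    (h₁ : IsLeast {i | A.chamberSign C i = -1} m₁)
    (h₂ : IsGreatest {i | A.chamberSign C i = 1} m₂) : m₁ < m₂ := by
  obtain ⟨hCc, hCF⟩ := hC
  by_contra hn
  have e1 : A.chamberSign C m₁ = -1 := h₁.1
  have e2 : A.chamberSign C m₂ = 1 := h₂.1
  have hlt : m₂ < m₁ := by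
    refine lt_of_le_of_ne (not_lt.1 hn) fun e => ?_
    rw [e, e1] at e2
    norm_num at e2
  -- If `m₂ < m₁`, the signs are 1 up to `m₂` and -1 from `m₁` on. A point of the axis between these
  -- two lines has the same signs as the chamber, so a segment that misses all lines joins it to the
  -- chamber.
  set y : ℝ × ℝ := ((A.a m₂ + A.a m₁) / 2, 0) with hy
  have ha := A.strictMono_a hlt
  obtain ⟨x, hx⟩ := A.exists_mem_chamber hCc
  have hsign : ∀ i, (0 < A.form i x ∧ 0 < A.form i y) ∨ (A.form i x < 0 ∧ A.form i y < 0) := by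
    intro i
    have hcr : A.crossing i y.2 = A.a i := by simp [crossing_eq, hy]
    rcases A.chamberSign_cases hCc i with ⟨hi, hi'⟩ | ⟨hi, hi'⟩
    · left
      refine ⟨hi' x hx, A.form_pos_iff.2 ?_⟩
      have := A.strictMono_a.monotone (h₂.2 hi)
      rw [hcr, hy]
      simp only
      linarith
    · right
      refine ⟨hi' x hx, A.form_neg_iff.2 ?_⟩
      have := A.strictMono_a.monotone (h₁.2 hi)
      rw [hcr, hy]
      simp only
      linarith
  have hseg : _root_.segment ℝ x y ⊆ A.complement := by
    intro w hw i
    rcases hsign i with ⟨h1, h2⟩ | ⟨h1, h2⟩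
    · exact ((A.convex_form_pos i).segment_subset h1 h2 hw : 0 < A.form i w).ne'
    · exact ((A.convex_form_neg i).segment_subset h1 h2 hw : A.form i w < 0).ne
  have hyC : y ∈ C := by
    obtain ⟨x₀, hx₀, rfl⟩ := hCc
    rw [connectedComponentIn_eq hx]
    exact (convex_segment x y).isPreconnected.subset_connectedComponentIn (left_mem_segment ℝ x y)
      hseg (right_mem_segment ℝ x y)
  have : y ∈ C ∩ {x | x.2 = 0} := ⟨hyC, rfl⟩
  rw [hCF] at this
  exact this

/-- If a chamber has a sign `-1` before a sign `1`, then these lines intersect. -/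
lemma one_lt_R₀ {C : Set (ℝ × ℝ)} (hC : C ∈ A.chambers) {i j : Fin n} (hij : i < j)
    (hi : A.chamberSign C i = -1) (hj : A.chamberSign C j = 1) : 1 < A.R₀ := by
  obtain ⟨x, hx⟩ := A.exists_mem_chamber hC
  have h1 : A.form i x < 0 := by
    rcases A.chamberSign_cases hC i with ⟨h, -⟩ | ⟨-, h⟩
    · rw [hi] at h; norm_num at h
    · exact h x hx
  have h2 : 0 < A.form j x := by
    rcases A.chamberSign_cases hC j with ⟨-, h⟩ | ⟨h, -⟩
    · exact h x hx
    · rw [hj] at h; norm_num at h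
  -- At the height of `x` the two lines have the order opposite to that on the axis, so they are not
  -- parallel. Their intersection has a height between 1 and `R₀`.
  have h3 := (A.form_pos_iff.1 h2).trans (A.form_neg_iff.1 h1)
  rw [crossing_eq, crossing_eq] at h3
  have ha := A.strictMono_a hij
  have hne : A.cot i - A.cot j ≠ 0 := by
    intro h0
    rw [sub_eq_zero.1 h0] at h3
    linarith
  set z := (A.a j - A.a i) / (A.cot i - A.cot j) with hz
  have hcr : A.crossing j z = A.crossing i z := by
    rw [crossing_eq, crossing_eq]
    have : z * (A.cot i - A.cot j) = A.a j - A.a i := div_mul_cancel₀ _ hne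
    linarith
  have := A.intersection_mem i j hij.ne (A.crossing i z, z)
    ((A.form_eq_zero_iff (x := (A.crossing i z, z))).2 rfl)
    ((A.form_eq_zero_iff (x := (A.crossing i z, z))).2 hcr.symm)
  exact this.1.trans this.2

/-! ### Straightening the lines -/

/-- `κ` is a Lipschitz function with constant less than `1` which interpolates the slopes of the
lines. -/
def IsSlope (κ : ℝ → ℝ) : Prop :=
  (∃ L : NNReal, L < 1 ∧ LipschitzWith L κ) ∧ ∀ i, κ (A.a i) = A.cot i

/-- By `cot_sub_lt` all difference quotients of the cotangents over the base points are less than 1.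
There are finitely many, so their maximum is a Lipschitz constant below 1, and a real Lipschitz
function on a subset extends with the same constant. -/
lemma exists_isSlope : ∃ κ, A.IsSlope κ := by
  let ρ : Fin n × Fin n → NNReal := fun p =>
    Real.toNNReal (|A.cot p.1 - A.cot p.2| / |A.a p.1 - A.a p.2|)
  let L : NNReal := Finset.univ.sup ρ
  have hlt : ∀ i j, i ≠ j → |A.cot i - A.cot j| < |A.a i - A.a j| := by
    intro i j hij
    rcases lt_or_gt_of_ne hij with h | h
    · obtain ⟨h1, h2⟩ := A.cot_sub_lt h
      rw [abs_of_nonneg h1, abs_sub_comm, abs_of_pos (by linarith)]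
      exact h2
    · obtain ⟨h1, h2⟩ := A.cot_sub_lt h
      rw [abs_sub_comm, abs_of_nonneg h1, abs_of_pos (by linarith)]
      exact h2
  have hL : L < 1 := by
    refine (Finset.sup_lt_iff (by simp)).2 fun p _ => ?_
    rw [Real.toNNReal_lt_one]
    by_cases hp : p.1 = p.2
    · simp [hp]
    · have := hlt _ _ hp
      exact (div_lt_one ((abs_nonneg _).trans_lt this)).2 this
  have hLe : ∀ i j, |A.cot i - A.cot j| ≤ L * |A.a i - A.a j| := by
    intro i j
    by_cases hij : i = j
    · simp [hij]
    · have h1 : (0 : ℝ) < |A.a i - A.a j| := (abs_nonneg _).trans_lt (hlt i j hij)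
      rw [← div_le_iff₀ h1]
      have h2 : ρ (i, j) ≤ L := Finset.le_sup (Finset.mem_univ _)
      exact (Real.le_coe_toNNReal _).trans (NNReal.coe_le_coe.2 h2)
  let k : ℝ → ℝ := Function.extend A.a A.cot 0
  have hk : ∀ i, k (A.a i) = A.cot i := fun i => A.strictMono_a.injective.extend_apply _ _ i
  have hLip : LipschitzOnWith L k (range A.a) := by
    refine LipschitzOnWith.of_dist_le_mul ?_
    rintro _ ⟨i, rfl⟩ _ ⟨j, rfl⟩
    rw [hk, hk]
    exact hLe i j
  obtain ⟨κ, hκ, hκe⟩ := hLip.extend_real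
  exact ⟨κ, ⟨L, hL, hκ⟩, fun i => by rw [← hκe ⟨i, rfl⟩, hk]⟩

end LineArrangement

section Straighten

variable {L : NNReal} {κ : ℝ → ℝ}

/-- A perturbation of the identity by an `L`-Lipschitz function contracts distances at most by the
factor `1 - L`. This gives both surjectivity and the continuity of the inverse. -/
lemma sub_le_add_mul_sub (hκ : LipschitzWith L κ) {c : ℝ} (hc : c ∈ Icc (0 : ℝ) 1) (a b : ℝ) :
    (1 - L) * |a - b| ≤ |(a + c * κ a) - (b + c * κ b)| := by
  have h1 : |κ a - κ b| ≤ L * |a - b| := hκ.dist_le_mul a b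
  have h2 : |c * (κ a - κ b)| ≤ L * |a - b| := by
    rw [abs_mul, abs_of_nonneg hc.1]
    exact (mul_le_of_le_one_left (abs_nonneg _) hc.2).trans h1
  have h3 : |a - b| ≤ |(a + c * κ a) - (b + c * κ b)| + |c * (κ a - κ b)| := by
    have := abs_sub ((a + c * κ a) - (b + c * κ b)) (c * (κ a - κ b))
    rwa [show a + c * κ a - (b + c * κ b) - c * (κ a - κ b) = a - b by ring] at this
  linarith

lemma strictMono_add_mul (hL : L < 1) (hκ : LipschitzWith L κ) {c : ℝ}
    (hc : c ∈ Icc (0 : ℝ) 1) : StrictMono fun a => a + c * κ a := by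
  intro a b hab
  have h1 : |κ a - κ b| ≤ L * |a - b| := hκ.dist_le_mul a b
  have hL' : (L : ℝ) < 1 := by exact_mod_cast hL
  rw [abs_sub_comm a b, abs_of_pos (sub_pos.2 hab)] at h1
  have h2 : κ a - κ b < b - a := by
    have := le_abs_self (κ a - κ b)
    nlinarith
  simp only
  by_cases h0 : κ a - κ b ≤ 0
  · have := mul_nonpos_of_nonneg_of_nonpos hc.1 h0
    linarith [mul_sub c (κ a) (κ b)]
  · have := mul_le_of_le_one_left (not_le.1 h0).le hc.2
    linarith [mul_sub c (κ a) (κ b)]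

lemma surjective_add_mul (hL : L < 1) (hκ : LipschitzWith L κ) {c : ℝ}
    (hc : c ∈ Icc (0 : ℝ) 1) : Function.Surjective fun a => a + c * κ a := by
  intro s
  have hL' : 0 < 1 - (L : ℝ) := by
    have : (L : ℝ) < 1 := by exact_mod_cast hL
    linarith
  have hmono := (strictMono_add_mul hL hκ hc).monotone
  have hcont : Continuous fun a => a + c * κ a := by
    have := hκ.continuous
    fun_prop
  -- Large enough for the values at `-M` and `M` to enclose `s`.
  set M := |s - c * κ 0| / (1 - L) with hM
  have hM0 : 0 ≤ M := div_nonneg (abs_nonneg _) hL'.le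
  have hM1 : (1 - L) * M = |s - c * κ 0| := mul_div_cancel₀ _ hL'.ne'
  have h1 := sub_le_add_mul_sub hκ hc M 0
  have h2 := sub_le_add_mul_sub hκ hc (-M) 0
  have hm1 := hmono hM0
  have hm2 := hmono (neg_nonpos.2 hM0)
  simp only [sub_zero, zero_add, abs_neg, abs_of_nonneg hM0] at h1 h2 hm1 hm2
  rw [abs_of_nonneg (by linarith)] at h1
  rw [abs_of_nonpos (by linarith)] at h2
  have h3 := le_abs_self (s - c * κ 0)
  have h4 := neg_abs_le (s - c * κ 0)
  obtain ⟨a, -, ha⟩ := intermediate_value_Icc (by linarith : -M ≤ M) hcont.continuousOn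
    (⟨by linarith, by linarith⟩ : s ∈ Icc (-M + c * κ (-M)) (M + c * κ M))
  exact ⟨a, ha⟩

/-- The restriction of a height to `[0, 1]`. -/
def unitClamp (z : ℝ) : ℝ := max 0 (min 1 z)

lemma unitClamp_mem (z : ℝ) : unitClamp z ∈ Icc (0 : ℝ) 1 :=
  ⟨le_max_left _ _, max_le zero_le_one (min_le_left _ _)⟩

lemma unitClamp_of_mem {z : ℝ} (hz : z ∈ Icc (0 : ℝ) 1) : unitClamp z = z := clamp_of_mem hz

/-- A homeomorphism of the plane that carries the vertical line over `(a, 0)`, at heights between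
`0` and `1`, to the line through `(a, 0)` of slope `κ a`. -/
def straighten (hL : L < 1) (hκ : LipschitzWith L κ) : (ℝ × ℝ) ≃ₜ (ℝ × ℝ) where
  toFun x := (x.1 + unitClamp x.2 * κ x.1, x.2)
  invFun x := ((surjective_add_mul hL hκ (unitClamp_mem x.2) x.1).choose, x.2)
  left_inv x := by
    refine Prod.ext ?_ rfl
    exact (strictMono_add_mul hL hκ (unitClamp_mem x.2)).injective
      (surjective_add_mul hL hκ (unitClamp_mem x.2) (x.1 + unitClamp x.2 * κ x.1)).choose_spec
  right_inv x := by
    refine Prod.ext ?_ rfl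
    exact (surjective_add_mul hL hκ (unitClamp_mem x.2) x.1).choose_spec
  continuous_toFun := by
    have := hκ.continuous
    unfold unitClamp
    fun_prop
  continuous_invFun := by
    refine Continuous.prodMk ?_ continuous_snd
    rw [continuous_iff_continuousAt]
    intro x
    set f : ℝ × ℝ → ℝ := fun x => (surjective_add_mul hL hκ (unitClamp_mem x.2) x.1).choose
      with hf
    have hspec : ∀ x, f x + unitClamp x.2 * κ (f x) = x.1 := fun x =>
      (surjective_add_mul hL hκ (unitClamp_mem x.2) x.1).choose_spec
    have hL' : 0 < 1 - (L : ℝ) := by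
      have : (L : ℝ) < 1 := by exact_mod_cast hL
      linarith
    -- The distance of the preimages is bounded by the error made when `f x` is used as a preimage
    -- over `y`; this error is continuous in `y` and vanishes at `x`.
    have hle : ∀ y, ‖f y - f x‖ ≤
        |y.1 - (f x + unitClamp y.2 * κ (f x))| / (1 - L) := by
      intro y
      rw [le_div_iff₀ hL', mul_comm]
      have := sub_le_add_mul_sub hκ (unitClamp_mem y.2) (f y) (f x)
      rwa [hspec] at this
    have hlim : Tendsto (fun y : ℝ × ℝ => |y.1 - (f x + unitClamp y.2 * κ (f x))| / (1 - L))
        (𝓝 x) (𝓝 0) := by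
      have hc : Continuous fun y : ℝ × ℝ =>
          |y.1 - (f x + unitClamp y.2 * κ (f x))| / (1 - (L : ℝ)) := by
        unfold unitClamp
        fun_prop
      have := hc.tendsto x
      rwa [hspec, sub_self, abs_zero, zero_div] at this
    have := squeeze_zero_norm hle hlim
    exact tendsto_sub_nhds_zero_iff.1 this

end Straighten

/-- The pieces move one after another. Whenever one of them moves, the others are at their initial
or final position, so both positions have to avoid its region. -/
lemma IsotopicRel.biUnion {ι : Type*} {U : Set (ℝ × ℝ)} {Λ : Set (Set AngledPoint)} (s : Finset ι)
    {W : ι → Set (ℝ × ℝ)} {X Y : ι → Set AngledPoint}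
    (h : ∀ i ∈ s, IsotopicRel (W i) ∅ (X i) (Y i)) (hWU : ∀ i ∈ s, W i ⊆ U)
    (hX : ∀ i ∈ s, ∀ k ∈ s, k ≠ i → ∀ e ∈ X k, e.1 ∉ W i)
    (hY : ∀ i ∈ s, ∀ k ∈ s, k ≠ i → ∀ e ∈ Y k, e.1 ∉ W i)
    (hΛ : ∀ i ∈ s, ∀ B ∈ Λ, ∀ e ∈ B, e.1 ∉ W i) (R : Set AngledPoint)
    (hR : ∀ i ∈ s, ∀ e ∈ R, e.1 ∉ W i) :
    IsotopicRel U Λ (R ∪ ⋃ i ∈ s, X i) (R ∪ ⋃ i ∈ s, Y i) := by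
  classical
  induction s using Finset.induction_on generalizing R with
  | empty => simpa using IsotopicRel.refl U Λ R
  | insert k s hk ih =>
    have hsub : ∀ i ∈ s, i ∈ insert k s := fun i hi => Finset.mem_insert_of_mem hi
    have hks : k ∈ insert k s := Finset.mem_insert_self k s
    have hne : ∀ i ∈ s, k ≠ i := fun i hi e => hk (e ▸ hi)
    have step1 := ih (fun i hi => h i (hsub i hi)) (fun i hi => hWU i (hsub i hi))
      (fun i hi j hj => hX i (hsub i hi) j (hsub j hj))
      (fun i hi j hj => hY i (hsub i hi) j (hsub j hj)) (fun i hi => hΛ i (hsub i hi)) (R ∪ X k) (by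
        rintro i hi e (he | he)
        · exact hR i (hsub i hi) e he
        · exact hX i (hsub i hi) k hks (hne i hi) e he)
    have step2 : IsotopicRel U Λ ((R ∪ ⋃ i ∈ s, Y i) ∪ X k) ((R ∪ ⋃ i ∈ s, Y i) ∪ Y k) := by
      refine ((h k hks).union ?_ (hΛ k hks)).mono (hWU k hks)
      rintro e (he | he)
      · exact hR k hks e he
      · obtain ⟨i, hi, he⟩ := mem_iUnion₂.1 he
        exact hY k hks i (hsub i hi) (hne i hi).symm e he
    rw [Finset.set_biUnion_insert, Finset.set_biUnion_insert, ← union_assoc, ← union_assoc]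
    refine step1.trans ?_
    rwa [union_right_comm, union_right_comm R (Y k)]

lemma strand_biUnion {ι : Type*} (c : ℝ → ℝ × ℝ) (σ : ℝ → ℝ) (s : Set ι) (I : ι → Set ℝ) :
    strand c σ (⋃ i ∈ s, I i) = ⋃ i ∈ s, strand c σ (I i) := by
  ext e
  simp only [strand, mem_iUnion, mem_ofPred_eq]
  constructor
  · rintro ⟨r, ⟨i, hi, hr⟩, h⟩
    exact ⟨i, hi, r, hr, h⟩
  · rintro ⟨i, hi, r, hr, h⟩
    exact ⟨r, ⟨i, hi, hr⟩, h⟩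

/-! ### The chart, the regions between the lines, and the parts of a joined curve -/

namespace LineArrangement

variable {n : ℕ} (A : LineArrangement n)

/-- The homeomorphism of the plane given by an interpolation of the slopes. -/
def chart {κ : ℝ → ℝ} (hκ : A.IsSlope κ) : (ℝ × ℝ) ≃ₜ (ℝ × ℝ) :=
  straighten hκ.1.choose_spec.1 hκ.1.choose_spec.2

section Chart

variable {A} {κ : ℝ → ℝ} (hκ : A.IsSlope κ)

lemma chart_snd (x : ℝ × ℝ) : (A.chart hκ x).2 = x.2 := rfl

lemma chart_fst {a z : ℝ} (hz : z ∈ Icc (0 : ℝ) 1) : (A.chart hκ (a, z)).1 = a + z * κ a := by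
  have : (A.chart hκ (a, z)).1 = a + unitClamp z * κ a := rfl
  rw [this, unitClamp_of_mem hz]

lemma strictMono_chart (hκ : A.IsSlope κ) {z : ℝ} :
    StrictMono fun a => (A.chart hκ (a, z)).1 :=
  strictMono_add_mul hκ.1.choose_spec.1 hκ.1.choose_spec.2 (unitClamp_mem z)

lemma chart_node (i : Fin n) {z : ℝ} (hz : z ∈ Icc (0 : ℝ) 1) :
    (A.chart hκ (A.a i, z)).1 = A.crossing i z := by
  rw [chart_fst hκ hz, hκ.2, crossing_eq]

lemma chart_node' (i : Fin n) {z : ℝ} (hz : z ∈ Icc (0 : ℝ) 1) :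
    A.chart hκ (A.a i, z) = (A.crossing i z, z) :=
  Prod.ext (chart_node hκ i hz) rfl

lemma form_chart_pos_iff (i : Fin n) {a z : ℝ} (hz : z ∈ Icc (0 : ℝ) 1) :
    0 < A.form i (A.chart hκ (a, z)) ↔ A.a i < a := by
  rw [form_pos_iff, chart_snd, ← chart_node hκ i hz]
  exact (strictMono_chart hκ).lt_iff_lt

lemma form_chart_neg_iff (i : Fin n) {a z : ℝ} (hz : z ∈ Icc (0 : ℝ) 1) :
    A.form i (A.chart hκ (a, z)) < 0 ↔ a < A.a i := by
  rw [form_neg_iff, chart_snd, ← chart_node hκ i hz]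
  exact (strictMono_chart hκ).lt_iff_lt

lemma form_chart_eq_zero_iff (i : Fin n) {a z : ℝ} (hz : z ∈ Icc (0 : ℝ) 1) :
    A.form i (A.chart hκ (a, z)) = 0 ↔ a = A.a i := by
  rw [form_eq_zero_iff, chart_snd, ← chart_node hκ i hz]
  exact (strictMono_chart hκ).injective.eq_iff

/-- The chart keeps heights and is increasing at each height, so horizontal segments remain
horizontal segments and only their parametrization changes. -/
lemma strand_chart_horizontal (hκ : A.IsSlope κ) {z : ℝ} (a b : ℝ) (ω : ℝ → ℝ) :
    strand (fun s => (s, z)) (fun s => ω ((A.chart hκ).symm (s, z)).1)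
      (Icc (A.chart hκ (a, z)).1 (A.chart hκ (b, z)).1) =
    strand (fun a => A.chart hκ (a, z)) ω (Icc a b) := by
  have hinv : ∀ a, (A.chart hκ).symm ((A.chart hκ (a, z)).1, z) = (a, z) := fun a =>
    (A.chart hκ).symm_apply_apply (a, z)
  have himg : (fun a => (A.chart hκ (a, z)).1) '' Icc a b =
      Icc (A.chart hκ (a, z)).1 (A.chart hκ (b, z)).1 := by
    ext s
    constructor
    · rintro ⟨t, ht, rfl⟩
      exact ⟨(strictMono_chart hκ).monotone ht.1, (strictMono_chart hκ).monotone ht.2⟩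
    · intro hs
      have e : (A.chart hκ (((A.chart hκ).symm (s, z)).1, z)).1 = s :=
        congrArg Prod.fst ((A.chart hκ).apply_symm_apply (s, z))
      refine ⟨((A.chart hκ).symm (s, z)).1, ⟨?_, ?_⟩, e⟩
      · rw [← e] at hs
        exact (strictMono_chart hκ).le_iff_le.1 hs.1
      · rw [← e] at hs
        exact (strictMono_chart hκ).le_iff_le.1 hs.2
  rw [← himg, ← strand_comp]
  refine strand_congr (fun r _ => rfl) fun r _ => ?_
  simp only [Function.comp_apply, hinv]

end Chart

/-- The open strip at the heights between `0` and `1` in the rectangle. -/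
def strip : Set (ℝ × ℝ) := Ioo (-A.R) A.R ×ˢ Ioo 0 1

/-- The lift of the part of the `i`-th line at the heights between `0` and `1`. -/
def lineLift (i : Fin n) : Set AngledPoint :=
  {e | A.form i e.1 = 0 ∧ e.1.2 ∈ Ioo (0 : ℝ) 1 ∧ ∃ k : ℤ, e.2 = A.θ i + k * Real.pi}

variable {A}

/-- At heights in [0, 1] the lines have the order of their indices. With this lemma and its three
companions, disjointness of pieces becomes a comparison of indices. -/
lemma form_pos_of_lt {i j : Fin n} (hij : i < j) {x : ℝ × ℝ} (hx : x.2 ∈ Icc (0 : ℝ) 1)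
    (h : 0 ≤ A.form j x) : 0 < A.form i x := by
  rw [form_pos_iff]
  have h1 := A.crossing_lt hij hx
  have h2 := mt A.form_neg_iff.2 (not_lt.2 h)
  linarith

lemma form_neg_of_lt {i j : Fin n} (hij : i < j) {x : ℝ × ℝ} (hx : x.2 ∈ Icc (0 : ℝ) 1)
    (h : A.form i x ≤ 0) : A.form j x < 0 := by
  rw [form_neg_iff]
  have h1 := A.crossing_lt hij hx
  have h2 := mt A.form_pos_iff.2 (not_lt.2 h)
  linarith

lemma form_nonneg_of_le {i j : Fin n} (hij : i ≤ j) {x : ℝ × ℝ} (hx : x.2 ∈ Icc (0 : ℝ) 1)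
    (h : 0 ≤ A.form j x) : 0 ≤ A.form i x := by
  rcases hij.eq_or_lt with rfl | h'
  · exact h
  · exact (form_pos_of_lt h' hx h).le

lemma form_nonpos_of_le {i j : Fin n} (hij : i ≤ j) {x : ℝ × ℝ} (hx : x.2 ∈ Icc (0 : ℝ) 1)
    (h : A.form i x ≤ 0) : A.form j x ≤ 0 := by
  rcases hij.eq_or_lt with rfl | h'
  · exact h
  · exact (form_neg_of_lt h' hx h).le

variable (A)

/-- The region on the left of the `p`-th line and on the right of the preceding lines. -/
def leftRegion (hl hu : ℝ) (p : Fin n) : Set (ℝ × ℝ) :=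
  {x | A.form p x < 0 ∧ (∀ i < p, 0 < A.form i x) ∧ -A.R < x.1 ∧ x.2 ∈ Ioo hl hu}

/-- The region on the right of the `q`-th line and on the left of the following lines. -/
def rightRegion (hl hu : ℝ) (q : Fin n) : Set (ℝ × ℝ) :=
  {x | 0 < A.form q x ∧ (∀ i > q, A.form i x < 0) ∧ x.1 < A.R ∧ x.2 ∈ Ioo hl hu}

/-- The region between the `i`-th and the `j`-th line. -/
def betweenRegion (b hu : ℝ) (i j : Fin n) : Set (ℝ × ℝ) :=
  {x | 0 < A.form i x ∧ A.form j x < 0 ∧ x.2 ∈ Ioo b hu}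

lemma isOpen_form_pos (i : Fin n) : IsOpen {x | 0 < A.form i x} :=
  isOpen_lt continuous_const (A.continuous_form i)

lemma isOpen_form_neg (i : Fin n) : IsOpen {x | A.form i x < 0} :=
  isOpen_lt (A.continuous_form i) continuous_const

lemma convex_snd_mem_Ioo (b c : ℝ) : Convex ℝ {x : ℝ × ℝ | x.2 ∈ Ioo b c} :=
  (convex_Ioo b c).linear_preimage (LinearMap.snd ℝ ℝ ℝ)

lemma isOpen_snd_mem_Ioo (b c : ℝ) : IsOpen {x : ℝ × ℝ | x.2 ∈ Ioo b c} :=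
  isOpen_Ioo.preimage continuous_snd

lemma isOpen_leftRegion (hl hu : ℝ) (p : Fin n) : IsOpen (A.leftRegion hl hu p) := by
  have : A.leftRegion hl hu p = {x | A.form p x < 0} ∩ ((⋂ i, ⋂ (_ : i < p), {x | 0 < A.form i x}) ∩
      ({x | x.1 ∈ Ioi (-A.R)} ∩ {x | x.2 ∈ Ioo hl hu})) := by
    ext x; simp [leftRegion]
  rw [this]
  exact (A.isOpen_form_neg p).inter ((isOpen_iInter_of_finite fun i =>
    isOpen_iInter_of_finite fun _ => A.isOpen_form_pos i).inter
      ((isOpen_Ioi.preimage continuous_fst).inter (isOpen_snd_mem_Ioo hl hu)))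

lemma convex_leftRegion (hl hu : ℝ) (p : Fin n) : Convex ℝ (A.leftRegion hl hu p) := by
  have : A.leftRegion hl hu p = {x | A.form p x < 0} ∩ ((⋂ i, ⋂ (_ : i < p), {x | 0 < A.form i x}) ∩
      ({x | x.1 ∈ Ioi (-A.R)} ∩ {x | x.2 ∈ Ioo hl hu})) := by
    ext x; simp [leftRegion]
  rw [this]
  exact (A.convex_form_neg p).inter ((convex_iInter₂ fun i _ => A.convex_form_pos i).inter
      (((convex_Ioi _).linear_preimage (LinearMap.fst ℝ ℝ ℝ)).inter (convex_snd_mem_Ioo hl hu)))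

lemma isOpen_rightRegion (hl hu : ℝ) (q : Fin n) : IsOpen (A.rightRegion hl hu q) := by
  have : A.rightRegion hl hu q = {x | 0 < A.form q x} ∩
      ((⋂ i, ⋂ (_ : i > q), {x | A.form i x < 0}) ∩
      ({x | x.1 ∈ Iio A.R} ∩ {x | x.2 ∈ Ioo hl hu})) := by
    ext x; simp [rightRegion]
  rw [this]
  exact (A.isOpen_form_pos q).inter ((isOpen_iInter_of_finite fun i =>
    isOpen_iInter_of_finite fun _ => A.isOpen_form_neg i).inter
      ((isOpen_Iio.preimage continuous_fst).inter (isOpen_snd_mem_Ioo hl hu)))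

lemma convex_rightRegion (hl hu : ℝ) (q : Fin n) : Convex ℝ (A.rightRegion hl hu q) := by
  have : A.rightRegion hl hu q = {x | 0 < A.form q x} ∩
      ((⋂ i, ⋂ (_ : i > q), {x | A.form i x < 0}) ∩
      ({x | x.1 ∈ Iio A.R} ∩ {x | x.2 ∈ Ioo hl hu})) := by
    ext x; simp [rightRegion]
  rw [this]
  exact (A.convex_form_pos q).inter ((convex_iInter₂ fun i _ => A.convex_form_neg i).inter
      (((convex_Iio _).linear_preimage (LinearMap.fst ℝ ℝ ℝ)).inter (convex_snd_mem_Ioo hl hu)))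

lemma isOpen_betweenRegion (b hu : ℝ) (i j : Fin n) : IsOpen (A.betweenRegion b hu i j) :=
  (A.isOpen_form_pos i).inter ((A.isOpen_form_neg j).inter (isOpen_snd_mem_Ioo b hu))

lemma convex_betweenRegion (b hu : ℝ) (i j : Fin n) : Convex ℝ (A.betweenRegion b hu i j) :=
  (A.convex_form_pos i).inter ((A.convex_form_neg j).inter (convex_snd_mem_Ioo b hu))

/-- The angle, up to a rotation by a full turn of a line, at a line with the sign `s`. -/
def signAngle (s : ℤ) : ℝ := if s = -1 then Real.pi else 0

lemma signAngle_one : signAngle 1 = 0 := if_neg (by norm_num)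

lemma signAngle_neg_one : signAngle (-1) = Real.pi := if_pos rfl

variable {A}
variable {δ : Fin n → ℤ} {b hl hu : ℝ} {p q i j : Fin n} {M : Set (ℝ × ℝ)}

/-- The choice between a cusp and a round curve makes the angle at the lower point depend on the
sign and the angle at the upper point independent of it. -/
lemma IsLeftEnd.exists_strand (H : A.IsLeftEnd δ hl hu p M) :
    ∃ g σ : ℝ → ℝ, ContinuousOn g (Icc hl hu) ∧ ContinuousOn σ (Icc hl hu) ∧
      g hl = A.crossing p hl ∧ g hu = A.crossing p hu ∧ σ hl = signAngle (δ p) ∧ σ hu = 0 ∧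
      IsTangentStrand M (fun y => (g y, y)) σ (Icc hl hu) := by
  obtain ⟨⟨h1, h2⟩ | ⟨h1, h2⟩, -, -⟩ := H
  · rw [h1, signAngle_one]
    exact h2.exists_strand
  · rw [h1, signAngle_neg_one]
    exact h2.exists_strand

lemma IsRightEnd.exists_strand (H : A.IsRightEnd δ hl hu q M) :
    ∃ g σ : ℝ → ℝ, ContinuousOn g (Icc hl hu) ∧ ContinuousOn σ (Icc hl hu) ∧
      g hl = A.crossing q hl ∧ g hu = A.crossing q hu ∧ σ hl = signAngle (δ q) ∧ σ hu = Real.pi ∧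
      IsTangentStrand M (fun y => (g y, y)) σ (Icc hl hu) := by
  obtain ⟨⟨h1, h2⟩ | ⟨h1, h2⟩, -, -⟩ := H
  · rw [h1, signAngle_one]
    exact h2.exists_strand
  · rw [h1, signAngle_neg_one]
    exact h2.exists_strand

lemma IsLowerPart.exists_strand (H : A.IsLowerPart δ b hl hu i j M)
    (hij : A.crossing i hl < A.crossing j hl) :
    ∃ f σ : ℝ → ℝ, ContinuousOn f (Icc (A.crossing i hl) (A.crossing j hl)) ∧
      ContinuousOn σ (Icc (A.crossing i hl) (A.crossing j hl)) ∧
      f (A.crossing i hl) = hl ∧ f (A.crossing j hl) = hl ∧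
      σ (A.crossing i hl) = signAngle (δ i) ∧ σ (A.crossing j hl) = signAngle (δ j) ∧
      IsTangentStrand M (fun x => (x, f x)) σ (Icc (A.crossing i hl) (A.crossing j hl)) := by
  obtain ⟨⟨h1, h2, h3⟩ | ⟨h1, h2, h3⟩ | ⟨h1, h2⟩, -, -⟩ := H
  · rw [h1, h2, signAngle_one, signAngle_neg_one]
    exact h3.exists_strand
  · rw [h1, h2, signAngle_one, signAngle_neg_one]
    exact h3.exists_strand
  · rw [h1, h2]
    refine ⟨fun _ => hl, fun _ => signAngle (δ j), by fun_prop, by fun_prop, rfl, rfl, rfl, rfl, ?_⟩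
    have h := isTangentStrand_horizontal hij hl
    -- A horizontal segment has the angle 0 and equally π; the common sign decides which. Any value
    -- other than -1 gets 0.
    by_cases hj : δ j = -1
    · have h' := h.add_int_mul_pi 1
      simp only [Int.cast_one, one_mul, zero_add] at h'
      rw [hj, signAngle_neg_one]
      exact h'
    · rw [signAngle, if_neg hj]
      exact h

variable {κ : ℝ → ℝ} (hκ : A.IsSlope κ)

/-- The given end and the prescribed one are graphs over the same heights, in the same open convex
region, with equal end points and end angles, so `isotopicRel_strand_swap_of_convex` applies. -/
lemma IsLeftEnd.isotopicRel (H : A.IsLeftEnd δ hl hu p M) (hl0 : 0 ≤ hl) (hlu : hl < hu)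
    (hu1 : hu ≤ 1) {c σ' : ℝ → ℝ} (hc : Continuous c) (hσ' : Continuous σ')
    (hcl : c hl = A.a p) (hcu : c hu = A.a p) (hcp : ∀ z ∈ Ioo hl hu, c z < A.a p)
    (hci : ∀ z ∈ Ioo hl hu, ∀ i < p, A.a i < c z)
    (hcR : ∀ z ∈ Ioo hl hu, -A.R < (A.chart hκ (c z, z)).1)
    (hσl : σ' hl = signAngle (δ p)) (hσu : σ' hu = 0) :
    IsotopicRel (A.leftRegion hl hu p) ∅ (tangentLift M)
      (strand (fun z => A.chart hκ (c z, z)) σ' (Icc hl hu)) := by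
  obtain ⟨g, σ, hg, hσ, h1, h2, h3, h4, hM⟩ := H.exists_strand
  rw [hM.2.2]
  have hI : ∀ z ∈ Ioo hl hu, z ∈ Icc (0 : ℝ) 1 := fun z hz => ⟨by linarith [hz.1], by linarith [hz.2]⟩
  have hlI : hl ∈ Icc (0 : ℝ) 1 := ⟨hl0, by linarith⟩
  have huI : hu ∈ Icc (0 : ℝ) 1 := ⟨by linarith, hu1⟩
  refine isotopicRel_strand_swap_of_convex hlu (g' := fun z => (A.chart hκ (c z, z)).1)
    (A.isOpen_leftRegion hl hu p) (A.convex_leftRegion hl hu p)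
    ⟨(0, hl), fun h => lt_irrefl _ h.2.2.2.1⟩ hg ?_ hσ hσ'.continuousOn ?_ ?_ ?_ ?_ (h3.trans hσl.symm)
    (h4.trans hσu.symm)
  · exact ((A.chart hκ).continuous.comp (hc.prodMk continuous_id)).fst.continuousOn
  · intro z hz
    have hzM : (g z, z) ∈ M := by
      rw [hM.2.1]
      exact ⟨z, Ioo_subset_Icc_self hz, rfl⟩
    have hR := H.2.2 _ hzM
    rcases H.2.1 _ hzM with h | h | h
    · exact absurd (congrArg Prod.snd h) hz.1.ne'
    · exact absurd (congrArg Prod.snd h) hz.2.ne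
    · exact ⟨h, hR.2, hR.1, hz⟩
  · intro z hz
    exact ⟨(form_chart_neg_iff hκ p (hI z hz)).2 (hcp z hz),
      fun i hi => (form_chart_pos_iff hκ i (hI z hz)).2 (hci z hz i hi), hcR z hz, hz⟩
  · rw [h1, hcl, chart_node hκ p hlI]
  · rw [h2, hcu, chart_node hκ p huI]

lemma IsRightEnd.isotopicRel (H : A.IsRightEnd δ hl hu q M) (hl0 : 0 ≤ hl) (hlu : hl < hu)
    (hu1 : hu ≤ 1) {c σ' : ℝ → ℝ} (hc : Continuous c) (hσ' : Continuous σ')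
    (hcl : c hl = A.a q) (hcu : c hu = A.a q) (hcq : ∀ z ∈ Ioo hl hu, A.a q < c z)
    (hci : ∀ z ∈ Ioo hl hu, ∀ i > q, c z < A.a i)
    (hcR : ∀ z ∈ Ioo hl hu, (A.chart hκ (c z, z)).1 < A.R)
    (hσl : σ' hl = signAngle (δ q)) (hσu : σ' hu = Real.pi) :
    IsotopicRel (A.rightRegion hl hu q) ∅ (tangentLift M)
      (strand (fun z => A.chart hκ (c z, z)) σ' (Icc hl hu)) := by
  obtain ⟨g, σ, hg, hσ, h1, h2, h3, h4, hM⟩ := H.exists_strand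
  rw [hM.2.2]
  have hI : ∀ z ∈ Ioo hl hu, z ∈ Icc (0 : ℝ) 1 := fun z hz => ⟨by linarith [hz.1], by linarith [hz.2]⟩
  have hlI : hl ∈ Icc (0 : ℝ) 1 := ⟨hl0, by linarith⟩
  have huI : hu ∈ Icc (0 : ℝ) 1 := ⟨by linarith, hu1⟩
  refine isotopicRel_strand_swap_of_convex hlu (g' := fun z => (A.chart hκ (c z, z)).1)
    (A.isOpen_rightRegion hl hu q) (A.convex_rightRegion hl hu q)
    ⟨(0, hl), fun h => lt_irrefl _ h.2.2.2.1⟩ hg ?_ hσ hσ'.continuousOn ?_ ?_ ?_ ?_ (h3.trans hσl.symm)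
    (h4.trans hσu.symm)
  · exact ((A.chart hκ).continuous.comp (hc.prodMk continuous_id)).fst.continuousOn
  · intro z hz
    have hzM : (g z, z) ∈ M := by
      rw [hM.2.1]
      exact ⟨z, Ioo_subset_Icc_self hz, rfl⟩
    have hR := H.2.2 _ hzM
    rcases H.2.1 _ hzM with h | h | h
    · exact absurd (congrArg Prod.snd h) hz.1.ne'
    · exact absurd (congrArg Prod.snd h) hz.2.ne
    · exact ⟨h, hR.2, hR.1, hz⟩
  · intro z hz
    exact ⟨(form_chart_pos_iff hκ q (hI z hz)).2 (hcq z hz),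
      fun i hi => (form_chart_neg_iff hκ i (hI z hz)).2 (hci z hz i hi), hcR z hz, hz⟩
  · rw [h1, hcl, chart_node hκ q hlI]
  · rw [h2, hcu, chart_node hκ q huI]

/-- The cusp is flattened to a straight segment; its turning survives only in the angle `ω`, which
therefore need not be tangent to the new curve. -/
lemma IsLowerPart.isotopicRel (H : A.IsLowerPart δ b hl hu i j M) (hij : i < j) (hl0 : 0 ≤ hl)
    (hb : b < hl) (hlu : hl < hu) (hu1 : hu ≤ 1) {ω : ℝ → ℝ} (hω : Continuous ω)
    (hωi : ω (A.a i) = signAngle (δ i)) (hωj : ω (A.a j) = signAngle (δ j)) :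
    IsotopicRel (A.betweenRegion b hu i j) ∅ (tangentLift M)
      (strand (fun a => A.chart hκ (a, hl)) ω (Icc (A.a i) (A.a j))) := by
  have hlI : hl ∈ Icc (0 : ℝ) 1 := ⟨hl0, by linarith⟩
  have hlt := A.crossing_lt hij hlI
  obtain ⟨f, σ, hf, hσ, h1, h2, h3, h4, hM⟩ := H.exists_strand hlt
  have hinv : ∀ i, (A.chart hκ).symm (A.crossing i hl, hl) = (A.a i, hl) := fun i => by
    rw [← chart_node' hκ i hlI, Homeomorph.symm_apply_apply]
  rw [hM.2.2, ← strand_chart_horizontal, chart_node hκ i hlI, chart_node hκ j hlI]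
  refine isotopicRel_strand_of_convex hlt (g' := fun _ => hl) (A.isOpen_betweenRegion b hu i j)
    (A.convex_betweenRegion b hu i j) ⟨(0, hu), fun h => lt_irrefl _ h.2.2.2⟩ hf (by fun_prop) hσ
    ?_ ?_ ?_ h1 h2 ?_ ?_
  · exact (hω.comp ((A.chart hκ).symm.continuous.comp
      (continuous_id.prodMk continuous_const)).fst).continuousOn
  · intro s hs
    have hsM : (s, f s) ∈ M := by
      rw [hM.2.1]
      exact ⟨s, Ioo_subset_Icc_self hs, rfl⟩
    have hR := H.2.2 _ hsM
    rcases H.2.1 _ hsM with h | h | h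
    · exact absurd (congrArg Prod.fst h) hs.1.ne'
    · exact absurd (congrArg Prod.fst h) hs.2.ne
    · exact ⟨h.1, h.2, hR⟩
  · intro s hs
    exact ⟨A.form_pos_iff.2 hs.1, A.form_neg_iff.2 hs.2, hb, hlu⟩
  · simp only [h3, hinv, hωi]
  · simp only [h4, hinv, hωj]

end LineArrangement

/-! ### Prescribed ends and the normalization to a box -/

/-- The affine function with the values `P` at `hl` and `e` at `hu`. -/
def lineTo (P e hl hu z : ℝ) : ℝ := P + (z - hl) / (hu - hl) * (e - P)

section LineTo

variable {P e hl hu : ℝ}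

lemma lineTo_left (P e hl hu : ℝ) : lineTo P e hl hu hl = P := by simp [lineTo]

lemma lineTo_right (P e : ℝ) (h : hl < hu) : lineTo P e hl hu hu = e := by
  rw [lineTo, div_self (sub_pos.2 h).ne']; ring

lemma continuous_lineTo (P e hl hu : ℝ) : Continuous (lineTo P e hl hu) := by
  unfold lineTo
  fun_prop

lemma lineTo_neg (P e hl hu z : ℝ) : lineTo (-P) (-e) hl hu z = -lineTo P e hl hu z := by
  unfold lineTo
  ring

/-- A curve from `P` to `P` that follows the line from `P` to `e` until it reaches `α`, and then
turns back. -/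
lemma exists_bend {α : ℝ} (h : hl < hu) (heα : e < α) (hα : α < P) :
    ∃ b : ℝ → ℝ, Continuous b ∧ b hl = P ∧ b hu = P ∧ (∀ z ∈ Ioo hl hu, α ≤ b z ∧ b z < P) ∧
      ∀ z ∈ Icc hl hu, b z = lineTo P e hl hu z ∨ lineTo P e hl hu z ≤ α := by
  have hd : 0 < hu - hl := sub_pos.2 h
  -- The speed of descent along the line, and below it the time `w` needed to reach `α`. Since `e <
  -- α`, time remains for the way back.
  set s : ℝ := (P - e) / (hu - hl) with hs
  set w : ℝ := (P - α) / s with hw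
  have hs0 : 0 < s := div_pos (by linarith) hd
  have hw0 : 0 < w := div_pos (by linarith) hs0
  have hsw : s * w = P - α := mul_div_cancel₀ _ hs0.ne'
  have hsd : s * (hu - hl) = P - e := div_mul_cancel₀ _ hd.ne'
  have hwd : w < hu - hl := by
    by_contra hn
    have := mul_le_mul_of_nonneg_left (not_lt.1 hn) hs0.le
    linarith
  have hline : ∀ z, lineTo P e hl hu z = P - s * (z - hl) := by
    intro z
    rw [lineTo, hs]
    ring
  set m : ℝ := hu - hl - w with hm
  have hm0 : 0 < m := by linarith
  set ν : ℝ := (P - α) / m with hν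
  have hν0 : 0 < ν := div_pos (by linarith) hm0
  have hνm : ν * m = P - α := div_mul_cancel₀ _ hm0.ne'
  -- The maximum of the outgoing line and the line of slope `ν` that returns to `P`; they meet at
  -- the value `α`.
  refine ⟨fun z => max (P - s * (z - hl)) (P - ν * (hu - z)), by fun_prop, ?_, ?_, ?_, ?_⟩
  · simp only [sub_self, mul_zero, sub_zero]
    exact max_eq_left (by linarith [mul_pos hν0 hd])
  · simp only [sub_self, mul_zero, sub_zero]
    exact max_eq_right (by linarith [mul_pos hs0 hd])
  · intro z hz
    constructor
    · rw [le_max_iff]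
      rcases le_total (z - hl) w with h' | h'
      · left
        have := mul_le_mul_of_nonneg_left h' hs0.le
        linarith
      · right
        have := mul_le_mul_of_nonneg_left (by linarith : hu - z ≤ m) hν0.le
        linarith
    · rw [max_lt_iff]
      exact ⟨by linarith [mul_pos hs0 (sub_pos.2 hz.1)], by linarith [mul_pos hν0 (sub_pos.2 hz.2)]⟩
  · intro z hz
    rw [hline]
    rcases le_total (z - hl) w with h' | h'
    · left
      refine max_eq_left ?_
      have h1 := mul_le_mul_of_nonneg_left h' hs0.le
      have h2 := mul_le_mul_of_nonneg_left (by linarith : m ≤ hu - z) hν0.le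
      linarith
    · right
      have := mul_le_mul_of_nonneg_left h' hs0.le
      linarith

lemma exists_bend_right {α : ℝ} (h : hl < hu) (heα : α < e) (hα : P < α) :
    ∃ b : ℝ → ℝ, Continuous b ∧ b hl = P ∧ b hu = P ∧ (∀ z ∈ Ioo hl hu, P < b z ∧ b z ≤ α) ∧
      ∀ z ∈ Icc hl hu, b z = lineTo P e hl hu z ∨ α ≤ lineTo P e hl hu z := by
  obtain ⟨b, h1, h2, h3, h4, h5⟩ := exists_bend (P := -P) (e := -e) (α := -α) h
    (neg_lt_neg heα) (neg_lt_neg hα)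
  refine ⟨fun z => -b z, h1.neg, by simp only [h2, neg_neg], by simp only [h3, neg_neg], fun z hz => ?_,
    fun z hz => ?_⟩
  · obtain ⟨h6, h7⟩ := h4 z hz
    exact ⟨by linarith, by linarith⟩
  · rcases h5 z hz with h6 | h6
    · left
      show -b z = _
      rw [h6, lineTo_neg, neg_neg]
    · right; rw [lineTo_neg] at h6; linarith

end LineTo

/-- A closed curve of two ends, which are graphs of `bL` and `bR`, and two horizontal segments, with
its angles. -/
def boxCurve (bL bR σL σR ω : ℝ → ℝ) (hl hu P Q : ℝ) : Set AngledPoint :=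
  strand (fun z => (bL z, z)) σL (Icc hl hu) ∪ strand (fun a => (a, hu)) (fun _ => 0) (Icc P Q) ∪
    strand (fun a => (a, hl)) ω (Icc P Q) ∪ strand (fun z => (bR z, z)) σR (Icc hl hu)

lemma mem_strand_comp {c : ℝ → ℝ × ℝ} {σ : ℝ → ℝ} {I : Set ℝ} (j : (ℝ × ℝ) ≃ₜ (ℝ × ℝ)) :
    {e : AngledPoint | (j.symm e.1, e.2) ∈ strand c σ I} = strand (fun r => j (c r)) σ I := by
  ext e
  simp only [strand, mem_ofPred_eq]
  refine exists_congr fun r => and_congr_right fun _ => and_congr_left fun _ => ?_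
  exact j.symm_apply_eq

namespace LineArrangement

variable {n : ℕ} {A : LineArrangement n}

/-- The positions of four vertical lines on both sides of all the lines. -/
structure IsFrame {κ : ℝ → ℝ} (hκ : A.IsSlope κ) (dL eL eR dR : ℝ) : Prop where
  dL_lt : dL < eL
  lt_dR : eR < dR
  eL_lt : ∀ i, eL < A.a i
  lt_eR : ∀ i, A.a i < eR
  left : ∀ z ∈ Icc (0 : ℝ) 1, -A.R < (A.chart hκ (dL, z)).1
  right : ∀ z ∈ Icc (0 : ℝ) 1, (A.chart hκ (dR, z)).1 < A.R

variable (A) in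
/-- The function `ω` interpolates the angles at the lines, and is constant on the left of `α`, before
the `p`-th line, and on the right of `β`, after the `q`-th line. -/
structure IsAngle (δ : Fin n → ℤ) (ω : ℝ → ℝ) (eL α : ℝ) (p q : Fin n) (β eR : ℝ) : Prop where
  cont : Continuous ω
  node : ∀ i, ω (A.a i) = signAngle (δ i)
  eL_lt : eL < α
  lt_p : α < A.a p
  lt_α : ∀ i < p, A.a i < α
  left : ∀ x ≤ α, ω x = 0
  lt_β : A.a q < β
  lt_eR : β < eR
  β_lt : ∀ i > q, β < A.a i
  right : ∀ x ≥ β, ω x = Real.pi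

/-- The index of the following line. -/
def next (i : Fin n) : Fin n := if h : (i : ℕ) + 1 < n then ⟨i + 1, h⟩ else i

lemma next_val {i q : Fin n} (h : i < q) : (next i : ℕ) = i + 1 := by
  have : (i : ℕ) + 1 < n := by have := q.2; omega
  simp [next, this]

lemma lt_next {i q : Fin n} (h : i < q) : i < next i := by
  have := next_val h
  omega

lemma next_le {i q : Fin n} (h : i < q) : next i ≤ q := by
  have := next_val h
  omega

lemma biUnion_Icc_next {p q : Fin n} (hpq : p ≤ q) :
    ⋃ i ∈ Finset.Ico p q, Icc (A.a i) (A.a (next i)) = if p = q then ∅ else Icc (A.a p) (A.a q) := by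
  split_ifs with h
  · simp [h]
  have hpq' : p < q := lt_of_le_of_ne hpq h
  ext x
  simp only [mem_iUnion, Finset.mem_Ico, exists_prop]
  constructor
  · rintro ⟨i, ⟨h1, h2⟩, h3, h4⟩
    exact ⟨(A.strictMono_a.monotone h1).trans h3,
      h4.trans (A.strictMono_a.monotone (next_le h2))⟩
  · rintro ⟨h1, h2⟩
    -- The interval containing `x` starts at the last line from `p` on and before `q` whose base
    -- point does not exceed `x`.
    let s : Finset (Fin n) := (Finset.Ico p q).filter fun i => A.a i ≤ x
    have hs : s.Nonempty := ⟨p, by simp [s, hpq', h1]⟩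
    have hm := s.max'_mem hs
    set i := s.max' hs with hi
    simp only [s, Finset.mem_filter, Finset.mem_Ico] at hm
    refine ⟨i, hm.1, hm.2, ?_⟩
    rcases (next_le hm.1.2).eq_or_lt with h3 | h3
    · rwa [h3]
    · by_contra hn
      have : next i ∈ s := by
        simp only [s, Finset.mem_filter, Finset.mem_Ico]
        exact ⟨⟨hm.1.1.trans (lt_next hm.1.2).le, h3⟩, (not_le.1 hn).le⟩
      exact absurd (s.le_max' _ this) (not_le.2 (lt_next hm.1.2))

variable {δ : Fin n → ℤ} {b hl hu : ℝ} {p q i j : Fin n} {M : Set (ℝ × ℝ)}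

lemma IsLeftEnd.form_nonpos (H : A.IsLeftEnd δ hl hu p M) {x : ℝ × ℝ} (hx : x ∈ M) :
    A.form p x ≤ 0 := by
  rcases H.2.1 x hx with rfl | rfl | h
  · exact (A.form_eq_zero_iff.2 rfl).le
  · exact (A.form_eq_zero_iff.2 rfl).le
  · exact h.le

lemma IsRightEnd.form_nonneg (H : A.IsRightEnd δ hl hu q M) {x : ℝ × ℝ} (hx : x ∈ M) :
    0 ≤ A.form q x := by
  rcases H.2.1 x hx with rfl | rfl | h
  · exact (A.form_eq_zero_iff.2 rfl).ge
  · exact (A.form_eq_zero_iff.2 rfl).ge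
  · exact h.le

lemma IsLeftEnd.snd_mem (H : A.IsLeftEnd δ hl hu p M) {x : ℝ × ℝ} (hx : x ∈ M) :
    x.2 ∈ Icc hl hu := by
  obtain ⟨g, σ, -, -, -, -, -, -, hM⟩ := H.exists_strand
  rw [hM.2.1] at hx
  obtain ⟨z, hz, rfl⟩ := hx
  exact hz

lemma IsRightEnd.snd_mem (H : A.IsRightEnd δ hl hu q M) {x : ℝ × ℝ} (hx : x ∈ M) :
    x.2 ∈ Icc hl hu := by
  obtain ⟨g, σ, -, -, -, -, -, -, hM⟩ := H.exists_strand
  rw [hM.2.1] at hx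
  obtain ⟨z, hz, rfl⟩ := hx
  exact hz

lemma IsLowerPart.form_between (H : A.IsLowerPart δ b hl hu i j M) (hij : i < j)
    (hl1 : hl ∈ Icc (0 : ℝ) 1) {x : ℝ × ℝ} (hx : x ∈ M) : 0 ≤ A.form i x ∧ A.form j x ≤ 0 := by
  rcases H.2.1 x hx with rfl | rfl | h
  · have : A.form i (A.crossing i hl, hl) = 0 := A.form_eq_zero_iff.2 rfl
    exact ⟨this.ge, (form_neg_of_lt hij hl1 this.le).le⟩
  · have : A.form j (A.crossing j hl, hl) = 0 := A.form_eq_zero_iff.2 rfl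
    exact ⟨(form_pos_of_lt hij hl1 this.ge).le, this.le⟩
  · exact ⟨h.1.le, h.2.le⟩

/-- Up to isotopy in the complement of the lines, the ends of a joined curve may be prescribed, and
the lower curve is a horizontal segment. -/
lemma IsJoinedCurve.isotopicRel_boxCurve {κ : ℝ → ℝ} (hκ : A.IsSlope κ) (hR₀ : 1 < A.R₀)
    {h ε : ℝ} (hh : ε < h) (hh1 : h < 1 - ε) {γ : Set (ℝ × ℝ)} (hpq : p < q)
    (H : A.IsJoinedCurve δ h ε p q γ) {ω : ℝ → ℝ} {dL eL eR dR α β : ℝ}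
    (hF : IsFrame hκ dL eL eR dR) (hω : A.IsAngle δ ω eL α p q β eR) :
    ∃ (hl hu : ℝ) (bL bR : ℝ → ℝ), 0 < hl ∧ hl < hu ∧ hu < 1 ∧
      (Continuous bL ∧ bL hl = A.a p ∧ bL hu = A.a p ∧
        (∀ z ∈ Ioo hl hu, α ≤ bL z ∧ bL z < A.a p) ∧
        ∀ z ∈ Icc hl hu, bL z = lineTo (A.a p) eL hl hu z ∨ lineTo (A.a p) eL hl hu z ≤ α) ∧
      (Continuous bR ∧ bR hl = A.a q ∧ bR hu = A.a q ∧
        (∀ z ∈ Ioo hl hu, A.a q < bR z ∧ bR z ≤ β) ∧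
        ∀ z ∈ Icc hl hu, bR z = lineTo (A.a q) eR hl hu z ∨ β ≤ lineTo (A.a q) eR hl hu z) ∧
      IsotopicRel A.strip (range A.lineLift) (tangentLift γ)
        {e | ((A.chart hκ).symm e.1, e.2) ∈ boxCurve bL bR
          (fun z => ω (lineTo (A.a p) eL hl hu z)) (fun z => ω (lineTo (A.a q) eR hl hu z)) ω
          hl hu (A.a p) (A.a q)} := by
  obtain ⟨hl, hu, left, right, lower, hbl, hlu, hub, hL, hRt, hlow, rfl⟩ := H
  -- The ends must stay clear of the neighbouring lines, so they turn back at `α` and `β`. Their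
  -- angles nevertheless follow the straight lines out to `eL` and `eR`, ready for the later push.
  obtain ⟨bL, hbL⟩ := exists_bend hlu hω.eL_lt hω.lt_p
  obtain ⟨bR, hbR⟩ := exists_bend_right hlu hω.lt_eR hω.lt_β
  refine ⟨hl, hu, bL, bR, by linarith, hlu, by linarith, hbL, hbR, ?_⟩
  obtain ⟨hbLc, hbLl, hbLu, hbLm, -⟩ := hbL
  obtain ⟨hbRc, hbRl, hbRu, hbRm, -⟩ := hbR
  have hl0 : 0 ≤ hl := by linarith
  have hu1 : hu ≤ 1 := by linarith
  have hlI : hl ∈ Icc (0 : ℝ) 1 := ⟨hl0, by linarith⟩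
  have hmemI : ∀ z, z ∈ Icc hl hu → z ∈ Icc (0 : ℝ) 1 := fun z hz =>
    ⟨hl0.trans hz.1, hz.2.trans hu1⟩
  have hlow' : ∀ i ∈ Finset.Ico p q, A.IsLowerPart δ (h - ε) hl hu i (next i) (lower i) := by
    intro i hi
    rw [Finset.mem_Ico] at hi
    exact hlow i (next i) hi.1 (next_le hi.2) (next_val hi.2).symm
  have hnext : ∀ i ∈ Finset.Ico p q, i < next i := fun i hi => lt_next (Finset.mem_Ico.1 hi).2
  -- the pieces after the isotopies
  set NL := strand (fun z => A.chart hκ (bL z, z)) (fun z => ω (lineTo (A.a p) eL hl hu z))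
    (Icc hl hu) with hNL
  set NR := strand (fun z => A.chart hκ (bR z, z)) (fun z => ω (lineTo (A.a q) eR hl hu z))
    (Icc hl hu) with hNR
  set Y : Fin n → Set AngledPoint := fun i =>
    strand (fun a => A.chart hκ (a, hl)) ω (Icc (A.a i) (A.a (next i))) with hY
  set T := strand (fun a => A.chart hκ (a, hu)) (fun _ => 0) (Icc (A.a p) (A.a q)) with hT
  set X : Fin n → Set AngledPoint := fun i => tangentLift (lower i) with hX
  set W : Fin n → Set (ℝ × ℝ) := fun i => A.betweenRegion (h - ε) hu i (next i) with hW
  -- the isotopies of the pieces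
  have iL : IsotopicRel (A.leftRegion hl hu p) ∅ (tangentLift left) NL := by
    refine hL.isotopicRel hκ hl0 hlu hu1 hbLc (hω.cont.comp (continuous_lineTo _ _ _ _)) hbLl hbLu
      (fun z hz => (hbLm z hz).2) (fun z hz i hi => (hω.lt_α i hi).trans_le (hbLm z hz).1)
      (fun z hz => ?_) ?_ ?_
    · refine (hF.left z (hmemI z (Ioo_subset_Icc_self hz))).trans (strictMono_chart hκ ?_)
      linarith [hF.dL_lt, hω.eL_lt, (hbLm z hz).1]
    · simp only [lineTo_left, hω.node]
    · simp only [lineTo_right _ _ hlu]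
      exact hω.left _ hω.eL_lt.le
  have iR : IsotopicRel (A.rightRegion hl hu q) ∅ (tangentLift right) NR := by
    refine hRt.isotopicRel hκ hl0 hlu hu1 hbRc (hω.cont.comp (continuous_lineTo _ _ _ _)) hbRl hbRu
      (fun z hz => (hbRm z hz).1) (fun z hz i hi => (hbRm z hz).2.trans_lt (hω.β_lt i hi))
      (fun z hz => ?_) ?_ ?_
    · refine lt_trans (strictMono_chart hκ ?_) (hF.right z (hmemI z (Ioo_subset_Icc_self hz)))
      linarith [hF.lt_dR, hω.lt_eR, (hbRm z hz).2]
    · simp only [lineTo_left, hω.node]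
    · simp only [lineTo_right _ _ hlu]
      exact hω.right _ hω.lt_eR.le
  have iM : ∀ i ∈ Finset.Ico p q, IsotopicRel (W i) ∅ (X i) (Y i) := fun i hi =>
    (hlow' i hi).isotopicRel hκ (hnext i hi) hl0 hbl hlu hu1 hω.cont (hω.node _) (hω.node _)
  -- positions of the pieces
  have pL : ∀ e ∈ tangentLift left, A.form p e.1 ≤ 0 ∧ e.1.2 ∈ Icc (0 : ℝ) 1 := fun e he =>
    ⟨hL.form_nonpos he.1, hmemI _ (hL.snd_mem he.1)⟩
  have pR : ∀ e ∈ tangentLift right, 0 ≤ A.form q e.1 ∧ e.1.2 ∈ Icc (0 : ℝ) 1 := fun e he =>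
    ⟨hRt.form_nonneg he.1, hmemI _ (hRt.snd_mem he.1)⟩
  have pNL : ∀ e ∈ NL, A.form p e.1 ≤ 0 ∧ e.1.2 ∈ Icc (0 : ℝ) 1 := by
    rintro ⟨x, u⟩ ⟨z, hz, hx, -⟩
    simp only at hx
    subst hx
    refine ⟨?_, hmemI z hz⟩
    rw [← not_lt, form_chart_pos_iff hκ p (hmemI z hz), not_lt]
    rcases eq_or_lt_of_le hz.1 with rfl | h1
    · exact hbLl.le
    rcases eq_or_lt_of_le hz.2 with rfl | h2
    · exact hbLu.le
    · exact (hbLm z ⟨h1, h2⟩).2.le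
  have pNR : ∀ e ∈ NR, 0 ≤ A.form q e.1 ∧ e.1.2 ∈ Icc (0 : ℝ) 1 := by
    rintro ⟨x, u⟩ ⟨z, hz, hx, -⟩
    simp only at hx
    subst hx
    refine ⟨?_, hmemI z hz⟩
    rw [← not_lt, form_chart_neg_iff hκ q (hmemI z hz), not_lt]
    rcases eq_or_lt_of_le hz.1 with rfl | h1
    · exact hbRl.ge
    rcases eq_or_lt_of_le hz.2 with rfl | h2
    · exact hbRu.ge
    · exact (hbRm z ⟨h1, h2⟩).1.le
  have pX : ∀ i ∈ Finset.Ico p q, ∀ e ∈ X i, 0 ≤ A.form i e.1 ∧ A.form (next i) e.1 ≤ 0 ∧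
      e.1.2 ∈ Icc (0 : ℝ) 1 := fun i hi e he => by
    obtain ⟨h1, h2⟩ := (hlow' i hi).form_between (hnext i hi) hlI he.1
    have := (hlow' i hi).2.2 _ he.1
    exact ⟨h1, h2, by linarith, by linarith⟩
  have pY : ∀ i ∈ Finset.Ico p q, ∀ e ∈ Y i, 0 ≤ A.form i e.1 ∧ A.form (next i) e.1 ≤ 0 ∧
      e.1.2 ∈ Icc (0 : ℝ) 1 := by
    rintro i hi ⟨x, u⟩ ⟨a, ha, hx, -⟩
    simp only at hx
    subst hx
    refine ⟨?_, ?_, hlI⟩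
    · rw [← not_lt, form_chart_neg_iff hκ i hlI, not_lt]
      exact ha.1
    · rw [← not_lt, form_chart_pos_iff hκ _ hlI, not_lt]
      exact ha.2
  have pT : ∀ e ∈ T, e.1.2 = hu := by
    rintro ⟨x, u⟩ ⟨a, ha, hx, -⟩
    simp only at hx
    subst hx
    rfl
  have pΛ : ∀ B ∈ range A.lineLift, ∀ e ∈ B, ∃ k, A.form k e.1 = 0 ∧ e.1.2 ∈ Icc (0 : ℝ) 1 := by
    rintro _ ⟨k, rfl⟩ e he
    exact ⟨k, he.1, Ioo_subset_Icc_self he.2.1⟩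
  -- the regions avoid the other pieces
  have nL : ∀ e : AngledPoint, e.1.2 ∈ Icc (0 : ℝ) 1 → ∀ i, p ≤ i → 0 ≤ A.form i e.1 →
      e.1 ∉ A.leftRegion hl hu p := fun e he i hi hf hm =>
    absurd (form_nonneg_of_le hi he hf) (not_le.2 hm.1)
  have nR : ∀ e : AngledPoint, e.1.2 ∈ Icc (0 : ℝ) 1 → ∀ i, i ≤ q → A.form i e.1 ≤ 0 →
      e.1 ∉ A.rightRegion hl hu q := fun e he i hi hf hm =>
    absurd (form_nonpos_of_le hi he hf) (not_le.2 hm.1)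
  have nW : ∀ i, ∀ e : AngledPoint, e.1.2 ∈ Icc (0 : ℝ) 1 →
      ((∃ k, k ≤ i ∧ A.form k e.1 ≤ 0) ∨ ∃ k, next i ≤ k ∧ 0 ≤ A.form k e.1) → e.1 ∉ W i := by
    rintro i e he (⟨k, hk, hf⟩ | ⟨k, hk, hf⟩) hm
    · exact absurd (form_nonpos_of_le hk he hf) (not_le.2 hm.1)
    · exact absurd (form_nonneg_of_le hk he hf) (not_le.2 hm.2.1)
  have nWk : ∀ i ∈ Finset.Ico p q, ∀ k ∈ Finset.Ico p q, k ≠ i → ∀ e : AngledPoint,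
      0 ≤ A.form k e.1 ∧ A.form (next k) e.1 ≤ 0 ∧ e.1.2 ∈ Icc (0 : ℝ) 1 → e.1 ∉ W i := by
    intro i hi k hk hki e ⟨h1, h2, h3⟩
    rcases lt_or_gt_of_ne hki with h | h
    · exact nW i e h3 (Or.inl ⟨next k, next_le h, h2⟩)
    · exact nW i e h3 (Or.inr ⟨k, next_le h, h1⟩)
  -- the regions are in the strip
  have sI : ∀ x : ℝ × ℝ, x.2 ∈ Ioo (h - ε) hu → x.2 ∈ Ioo (0 : ℝ) 1 := fun x hx =>
    ⟨by linarith [hx.1], by linarith [hx.2]⟩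
  have sL : A.leftRegion hl hu p ⊆ A.strip := by
    intro x hx
    have hx2 : x.2 ∈ Ioo (0 : ℝ) 1 := ⟨hl0.trans_lt hx.2.2.2.1, hx.2.2.2.2.trans_le hu1⟩
    exact ⟨⟨hx.2.2.1, (A.form_neg_iff.1 hx.1).trans
      (A.crossing_mem hR₀ p (Ioo_subset_Icc_self hx2)).2⟩, hx2⟩
  have sR : A.rightRegion hl hu q ⊆ A.strip := by
    intro x hx
    have hx2 : x.2 ∈ Ioo (0 : ℝ) 1 := ⟨hl0.trans_lt hx.2.2.2.1, hx.2.2.2.2.trans_le hu1⟩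
    exact ⟨⟨(A.crossing_mem hR₀ q (Ioo_subset_Icc_self hx2)).1.trans (A.form_pos_iff.1 hx.1),
      hx.2.2.1⟩, hx2⟩
  have sW : ∀ i, W i ⊆ A.strip := by
    intro i x hx
    have hx2 := sI x hx.2.2
    exact ⟨⟨(A.crossing_mem hR₀ i (Ioo_subset_Icc_self hx2)).1.trans (A.form_pos_iff.1 hx.1),
      (A.form_neg_iff.1 hx.2.1).trans
      (A.crossing_mem hR₀ _ (Ioo_subset_Icc_self hx2)).2⟩, hx2⟩
  -- the lift of the whole curve
  have hcross : A.crossing p hu < A.crossing q hu := A.crossing_lt hpq ⟨by linarith, hu1⟩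
  have hTop : tangentLift (A.horizontal p q hu) = T := by
    rw [hT, ← strand_chart_horizontal, chart_node hκ p ⟨by linarith, hu1⟩,
      chart_node hκ q ⟨by linarith, hu1⟩]
    exact (isTangentStrand_horizontal hcross hu).2.2
  have hcl : ∀ i ∈ Finset.Ico p q, IsClosed (lower i) := by
    intro i hi
    obtain ⟨f, σ, -, -, -, -, -, -, hM⟩ :=
      (hlow' i hi).exists_strand (A.crossing_lt (hnext i hi) hlI)
    exact hM.1
  have hIco : (⋃ i ∈ Ico p q, lower i) = ⋃ i ∈ (Finset.Ico p q : Set (Fin n)), lower i := by simp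
  have hwhole : tangentLift (left ∪ A.horizontal p q hu ∪ (⋃ i ∈ Ico p q, lower i) ∪ right) =
      tangentLift left ∪ T ∪ (⋃ i ∈ Finset.Ico p q, X i) ∪ tangentLift right := by
    obtain ⟨g, σ, -, -, -, -, -, -, hM⟩ := hL.exists_strand
    obtain ⟨g', σ', -, -, -, -, -, -, hM'⟩ := hRt.exists_strand
    have c1 : IsClosed (A.horizontal p q hu) := (isTangentStrand_horizontal hcross hu).1
    have c2 : IsClosed (⋃ i ∈ (Finset.Ico p q : Set (Fin n)), lower i) :=
      (Finset.finite_toSet _).isClosed_biUnion fun i hi => hcl i hi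
    rw [hIco, tangentLift_union ((hM.1.union c1).union c2) hM'.1,
      tangentLift_union (hM.1.union c1) c2, tangentLift_union hM.1 c1,
      tangentLift_biUnion _ (Finset.finite_toSet _) _ (fun i hi => hcl i hi)]
    rw [← hTop]
    rfl
  have hend : {e : AngledPoint | ((A.chart hκ).symm e.1, e.2) ∈ boxCurve bL bR
          (fun z => ω (lineTo (A.a p) eL hl hu z)) (fun z => ω (lineTo (A.a q) eR hl hu z)) ω
          hl hu (A.a p) (A.a q)} = NL ∪ T ∪ (⋃ i ∈ Finset.Ico p q, Y i) ∪ NR := by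
    have hYu : (⋃ i ∈ Finset.Ico p q, Y i) =
        strand (fun a => A.chart hκ (a, hl)) ω (Icc (A.a p) (A.a q)) := by
      have h1 := biUnion_Icc_next (A := A) hpq.le
      rw [if_neg hpq.ne] at h1
      rw [← h1]
      exact (strand_biUnion _ ω (Finset.Ico p q : Set (Fin n)) _).symm
    rw [hYu, hNL, hNR, hT, ← mem_strand_comp, ← mem_strand_comp, ← mem_strand_comp,
      ← mem_strand_comp]
    rfl
  rw [hwhole, hend]
  have hmid : ∀ e ∈ ⋃ i ∈ Finset.Ico p q, X i, ∃ i ∈ Finset.Ico p q, 0 ≤ A.form i e.1 ∧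
      A.form (next i) e.1 ≤ 0 ∧ e.1.2 ∈ Icc (0 : ℝ) 1 := by
    intro e he
    obtain ⟨i, hi, he⟩ := mem_iUnion₂.1 he
    exact ⟨i, hi, pX i hi e he⟩
  -- The left end, the right end and the lower parts move in turn, each in its own region, which
  -- avoids all the other pieces and all the lines. The upper segment is avoided because the regions
  -- lie below its height.
  have step1 : IsotopicRel A.strip (range A.lineLift)
      ((T ∪ (⋃ i ∈ Finset.Ico p q, X i) ∪ tangentLift right) ∪ tangentLift left)
      ((T ∪ (⋃ i ∈ Finset.Ico p q, X i) ∪ tangentLift right) ∪ NL) := by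
    refine (iL.union ?_ ?_).mono sL
    · rintro e ((he | he) | he) hm
      · exact hm.2.2.2.2.ne (pT e he)
      · obtain ⟨i, hi, h1, -, h2⟩ := hmid e he
        exact nL e h2 i (Finset.mem_Ico.1 hi).1 h1 hm
      · exact nL e (pR e he).2 q hpq.le (pR e he).1 hm
    · intro B hB e he hm
      obtain ⟨k, hk, hk'⟩ := pΛ B hB e he
      rcases lt_or_ge k p with h' | h'
      · exact (hm.2.1 k h').ne' hk
      · exact nL e hk' k h' hk.ge hm
  have step2 : IsotopicRel A.strip (range A.lineLift)
      ((T ∪ (⋃ i ∈ Finset.Ico p q, X i) ∪ NL) ∪ tangentLift right)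
      ((T ∪ (⋃ i ∈ Finset.Ico p q, X i) ∪ NL) ∪ NR) := by
    refine (iR.union ?_ ?_).mono sR
    · rintro e ((he | he) | he) hm
      · exact hm.2.2.2.2.ne (pT e he)
      · obtain ⟨i, hi, -, h1, h2⟩ := hmid e he
        exact nR e h2 _ (next_le (Finset.mem_Ico.1 hi).2) h1 hm
      · exact nR e (pNL e he).2 p hpq.le (pNL e he).1 hm
    · intro B hB e he hm
      obtain ⟨k, hk, hk'⟩ := pΛ B hB e he
      rcases lt_or_ge q k with h' | h'
      · exact (hm.2.1 k h').ne hk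
      · exact nR e hk' k h' hk.le hm
  have step3 : IsotopicRel A.strip (range A.lineLift)
      ((T ∪ NL ∪ NR) ∪ ⋃ i ∈ Finset.Ico p q, X i) ((T ∪ NL ∪ NR) ∪ ⋃ i ∈ Finset.Ico p q, Y i) := by
    refine IsotopicRel.biUnion _ iM (fun i _ => sW i)
      (fun i hi k hk hki e he => nWk i hi k hk hki e (pX k hk e he))
      (fun i hi k hk hki e he => nWk i hi k hk hki e (pY k hk e he)) ?_ _ ?_
    · intro i hi B hB e he
      obtain ⟨k, hk, hk'⟩ := pΛ B hB e he
      rcases le_or_gt k i with h' | h'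
      · exact nW i e hk' (Or.inl ⟨k, h', hk.le⟩)
      · exact nW i e hk' (Or.inr ⟨k, next_le h', hk.ge⟩)
    · rintro i hi e ((he | he) | he)
      · exact fun hm => hm.2.2.2.ne (pT e he)
      · exact nW i e (pNL e he).2 (Or.inl ⟨p, (Finset.mem_Ico.1 hi).1, (pNL e he).1⟩)
      · exact nW i e (pNR e he).2
          (Or.inr ⟨q, next_le (Finset.mem_Ico.1 hi).2, (pNR e he).1⟩)
  have e0 : tangentLift left ∪ T ∪ (⋃ i ∈ Finset.Ico p q, X i) ∪ tangentLift right =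
      (T ∪ (⋃ i ∈ Finset.Ico p q, X i) ∪ tangentLift right) ∪ tangentLift left := by ac_rfl
  have e1 : (T ∪ (⋃ i ∈ Finset.Ico p q, X i) ∪ tangentLift right) ∪ NL =
      (T ∪ (⋃ i ∈ Finset.Ico p q, X i) ∪ NL) ∪ tangentLift right := by ac_rfl
  have e2 : (T ∪ (⋃ i ∈ Finset.Ico p q, X i) ∪ NL) ∪ NR =
      (T ∪ NL ∪ NR) ∪ ⋃ i ∈ Finset.Ico p q, X i := by ac_rfl
  have e3 : NL ∪ T ∪ (⋃ i ∈ Finset.Ico p q, Y i) ∪ NR =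
      (T ∪ NL ∪ NR) ∪ ⋃ i ∈ Finset.Ico p q, Y i := by ac_rfl
  rw [e0, e3]
  rw [e1] at step1
  rw [e2] at step2
  exact step1.trans (step2.trans step3)

end LineArrangement

/-! ### Pushing ends across vertical lines -/

namespace IsotopicRel

variable {U : Set (ℝ × ℝ)} {Λ Λ' : Set (Set AngledPoint)} {S S' R : Set AngledPoint}

lemma mono_right (h : IsotopicRel U Λ S S') (hΛ : Λ' ⊆ Λ) : IsotopicRel U Λ' S S' := by
  obtain ⟨Φ, h1, h2⟩ := h
  exact ⟨Φ, h1, fun B hB => h2 B (hΛ hB)⟩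

lemma union_of_mem (h : IsotopicRel U Λ S S') (hR : R ∈ Λ) :
    IsotopicRel U Λ (R ∪ S) (R ∪ S') := by
  obtain ⟨Φ, h1, h2⟩ := h
  exact ⟨Φ, fun e => by rw [mem_union, mem_union, h1, h2 R hR], h2⟩

end IsotopicRel

/-- The angle `θ` over the segment of the abscissa `a` at the heights between `0` and `1`. -/
def verticalLift (a θ : ℝ) : Set AngledPoint :=
  {e | e.1.1 = a ∧ e.1.2 ∈ Ioo (0 : ℝ) 1 ∧ ∃ k : ℤ, e.2 = θ + k * Real.pi}

section Push

variable {l p q h m x : ℝ}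

/-- A push that carries `p` to `q` carries the interval from a fixed point to `p` to the interval
from this point to `q`. -/
lemma push_mem_uIcc (hl : l < p) (hh : p < h) (hl' : l < q) (hh' : q < h) (hm : m ∉ Ioo l h)
    (hx : x ∈ uIcc p m) : x + (q - p) * tent l p h x ∈ uIcc q m := by
  rcases le_or_gt m l with hml | hml
  · rw [uIcc_of_ge (hml.trans hl.le)] at hx
    rw [uIcc_of_ge (hml.trans hl'.le)]
    refine ⟨?_, push_le_iff hl hh hl' hh' hx.2⟩
    rcases le_total x l with h1 | h1
    · rw [tent_of_le_left hl h1]; linarith [hx.1]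
    · exact hml.trans (left_le_push hl hh hl' h1)
  · have hmh : h ≤ m := not_lt.1 fun hlt => hm ⟨hml, hlt⟩
    rw [uIcc_of_le (hh.le.trans hmh)] at hx
    rw [uIcc_of_le (hh'.le.trans hmh)]
    refine ⟨le_push hl hh hl' hh' hx.1, ?_⟩
    rcases le_total h x with h1 | h1
    · rw [tent_of_right_le hh h1]; linarith [hx.2]
    · exact (push_le_right hl hh hh' h1).trans hmh

end Push

/-- An isotopy which pushes an end of a curve over vertical lines in the horizontal direction: the
graph of `b`, with the angle `σ`, becomes the graph of `f`. The end of the upper segment at this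
graph moves with it. -/
lemma isotopicRel_horizontal_push {hl hu lo hi m : ℝ} (hl0 : 0 < hl) (hlu : hl < hu) (hu1 : hu < 1)
    {b f σ : ℝ → ℝ} (hb : Continuous b) (hf : Continuous f) (hbf : b hl = f hl)
    (hbI : ∀ z ∈ Icc hl hu, b z ∈ Ioo lo hi) (hfI : ∀ z ∈ Icc hl hu, f z ∈ Ioo lo hi)
    (hσ : ∀ z ∈ Icc hl hu, b z = f z ∨ ∃ k : ℤ, σ z = k * Real.pi)
    {Λ : Set (Set AngledPoint)}
    (hΛ : ∀ B ∈ Λ, ∃ a θ : ℝ, Real.cos (2 * θ) ≤ 0 ∧ B = verticalLift a θ)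
    (hm : m ∉ Ioo lo hi) {S : Set AngledPoint} (hS : ∀ e ∈ S, e.1.1 ∉ Ioo lo hi ∨ e.1.2 ≤ hl) :
    IsotopicRel (Ioo lo hi ×ˢ Ioo 0 1) Λ
      (S ∪ strand (fun z => (b z, z)) σ (Icc hl hu) ∪
        strand (fun a => (a, hu)) (fun _ => 0) (uIcc (b hu) m))
      (S ∪ strand (fun z => (f z, z)) σ (Icc hl hu) ∪
        strand (fun a => (a, hu)) (fun _ => 0) (uIcc (f hu) m)) := by
  have hη : 0 < 1 - hu := by linarith
  set κ : ℝ → ℝ := fun z => max hl (min hu z) with hκ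
  have hκI : ∀ z, κ z ∈ Icc hl hu := fun z => ⟨le_max_left _ _, max_le hlu.le (min_le_left _ _)⟩
  have hκc : ∀ z ∈ Icc hl hu, κ z = z := fun z hz => clamp_of_mem hz
  -- Decreases from 1 at the height `hu` to 0 at the height 1, so that the upper segment is carried
  -- along and the motion dies out inside the strip.
  set damp : ℝ → ℝ := fun z => max 0 (1 - max 0 (z - hu) / (1 - hu)) with hdamp
  have hdamp1 : ∀ z, damp z ≤ 1 := fun z => max_le zero_le_one
    (by have := div_nonneg (le_max_left 0 (z - hu)) hη.le; linarith)
  have hdamp0 : ∀ z, 0 ≤ damp z := fun z => le_max_left _ _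
  have hdampc : ∀ z ≤ hu, damp z = 1 := fun z hz => by
    simp [hdamp, max_eq_left (sub_nonpos.2 hz)]
  have hdampz : ∀ z, 1 ≤ z → damp z = 0 := fun z hz => by
    refine max_eq_left (sub_nonpos.2 ?_)
    rw [le_div_iff₀ hη, one_mul]
    exact le_max_of_le_right (by linarith)
  -- The damping in the angle is 1 in the horizontal directions and 0 where `cos 2u` is not
  -- positive, in particular at the angles of the lines. The end can thus cross the lines in the
  -- plane while the lifts stay disjoint.
  set ρ : ℝ → ℝ := fun u => max 0 (Real.cos (2 * u)) with hρ
  have hρ0 : ∀ u, 0 ≤ ρ u := fun u => le_max_left _ _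
  have hρ1 : ∀ u, ρ u ≤ 1 := fun u => max_le zero_le_one (Real.cos_le_one _)
  have hρπ : ∀ k : ℤ, ρ (k * Real.pi) = 1 := fun k => by
    have : (2 : ℝ) * (k * Real.pi) = k * (2 * Real.pi) := by ring
    simp only [hρ, this, Real.cos_int_mul_two_pi]
    exact max_eq_right zero_le_one
  set d : ℝ × ℝ → ℝ := fun x => (f (κ x.1) - b (κ x.1)) * (damp x.1 * ρ x.2) with hd
  -- Below the height `hl` the clamp returns `hl`, where the two graphs agree, so the lower curve
  -- does not move.
  have hd0 : ∀ z u, z ≤ hl → d (z, u) = 0 := fun z u hz => by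
    have : κ z = hl := max_eq_left ((min_le_right _ _).trans hz)
    simp [hd, this, hbf]
  have hd1 : ∀ z u, 1 ≤ z → d (z, u) = 0 := fun z u hz => by simp [hd, hdampz z hz]
  have hbetween : ∀ z u, b (κ z) + d (z, u) ∈ Ioo lo hi := by
    intro z u
    have hs0 := mul_nonneg (hdamp0 z) (hρ0 u)
    have hs1 := mul_le_one₀ (hdamp1 z) (hρ0 u) (hρ1 u)
    have := (convex_Ioo lo hi) (hbI _ (hκI z)) (hfI _ (hκI z)) (sub_nonneg.2 hs1) hs0 (by ring)
    convert this using 1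
    simp only [hd, smul_eq_mul]
    ring
  have H : AngleIsotopy.PushData (fun z => b (κ z)) (fun _ => lo) (fun _ => hi) d := by
    refine ⟨by fun_prop, by fun_prop, fun z u => ?_, fun _ _ _ => continuousAt_const,
      fun _ _ _ => continuousAt_const, fun z u _ => (hbI _ (hκI z)).1,
      fun z u _ => (hbI _ (hκI z)).2, fun z u _ => (hbetween z u).1, fun z u _ => (hbetween z u).2⟩
    have : 2 * (u + 2 * Real.pi) = 2 * u + 2 * Real.pi + 2 * Real.pi := by ring
    simp only [hd, hρ, this, Real.cos_add_two_pi]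
  have hU : ∀ z u v, d (z, u) ≠ 0 → lo < v → v < hi →
      (z, v) ∈ {x : ℝ × ℝ | x.2 ∈ Ioo lo hi ∧ x.1 ∈ Ioo (0 : ℝ) 1} := by
    intro z u v hz h1 h2
    refine ⟨⟨h1, h2⟩, ?_, ?_⟩
    · exact hl0.trans (not_le.1 fun h => hz (hd0 z u h))
    · exact not_le.1 fun h => hz (hd1 z u h)
  have himg : (Homeomorph.prodComm ℝ ℝ) '' {x : ℝ × ℝ | x.2 ∈ Ioo lo hi ∧ x.1 ∈ Ioo (0 : ℝ) 1} ⊆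
      Ioo lo hi ×ˢ Ioo 0 1 := by
    rintro _ ⟨x, hx, rfl⟩
    exact hx
  set Φ : AngleIsotopy (Ioo lo hi ×ˢ Ioo (0 : ℝ) 1) :=
    ((AngleIsotopy.push H hU).conj (Homeomorph.prodComm ℝ ℝ)).mono himg with hΦ
  have hto : ∀ v z u, Φ.toFun 1 ((v, z), u) =
      ((v + d (z, u) * tent lo (b (κ z)) hi v, z), u) := by
    intro v z u
    show ((v + 1 * (d (z, u) * tent lo (b (κ z)) hi v), z), u) = _
    rw [one_mul]
  have hinv : ∀ v z u, Φ.invFun 1 ((v, z), u) =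
      ((v - d (z, u) * tent lo (b (κ z) + d (z, u)) hi v, z), u) := by
    intro v z u
    show ((v - 1 * (d (z, u) * tent lo (b (κ z) + 1 * d (z, u)) hi v), z), u) = _
    rw [one_mul, one_mul]
  have hfix : ∀ v z u, d (z, u) = 0 → Φ.toFun 1 ((v, z), u) = ((v, z), u) := by
    intro v z u h0
    rw [hto, h0, zero_mul, add_zero]
  have hfix' : ∀ v z u, d (z, u) = 0 → Φ.invFun 1 ((v, z), u) = ((v, z), u) := by
    intro v z u h0
    rw [hinv, h0, zero_mul, sub_zero]
  -- Wherever the graphs differ the angle is a multiple of π, so the displacement is undamped.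
  have hdσ : ∀ z ∈ Icc hl hu, ∀ k : ℤ, d (z, σ z + k * Real.pi) = f z - b z := by
    intro z hz k
    simp only [hd, hκc z hz, hdampc z hz.2, one_mul]
    rcases hσ z hz with h | ⟨k', h⟩
    · rw [h, sub_self, zero_mul]
    · rw [h, ← add_mul, ← Int.cast_add, hρπ, mul_one]
  have huI : hu ∈ Icc hl hu := ⟨hlu.le, le_rfl⟩
  have hdu : ∀ k : ℤ, d (hu, 0 + k * Real.pi) = f hu - b hu := by
    intro k
    simp only [hd, hκc hu huI, hdampc hu le_rfl, zero_add, hρπ, mul_one]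
  have hSfix : ∀ e ∈ S, Φ.toFun 1 e = e ∧ Φ.invFun 1 e = e := by
    rintro ⟨⟨v, z⟩, u⟩ he
    rcases hS _ he with h1 | h1
    · have : ((v, z), u).1 ∉ Ioo lo hi ×ˢ Ioo (0 : ℝ) 1 := fun h2 => h1 h2.1
      exact ⟨Φ.eq_self 1 _ this, Φ.inv_eq_self 1 _ this⟩
    · exact ⟨hfix v z u (hd0 z u h1), hfix' v z u (hd0 z u h1)⟩
  refine IsotopicRel.of_mapsTo Φ ?_ ?_ ?_
  · rintro ⟨⟨v, z⟩, u⟩ ((he | he) | he)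
    · rw [(hSfix _ he).1]; exact Or.inl (Or.inl he)
    · obtain ⟨r, hr, hx, k, hk⟩ := he
      simp only [Prod.mk.injEq] at hx hk
      obtain ⟨rfl, rfl⟩ := hx
      refine Or.inl (Or.inr ⟨z, hr, ?_, k, ?_⟩)
      · rw [hto, hk, hdσ z hr, hκc z hr, tent_self (hbI z hr).1 (hbI z hr).2]
        simp
      · rw [hto]; exact hk
    · obtain ⟨r, hr, hx, k, hk⟩ := he
      simp only [Prod.mk.injEq] at hx hk
      obtain ⟨rfl, rfl⟩ := hx
      refine Or.inr ⟨v + (f z - b z) * tent lo (b z) hi v, ?_, ?_, k, ?_⟩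
      rotate_left
      · rw [hto, hk, hdu, hκc z huI]
      · rw [hto]; exact hk
      · exact push_mem_uIcc (hbI z huI).1 (hbI z huI).2 (hfI z huI).1 (hfI z huI).2 hm hr
  · rintro ⟨⟨v, z⟩, u⟩ ((he | he) | he)
    · rw [(hSfix _ he).2]; exact Or.inl (Or.inl he)
    · obtain ⟨r, hr, hx, k, hk⟩ := he
      simp only [Prod.mk.injEq] at hx hk
      obtain ⟨rfl, rfl⟩ := hx
      refine Or.inl (Or.inr ⟨z, hr, ?_, k, ?_⟩)
      · rw [hinv, hk, hdσ z hr, hκc z hr, add_sub_cancel, tent_self (hfI z hr).1 (hfI z hr).2]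
        simp
      · rw [hinv]; exact hk
    · obtain ⟨r, hr, hx, k, hk⟩ := he
      simp only [Prod.mk.injEq] at hx hk
      obtain ⟨rfl, rfl⟩ := hx
      refine Or.inr ⟨v - (f z - b z) * tent lo (f z) hi v, ?_, ?_, k, ?_⟩
      rotate_left
      · rw [hinv, hk, hdu, hκc z huI, add_sub_cancel]
      · rw [hinv]; exact hk
      · have := push_mem_uIcc (hfI z huI).1 (hfI z huI).2 (hbI z huI).1 (hbI z huI).2 hm hr
        rwa [show v + (b z - f z) * tent lo (f z) hi v = v - (f z - b z) * tent lo (f z) hi v by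
          ring] at this
  · intro B hB
    obtain ⟨a, θ, hθ, rfl⟩ := hΛ B hB
    -- The lifts of the lines are fixed pointwise.
    have hd2 : ∀ z, ∀ k : ℤ, d (z, θ + k * Real.pi) = 0 := by
      intro z k
      have : 2 * (θ + k * Real.pi) = 2 * θ + k * (2 * Real.pi) := by ring
      simp only [hd, hρ, this, Real.cos_add_int_mul_two_pi, max_eq_left hθ, mul_zero]
    rintro ⟨⟨v, z⟩, u⟩
    constructor
    · intro he
      have he' := he
      rw [hto] at he'
      obtain ⟨-, -, k, hk⟩ := he'
      simp only at hk
      rwa [hk, hfix _ _ _ (hd2 z k), ← hk] at he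
    · intro he
      have he' := he
      obtain ⟨-, -, k, hk⟩ := he'
      simp only at hk
      rw [hk, hfix _ _ _ (hd2 z k), ← hk]
      exact he

/-! ### Wedges over a common interval -/

/-- The closed curve formed by the graph of `f` and the horizontal segment of height `hu`. -/
def wedge (f ω : ℝ → ℝ) (hu eL eR : ℝ) : Set AngledPoint :=
  strand (fun a => (a, hu)) (fun _ => 0) (Icc eL eR) ∪ strand (fun a => (a, f a)) ω (Icc eL eR)

/-- A push with corners 0 and 1 that moves the top from `hu` to `hu'` is multiplication by `hu' /
hu` at heights up to `hu`. It changes neither abscissas nor angles and so preserves every vertical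
lift; towards `dL` and `dR` it is damped out. -/
lemma isotopicRel_wedge_scale {f ω : ℝ → ℝ} {hu hu' dL eL eR dR : ℝ} (hd : dL < eL)
    (hd' : eR < dR) (hu0 : 0 < hu) (hu1 : hu < 1) (hu0' : 0 < hu') (hu1' : hu' < 1)
    (hf : ∀ a ∈ Icc eL eR, 0 < f a ∧ f a ≤ hu)
    {Λ : Set (Set AngledPoint)} (hΛ : ∀ B ∈ Λ, ∃ a θ : ℝ, B = verticalLift a θ) :
    IsotopicRel (Ioo dL dR ×ˢ Ioo 0 1) Λ (wedge f ω hu eL eR)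
      (wedge (fun a => f a * (hu' / hu)) ω hu' eL eR) := by
  set damp : ℝ → ℝ := fun a => max 0 (min 1 (min ((a - dL) / (eL - dL)) ((dR - a) / (dR - eR))))
    with hdamp
  have h1 : 0 < eL - dL := by linarith
  have h2 : 0 < dR - eR := by linarith
  have hdamp0 : ∀ a, 0 ≤ damp a := fun a => le_max_left _ _
  have hdamp1 : ∀ a, damp a ≤ 1 := fun a => max_le zero_le_one (min_le_left _ _)
  have hdampc : ∀ a ∈ Icc eL eR, damp a = 1 := by
    intro a ha
    have e1 : 1 ≤ (a - dL) / (eL - dL) := by rw [le_div_iff₀ h1]; linarith [ha.1]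
    have e2 : 1 ≤ (dR - a) / (dR - eR) := by rw [le_div_iff₀ h2]; linarith [ha.2]
    simp only [hdamp, min_eq_left (le_min e1 e2), max_eq_right zero_le_one]
  have hdampL : ∀ a, a ≤ dL → damp a = 0 := fun a ha => max_eq_left <| (min_le_right _ _).trans <|
    (min_le_left _ _).trans (div_nonpos_of_nonpos_of_nonneg (by linarith) h1.le)
  have hdampR : ∀ a, dR ≤ a → damp a = 0 := fun a ha => max_eq_left <| (min_le_right _ _).trans <|
    (min_le_right _ _).trans (div_nonpos_of_nonpos_of_nonneg (by linarith) h2.le)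
  set d : ℝ × ℝ → ℝ := fun x => (hu' - hu) * damp x.1 with hdd
  have hbetween : ∀ a, hu + (hu' - hu) * damp a ∈ Ioo (0 : ℝ) 1 := by
    intro a
    have := (convex_Ioo (0 : ℝ) 1) ⟨hu0, hu1⟩ ⟨hu0', hu1'⟩ (sub_nonneg.2 (hdamp1 a)) (hdamp0 a)
      (by ring)
    convert this using 1
    simp only [smul_eq_mul]
    ring
  have H : AngleIsotopy.PushData (fun _ => hu) (fun _ => 0) (fun _ => 1) d :=
    ⟨by fun_prop, by fun_prop, fun _ _ => rfl, fun _ _ _ => continuousAt_const,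
      fun _ _ _ => continuousAt_const, fun _ _ _ => hu0, fun _ _ _ => hu1,
      fun a _ _ => (hbetween a).1, fun a _ _ => (hbetween a).2⟩
  have hU : ∀ a u v, d (a, u) ≠ 0 → 0 < v → v < 1 → (a, v) ∈ Ioo dL dR ×ˢ Ioo (0 : ℝ) 1 := by
    intro a u v ha h1 h2
    refine ⟨⟨not_le.1 fun h => ha ?_, not_le.1 fun h => ha ?_⟩, h1, h2⟩
    · simp [hdd, hdampL a h]
    · simp [hdd, hdampR a h]
  have htent : ∀ {y y'}, 0 < y → y < 1 → 0 < y' → y' ≤ y → tent 0 y 1 y' = y' / y := by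
    intro y y' h1 h2 h3 h4
    have := tent_left h1 h2 (div_nonneg h3.le h1.le) ((div_le_one h1).2 h4)
    rwa [zero_add, sub_zero, div_mul_cancel₀ _ h1.ne'] at this
  set Φ := AngleIsotopy.push H hU with hΦ
  have hto : ∀ a ∈ Icc eL eR, ∀ v, 0 < v → v ≤ hu → ∀ u,
      Φ.toFun 1 ((a, v), u) = ((a, v * (hu' / hu)), u) := by
    intro a ha v h1 h2 u
    show ((a, v + 1 * ((hu' - hu) * damp a * tent 0 hu 1 v)), u) = _
    rw [hdampc a ha, htent hu0 hu1 h1 h2]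
    congr 2
    field_simp
    ring
  have hinv : ∀ a ∈ Icc eL eR, ∀ v, 0 < v → v ≤ hu → ∀ u,
      Φ.invFun 1 ((a, v * (hu' / hu)), u) = ((a, v), u) := by
    intro a ha v h1 h2 u
    rw [← hto a ha v h1 h2 u, Φ.left_inv]
  have hc : hu * (hu' / hu) = hu' := by field_simp
  refine IsotopicRel.of_mapsTo Φ ?_ ?_ ?_
  · rintro ⟨⟨a, v⟩, u⟩ (⟨r, hr, hx, k, hk⟩ | ⟨r, hr, hx, k, hk⟩)
    · simp only [Prod.mk.injEq] at hx
      obtain ⟨rfl, rfl⟩ := hx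
      refine Or.inl ⟨a, hr, ?_, k, ?_⟩
      · rw [hto a hr v hu0 le_rfl, hc]
      · rw [hto a hr v hu0 le_rfl]; exact hk
    · simp only [Prod.mk.injEq] at hx
      obtain ⟨rfl, rfl⟩ := hx
      refine Or.inr ⟨a, hr, ?_, k, ?_⟩
      · rw [hto a hr _ (hf a hr).1 (hf a hr).2]
      · rw [hto a hr _ (hf a hr).1 (hf a hr).2]; exact hk
  · rintro ⟨⟨a, v⟩, u⟩ (⟨r, hr, hx, k, hk⟩ | ⟨r, hr, hx, k, hk⟩)
    · simp only [Prod.mk.injEq] at hx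
      obtain ⟨rfl, rfl⟩ := hx
      refine Or.inl ⟨a, hr, ?_, k, ?_⟩
      · conv_lhs => rw [← hc, hinv a hr hu hu0 le_rfl]
      · rw [← hc, hinv a hr hu hu0 le_rfl]; exact hk
    · simp only [Prod.mk.injEq] at hx
      obtain ⟨rfl, rfl⟩ := hx
      refine Or.inr ⟨a, hr, ?_, k, ?_⟩
      · rw [hinv a hr _ (hf a hr).1 (hf a hr).2]
      · rw [hinv a hr _ (hf a hr).1 (hf a hr).2]; exact hk
  · intro B hB
    obtain ⟨a, θ, rfl⟩ := hΛ B hB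
    intro e
    by_cases he : e.1 ∈ Ioo dL dR ×ˢ Ioo (0 : ℝ) 1
    · have he' := (Φ.mem_iff_mem 1 e).2 he
      exact ⟨fun h => ⟨h.1, he.2, h.2.2⟩, fun h => ⟨h.1, he'.2, h.2.2⟩⟩
    · rw [Φ.eq_self 1 e he]

/-- After scaling, the wedges share the upper segment, and their lower graphs, which have equal ends
and equal angles, are joined by a vertical push. -/
lemma isotopicRel_wedge {f f' ω : ℝ → ℝ} {hu hu' dL eL eR dR : ℝ} (hd : dL < eL)
    (he : eL < eR) (hd' : eR < dR) (hu0 : 0 < hu) (hu1 : hu < 1) (hu0' : 0 < hu') (hu1' : hu' < 1)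
    (hf : Continuous f) (hfL : f eL = hu) (hfR : f eR = hu)
    (hfu : ∀ a ∈ Ioo eL eR, 0 < f a ∧ f a < hu)
    (hf' : Continuous f') (hfL' : f' eL = hu') (hfR' : f' eR = hu')
    (hfu' : ∀ a ∈ Ioo eL eR, 0 < f' a ∧ f' a < hu')
    {Λ : Set (Set AngledPoint)} (hΛ : ∀ B ∈ Λ, ∃ a θ : ℝ, B = verticalLift a θ) :
    IsotopicRel (Ioo dL dR ×ˢ Ioo 0 1) Λ (wedge f ω hu eL eR) (wedge f' ω hu' eL eR) := by
  have hf2 : ∀ a ∈ Icc eL eR, 0 < f a ∧ f a ≤ hu := by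
    intro a ha
    rcases eq_or_lt_of_le ha.1 with rfl | h1
    · exact ⟨hfL ▸ hu0, hfL.le⟩
    rcases eq_or_lt_of_le ha.2 with rfl | h2
    · exact ⟨hfR ▸ hu0, hfR.le⟩
    exact ⟨(hfu a ⟨h1, h2⟩).1, (hfu a ⟨h1, h2⟩).2.le⟩
  have hq : 0 < hu' / hu := div_pos hu0' hu0
  have hc : hu * (hu' / hu) = hu' := by field_simp
  refine (isotopicRel_wedge_scale (ω := ω) hd hd' hu0 hu1 hu0' hu1' hf2 hΛ).trans ?_
  have key := isotopicRel_strand_push (a := eL) (b := eR) (g := fun a => f a * (hu' / hu)) (g' := f')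
    (l := fun _ => 0) (h := fun _ => hu') he ω
    -- The upper segment is treated as one more preserved set: it lies on the edge of the open band
    -- in which the push takes place.
    (Λ := insert (strand (fun a => (a, hu')) (fun _ => 0) (Icc eL eR)) Λ)
    (by fun_prop) (by fun_prop) (by fun_prop) (by fun_prop)
    (fun a ha => ⟨mul_pos (hfu a ha).1 hq, by
      have := mul_lt_mul_of_pos_right (hfu a ha).2 hq
      rwa [hc] at this⟩) hfu' (by simp only [hfL, hfL', hc]) (by simp only [hfR, hfR', hc]) ?_
  · refine ((key.union_of_mem (mem_insert _ _)).mono ?_).mono_right (subset_insert _ _)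
    rintro x ⟨h1, h2, h3⟩
    exact ⟨⟨hd.trans h1.1, h1.2.trans hd'⟩, h2, h3.trans hu1'⟩
  · rintro B (rfl | hB) r hr v hv v' hv' u h
    · obtain ⟨a, -, hx, -⟩ := h
      exact absurd (congrArg Prod.snd hx) hv.2.ne
    · obtain ⟨a, θ, rfl⟩ := hΛ B hB
      exact ⟨h.1, ⟨hv'.1, hv'.2.trans hu1'⟩, h.2.2⟩

/-! ### Straight ends and troughs -/

section LineTo

variable {P e hl hu z : ℝ}

lemma lineTo_mem_of_le (h : hl < hu) (he : e ≤ P) (hz : z ∈ Icc hl hu) :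
    lineTo P e hl hu z ∈ Icc e P := by
  have h0 : 0 ≤ (z - hl) / (hu - hl) := div_nonneg (by linarith [hz.1]) (by linarith)
  have h1 : (z - hl) / (hu - hl) ≤ 1 := (div_le_one (by linarith)).2 (by linarith [hz.2])
  constructor <;> unfold lineTo <;> nlinarith

lemma lineTo_mem_of_ge (h : hl < hu) (he : P ≤ e) (hz : z ∈ Icc hl hu) :
    lineTo P e hl hu z ∈ Icc P e := by
  have h0 : 0 ≤ (z - hl) / (hu - hl) := div_nonneg (by linarith [hz.1]) (by linarith)
  have h1 : (z - hl) / (hu - hl) ≤ 1 := (div_le_one (by linarith)).2 (by linarith [hz.2])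
  constructor <;> unfold lineTo <;> nlinarith

/-- The inverse function of `lineTo`. -/
lemma inverse_lineTo (h : hl < hu) (he : e ≠ P) (z : ℝ) :
    hl + (lineTo P e hl hu z - P) * ((hu - hl) / (e - P)) = z := by
  have h1 : hu - hl ≠ 0 := (sub_pos.2 h).ne'
  have h2 : e - P ≠ 0 := sub_ne_zero.2 he
  unfold lineTo
  field_simp
  ring

end LineTo

/-- The function with the graph that rises linearly to both sides of the interval `[P, Q]`. -/
def trough (hl hu eL P Q eR a : ℝ) : ℝ :=
  hl + max 0 (max ((a - P) * ((hu - hl) / (eL - P))) ((a - Q) * ((hu - hl) / (eR - Q))))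

section Trough

variable {hl hu eL P Q eR a : ℝ}

lemma continuous_trough : Continuous (trough hl hu eL P Q eR) := by
  unfold trough
  fun_prop

lemma trough_of_le (h : hl < hu) (hP : eL < P) (hPQ : P ≤ Q) (hQ : Q < eR) (ha : a ≤ P) :
    trough hl hu eL P Q eR a = hl + (a - P) * ((hu - hl) / (eL - P)) := by
  have h1 : 0 ≤ (a - P) * ((hu - hl) / (eL - P)) :=
    mul_nonneg_of_nonpos_of_nonpos (by linarith)
      (div_nonpos_of_nonneg_of_nonpos (by linarith) (by linarith))
  have h2 : (a - Q) * ((hu - hl) / (eR - Q)) ≤ 0 :=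
    mul_nonpos_of_nonpos_of_nonneg (by linarith) (div_nonneg (by linarith) (by linarith))
  rw [trough, max_eq_left (h2.trans h1), max_eq_right h1]

lemma trough_of_ge (h : hl < hu) (hP : eL < P) (hPQ : P ≤ Q) (hQ : Q < eR) (ha : Q ≤ a) :
    trough hl hu eL P Q eR a = hl + (a - Q) * ((hu - hl) / (eR - Q)) := by
  have h1 : (a - P) * ((hu - hl) / (eL - P)) ≤ 0 :=
    mul_nonpos_of_nonneg_of_nonpos (by linarith)
      (div_nonpos_of_nonneg_of_nonpos (by linarith) (by linarith))
  have h2 : 0 ≤ (a - Q) * ((hu - hl) / (eR - Q)) :=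
    mul_nonneg (by linarith) (div_nonneg (by linarith) (by linarith))
  rw [trough, max_eq_right (h1.trans h2), max_eq_right h2]

lemma trough_of_mem (h : hl < hu) (hP : eL < P) (hQ : Q < eR) (ha : a ∈ Icc P Q) :
    trough hl hu eL P Q eR a = hl := by
  have h1 : (a - P) * ((hu - hl) / (eL - P)) ≤ 0 :=
    mul_nonpos_of_nonneg_of_nonpos (by linarith [ha.1])
      (div_nonpos_of_nonneg_of_nonpos (by linarith) (by linarith))
  have h2 : (a - Q) * ((hu - hl) / (eR - Q)) ≤ 0 :=
    mul_nonpos_of_nonpos_of_nonneg (by linarith [ha.2]) (div_nonneg (by linarith) (by linarith))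
  rw [trough, max_eq_left (max_le h1 h2), add_zero]

lemma trough_left (h : hl < hu) (hP : eL < P) (hPQ : P ≤ Q) (hQ : Q < eR) :
    trough hl hu eL P Q eR eL = hu := by
  rw [trough_of_le h hP hPQ hQ hP.le, mul_div_cancel₀ _ (by linarith)]
  ring

lemma trough_right (h : hl < hu) (hP : eL < P) (hPQ : P ≤ Q) (hQ : Q < eR) :
    trough hl hu eL P Q eR eR = hu := by
  rw [trough_of_ge h hP hPQ hQ hQ.le, mul_div_cancel₀ _ (by linarith)]
  ring

lemma trough_mem (h : hl < hu) (hP : eL < P) (hQ : Q < eR)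
    (ha : a ∈ Ioo eL eR) : hl ≤ trough hl hu eL P Q eR a ∧ trough hl hu eL P Q eR a < hu := by
  have h0 : 0 < hu - hl := by linarith
  refine ⟨le_add_of_nonneg_right (le_max_left _ _), ?_⟩
  have : max 0 (max ((a - P) * ((hu - hl) / (eL - P))) ((a - Q) * ((hu - hl) / (eR - Q)))) <
      hu - hl := by
    refine max_lt h0 (max_lt ?_ ?_)
    · rw [← mul_div_assoc, div_lt_iff_of_neg (by linarith)]
      nlinarith [ha.1]
    · rw [← mul_div_assoc, div_lt_iff₀ (by linarith)]
      nlinarith [ha.2]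
  unfold trough
  linarith

end Trough

/-- The strand over a line is the strand over the graph of `trough`. -/
lemma strand_lineTo {P e hl hu : ℝ} (h : hl < hu) (he : e ≠ P) {f : ℝ → ℝ} (ω : ℝ → ℝ)
    (hf : ∀ a ∈ uIcc P e, f a = hl + (a - P) * ((hu - hl) / (e - P))) :
    strand (fun z => (lineTo P e hl hu z, z)) (fun z => ω (lineTo P e hl hu z)) (Icc hl hu) =
      strand (fun a => (a, f a)) ω (uIcc P e) := by
  have hmem : ∀ z ∈ Icc hl hu, lineTo P e hl hu z ∈ uIcc P e := by
    intro z hz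
    rcases le_total e P with h1 | h1
    · rw [uIcc_of_ge h1]; exact lineTo_mem_of_le h h1 hz
    · rw [uIcc_of_le h1]; exact lineTo_mem_of_ge h h1 hz
  have himg : lineTo P e hl hu '' Icc hl hu = uIcc P e := by
    refine subset_antisymm (by rintro _ ⟨z, hz, rfl⟩; exact hmem z hz) ?_
    have := intermediate_value_uIcc (a := hl) (b := hu) (f := lineTo P e hl hu)
      (continuous_lineTo _ _ _ _).continuousOn
    rwa [uIcc_of_le h.le, lineTo_left, lineTo_right _ _ h] at this
  rw [← himg, ← strand_comp]
  refine strand_congr (fun z hz => ?_) fun _ _ => rfl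
  refine Prod.ext rfl ?_
  exact (inverse_lineTo h he z).symm.trans (hf _ (hmem z hz)).symm

/-- Where a bent end leaves its straight line, this line has already passed `α` or `β`, and there
`ω` is 0 or π. So the angle is horizontal exactly where the push of `isotopicRel_horizontal_push`
has to act. The straightened ends and the lower segment form the graph of a trough. -/
lemma isotopicRel_boxCurve_wedge {hl hu P Q dL eL α β eR dR : ℝ} {bL bR ω : ℝ → ℝ} (hl0 : 0 < hl)
    (hlu : hl < hu) (hu1 : hu < 1) (hdL : dL < eL) (hα : eL < α) (hαP : α < P) (hPQ : P < Q)
    (hβ : Q < β) (hβe : β < eR) (hdR : eR < dR)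
    (hL : Continuous bL ∧ bL hl = P ∧ bL hu = P ∧ (∀ z ∈ Ioo hl hu, α ≤ bL z ∧ bL z < P) ∧
      ∀ z ∈ Icc hl hu, bL z = lineTo P eL hl hu z ∨ lineTo P eL hl hu z ≤ α)
    (hR : Continuous bR ∧ bR hl = Q ∧ bR hu = Q ∧ (∀ z ∈ Ioo hl hu, Q < bR z ∧ bR z ≤ β) ∧
      ∀ z ∈ Icc hl hu, bR z = lineTo Q eR hl hu z ∨ β ≤ lineTo Q eR hl hu z)
    (hωL : ∀ x ≤ α, ω x = 0) (hωR : ∀ x ≥ β, ω x = Real.pi) {Λ : Set (Set AngledPoint)}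
    (hΛ : ∀ B ∈ Λ, ∃ a θ : ℝ, Real.cos (2 * θ) ≤ 0 ∧ B = verticalLift a θ) :
    IsotopicRel (Ioo dL dR ×ˢ Ioo 0 1) Λ
      (boxCurve bL bR (fun z => ω (lineTo P eL hl hu z)) (fun z => ω (lineTo Q eR hl hu z)) ω
        hl hu P Q) (wedge (trough hl hu eL P Q eR) ω hu eL eR) := by
  obtain ⟨hLc, hLl, hLu, hLm, hLe⟩ := hL
  obtain ⟨hRc, hRl, hRu, hRm, hRe⟩ := hR
  have heP : eL < P := hα.trans hαP
  have hQe : Q < eR := hβ.trans hβe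
  have hLI : ∀ z ∈ Icc hl hu, α ≤ bL z ∧ bL z ≤ P := by
    intro z hz
    rcases eq_or_lt_of_le hz.1 with rfl | h1
    · exact ⟨hLl ▸ hαP.le, hLl.le⟩
    rcases eq_or_lt_of_le hz.2 with rfl | h2
    · exact ⟨hLu ▸ hαP.le, hLu.le⟩
    exact ⟨(hLm z ⟨h1, h2⟩).1, (hLm z ⟨h1, h2⟩).2.le⟩
  have hRI : ∀ z ∈ Icc hl hu, Q ≤ bR z ∧ bR z ≤ β := by
    intro z hz
    rcases eq_or_lt_of_le hz.1 with rfl | h1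
    · exact ⟨hRl.ge, hRl ▸ hβ.le⟩
    rcases eq_or_lt_of_le hz.2 with rfl | h2
    · exact ⟨hRu.ge, hRu ▸ hβ.le⟩
    exact ⟨(hRm z ⟨h1, h2⟩).1.le, (hRm z ⟨h1, h2⟩).2⟩
  set bot := strand (fun a => (a, hl)) ω (Icc P Q) with hbot
  set μ := (P + Q) / 2 with hμ
  set SL := strand (fun z => (bL z, z)) (fun z => ω (lineTo P eL hl hu z)) (Icc hl hu)
  set SR := strand (fun z => (bR z, z)) (fun z => ω (lineTo Q eR hl hu z)) (Icc hl hu)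
  set TL := strand (fun z => (lineTo P eL hl hu z, z)) (fun z => ω (lineTo P eL hl hu z))
    (Icc hl hu)
  set TR := strand (fun z => (lineTo Q eR hl hu z, z)) (fun z => ω (lineTo Q eR hl hu z))
    (Icc hl hu)
  have hbot' : ∀ e ∈ bot, e.1.2 ≤ hl := by
    rintro e ⟨r, -, hr, -⟩
    rw [hr]
  -- The two pushes are separated by the midpoint `μ`. The upper segment is stretched at its left
  -- end first, with `Q` as its fixed end.
  have s1 := isotopicRel_horizontal_push (lo := dL) (hi := μ) (m := Q) hl0 hlu hu1 hLc
    (continuous_lineTo P eL hl hu) (hLl.trans (lineTo_left _ _ _ _).symm)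
    (fun z hz => ⟨by linarith [(hLI z hz).1], by linarith [(hLI z hz).2]⟩)
    (fun z hz => by
      have := lineTo_mem_of_le hlu heP.le hz
      exact ⟨by linarith [this.1], by linarith [this.2]⟩)
    (σ := fun z => ω (lineTo P eL hl hu z))
    (fun z hz => (hLe z hz).imp_right fun h => ⟨0, by simp [hωL _ h]⟩) hΛ
    (fun h => by linarith [h.2]) (S := bot ∪ SR) (by
      rintro e (he | ⟨z, hz, he, -⟩)
      · exact Or.inr (hbot' e he)
      · refine Or.inl fun h => ?_
        rw [he] at h
        linarith [h.2, (hRI z hz).1])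
  -- Now the upper segment already starts at `eL`, which is its fixed end in the right push.
  have s2 := isotopicRel_horizontal_push (lo := μ) (hi := dR) (m := eL) hl0 hlu hu1 hRc
    (continuous_lineTo Q eR hl hu) (hRl.trans (lineTo_left _ _ _ _).symm)
    (fun z hz => ⟨by linarith [(hRI z hz).1], by linarith [(hRI z hz).2]⟩)
    (fun z hz => by
      have := lineTo_mem_of_ge hlu hQe.le hz
      exact ⟨by linarith [this.1], by linarith [this.2]⟩)
    (σ := fun z => ω (lineTo Q eR hl hu z))
    (fun z hz => (hRe z hz).imp_right fun h => ⟨1, by simp [hωR _ h]⟩) hΛ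
    (fun h => by linarith [h.1]) (S := bot ∪ TL) (by
      rintro e (he | ⟨z, hz, he, -⟩)
      · exact Or.inr (hbot' e he)
      · refine Or.inl fun h => ?_
        rw [he] at h
        linarith [h.1, (lineTo_mem_of_le hlu heP.le hz).2])
  have s1' := s1.mono (V := Ioo dL dR ×ˢ Ioo 0 1)
    (prod_mono (Ioo_subset_Ioo le_rfl (by linarith)) subset_rfl)
  have s2' := s2.mono (V := Ioo dL dR ×ˢ Ioo 0 1)
    (prod_mono (Ioo_subset_Ioo (by linarith) le_rfl) subset_rfl)
  rw [hLu, lineTo_right _ _ hlu, uIcc_of_le hPQ.le, uIcc_of_le (by linarith)] at s1'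
  rw [hRu, lineTo_right _ _ hlu, uIcc_of_ge (by linarith), uIcc_of_ge (by linarith)] at s2'
  have e1 : boxCurve bL bR (fun z => ω (lineTo P eL hl hu z)) (fun z => ω (lineTo Q eR hl hu z)) ω
      hl hu P Q = bot ∪ SR ∪ SL ∪ strand (fun a => (a, hu)) (fun _ => 0) (Icc P Q) := by
    show SL ∪ _ ∪ bot ∪ SR = _
    ac_rfl
  have e2 : bot ∪ SR ∪ TL ∪ strand (fun a => (a, hu)) (fun _ => 0) (Icc eL Q) =
      bot ∪ TL ∪ SR ∪ strand (fun a => (a, hu)) (fun _ => 0) (Icc eL Q) := by ac_rfl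
  have e3 : wedge (trough hl hu eL P Q eR) ω hu eL eR =
      bot ∪ TL ∪ TR ∪ strand (fun a => (a, hu)) (fun _ => 0) (Icc eL eR) := by
    have f1 : TL = strand (fun a => (a, trough hl hu eL P Q eR a)) ω (Icc eL P) := by
      rw [← uIcc_of_ge heP.le]
      refine strand_lineTo hlu heP.ne ω fun a ha => ?_
      rw [uIcc_of_ge heP.le] at ha
      exact trough_of_le hlu heP hPQ.le hQe ha.2
    have f2 : TR = strand (fun a => (a, trough hl hu eL P Q eR a)) ω (Icc Q eR) := by
      rw [← uIcc_of_le hQe.le]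
      refine strand_lineTo hlu hQe.ne' ω fun a ha => ?_
      rw [uIcc_of_le hQe.le] at ha
      exact trough_of_ge hlu heP hPQ.le hQe ha.1
    have f3 : bot = strand (fun a => (a, trough hl hu eL P Q eR a)) ω (Icc P Q) :=
      strand_congr (fun a ha => by rw [trough_of_mem hlu heP hQe ha]) fun _ _ => rfl
    rw [f1, f2, f3, wedge, ← Icc_union_Icc_eq_Icc (heP.le.trans hPQ.le) hQe.le,
      ← Icc_union_Icc_eq_Icc heP.le hPQ.le]
    simp only [strand_union]
    ac_rfl
  rw [e1, e3]
  rw [e2] at s1'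
  exact s1'.trans s2'

/-! ### Comparison of joined curves; choice of the frame and of the angle function -/

namespace LineArrangement

variable {n : ℕ} {A : LineArrangement n} {δ : Fin n → ℤ} {p q p' q' : Fin n} {κ : ℝ → ℝ}

section Frame

variable {hκ : A.IsSlope κ} {dL eL eR dR : ℝ}

/-- An isotopy relative to vertical lines becomes, in the chart, an isotopy relative to the lines
of the arrangement. -/
lemma IsFrame.isotopicRel_chart (hF : IsFrame hκ dL eL eR dR) {S S' : Set AngledPoint}
    (h : IsotopicRel (Ioo dL dR ×ˢ Ioo 0 1) (range fun i => verticalLift (A.a i) (A.θ i)) S S') :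
    IsotopicRel A.strip (range A.lineLift) {e | ((A.chart hκ).symm e.1, e.2) ∈ S}
      {e | ((A.chart hκ).symm e.1, e.2) ∈ S'} := by
  refine ((h.conj (A.chart hκ)).mono ?_).mono_right ?_
  · rintro _ ⟨⟨a, z⟩, ⟨ha, hz⟩, rfl⟩
    have hz' : z ∈ Icc (0 : ℝ) 1 := Ioo_subset_Icc_self hz
    exact ⟨⟨(hF.left z hz').trans (strictMono_chart hκ ha.1),
      (strictMono_chart hκ ha.2).trans (hF.right z hz')⟩, hz⟩
  · rintro _ ⟨i, rfl⟩
    refine ⟨_, ⟨i, rfl⟩, ?_⟩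
    ext ⟨x, u⟩
    obtain ⟨⟨a, z⟩, rfl⟩ := (A.chart hκ).surjective x
    simp only [verticalLift, lineLift, mem_ofPred_eq, Homeomorph.symm_apply_apply, chart_snd]
    constructor
    · rintro ⟨h1, h2, h3⟩
      exact ⟨(form_chart_eq_zero_iff hκ i (Ioo_subset_Icc_self h2)).2 h1, h2, h3⟩
    · rintro ⟨h1, h2, h3⟩
      exact ⟨(form_chart_eq_zero_iff hκ i (Ioo_subset_Icc_self h2)).1 h1, h2, h3⟩

/-- Up to isotopy relative to the lines, a joined curve is the image of a wedge in the chart. -/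
lemma IsJoinedCurve.isotopicRel_wedge (hR₀ : 1 < A.R₀) {h ε : ℝ} (hh : ε < h) (hh1 : h < 1 - ε)
    {γ : Set (ℝ × ℝ)} (hpq : p < q) (H : A.IsJoinedCurve δ h ε p q γ) {ω : ℝ → ℝ} {α β : ℝ}
    (hF : IsFrame hκ dL eL eR dR) (hω : A.IsAngle δ ω eL α p q β eR) :
    ∃ hl hu : ℝ, 0 < hl ∧ hl < hu ∧ hu < 1 ∧
      IsotopicRel A.strip (range A.lineLift) (tangentLift γ)
        {e | ((A.chart hκ).symm e.1, e.2) ∈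
          wedge (trough hl hu eL (A.a p) (A.a q) eR) ω hu eL eR} := by
  obtain ⟨hl, hu, bL, bR, h0, hlu, h1, hL, hR, hiso⟩ :=
    H.isotopicRel_boxCurve hκ hR₀ hh hh1 hpq hF hω
  refine ⟨hl, hu, h0, hlu, h1, hiso.trans (hF.isotopicRel_chart ?_)⟩
  refine isotopicRel_boxCurve_wedge h0 hlu h1 hF.dL_lt hω.eL_lt hω.lt_p (A.strictMono_a hpq) hω.lt_β
    hω.lt_eR hF.lt_dR hL hR hω.left hω.right ?_
  rintro _ ⟨i, rfl⟩
  exact ⟨_, _, A.cos_two_mul_nonpos i, rfl⟩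

/-- The frame and `ω` are common to both curves, so their wedges differ only in the heights and in
the shape of the trough. -/
lemma IsJoinedCurve.isotopicRel (hR₀ : 1 < A.R₀) {h ε : ℝ} (hh : ε < h) (hh1 : h < 1 - ε)
    {γ γ' : Set (ℝ × ℝ)} (hpq : p < q) (H : A.IsJoinedCurve δ h ε p q γ)
    (hpq' : p' < q') (H' : A.IsJoinedCurve δ h ε p' q' γ') {ω : ℝ → ℝ} {α β α' β' : ℝ}
    (hF : IsFrame hκ dL eL eR dR) (hω : A.IsAngle δ ω eL α p q β eR)
    (hω' : A.IsAngle δ ω eL α' p' q' β' eR) :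
    IsotopicRel A.strip (range A.lineLift) (tangentLift γ) (tangentLift γ') := by
  obtain ⟨hl, hu, h0, hlu, h1, h2⟩ := H.isotopicRel_wedge hR₀ hh hh1 hpq hF hω
  obtain ⟨hl', hu', h0', hlu', h1', h2'⟩ := H'.isotopicRel_wedge hR₀ hh hh1 hpq' hF hω'
  refine (h2.trans (hF.isotopicRel_chart ?_)).trans h2'.symm
  have hP := hF.eL_lt p
  have hQ := hF.lt_eR q
  have hP' := hF.eL_lt p'
  have hQ' := hF.lt_eR q'
  have hPQ := (A.strictMono_a hpq).le
  have hPQ' := (A.strictMono_a hpq').le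
  refine _root_.isotopicRel_wedge hF.dL_lt (hP.trans (hPQ.trans_lt hQ)) hF.lt_dR (h0.trans hlu) h1
    (h0'.trans hlu') h1' continuous_trough (trough_left hlu hP hPQ hQ) (trough_right hlu hP hPQ hQ)
    (fun a ha => ?_) continuous_trough (trough_left hlu' hP' hPQ' hQ')
    (trough_right hlu' hP' hPQ' hQ') (fun a ha => ?_) ?_
  · obtain ⟨h3, h4⟩ := trough_mem hlu hP hQ ha
    exact ⟨h0.trans_le h3, h4⟩
  · obtain ⟨h3, h4⟩ := trough_mem hlu' hP' hQ' ha
    exact ⟨h0'.trans_le h3, h4⟩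
  · rintro _ ⟨i, rfl⟩
    exact ⟨_, _, rfl⟩

end Frame

/-- The outermost lines lie strictly inside the rectangle at all heights of the compact interval [0,
1], so nearby vertical lines of the chart do too. -/
lemma exists_isFrame (hκ : A.IsSlope κ) (hR₀ : 1 < A.R₀) (hp : IsBot p) (hq : IsTop q) :
    ∃ dL eL eR dR, IsFrame hκ dL eL eR dR := by
  have hcont : ∀ x : ℝ × ℝ, ContinuousAt (fun x : ℝ × ℝ => (A.chart hκ (x.1, x.2)).1) x :=
    fun x => ((A.chart hκ).continuous.fst).continuousAt
  have h1 : ∀ᶠ a in 𝓝 (A.a p), ∀ z ∈ Icc (0 : ℝ) 1, -A.R < (A.chart hκ (a, z)).1 := by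
    refine isCompact_Icc.eventually_forall_of_forall_eventually fun z hz => ?_
    refine (hcont (A.a p, z)).eventually (lt_mem_nhds ?_)
    simp only [chart_node hκ p hz]
    exact (A.crossing_mem hR₀ p hz).1
  have h2 : ∀ᶠ a in 𝓝 (A.a q), ∀ z ∈ Icc (0 : ℝ) 1, (A.chart hκ (a, z)).1 < A.R := by
    refine isCompact_Icc.eventually_forall_of_forall_eventually fun z hz => ?_
    refine (hcont (A.a q, z)).eventually (gt_mem_nhds ?_)
    simp only [chart_node hκ q hz]
    exact (A.crossing_mem hR₀ q hz).2
  obtain ⟨dL, hdL, hdL'⟩ := ((h1.filter_mono nhdsWithin_le_nhds).and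
    (self_mem_nhdsWithin (s := Iio (A.a p)))).exists
  obtain ⟨dR, hdR, hdR'⟩ := ((h2.filter_mono nhdsWithin_le_nhds).and
    (self_mem_nhdsWithin (s := Ioi (A.a q)))).exists
  refine ⟨dL, (dL + A.a p) / 2, (dR + A.a q) / 2, dR, by linarith, by linarith, fun i => ?_,
    fun i => ?_, hdL, hdR⟩
  · have := A.strictMono_a.monotone (hp i)
    linarith
  · have := A.strictMono_a.monotone (hq i)
    linarith

/-- An interpolation of the angles which is constant before the first line with the sign `-1` and
after the last line with the sign `1`. -/
lemma exists_isAngle {eL eR : ℝ} (hpq : p < q) (hp : ∀ i < p, δ i = 1) (hq : ∀ i > q, δ i = -1)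
    (heL : eL < A.a p) (heR : A.a q < eR) : ∃ ω α β, A.IsAngle δ ω eL α p q β eR := by
  have hα : ∀ᶠ x in 𝓝[<] (A.a p), eL < x ∧ ∀ i, i < p → A.a i < x := by
    refine nhdsWithin_le_nhds ((lt_mem_nhds heL).and ?_)
    refine eventually_all.2 fun i => ?_
    by_cases hi : i < p
    · exact (lt_mem_nhds (A.strictMono_a hi)).mono fun x hx _ => hx
    · exact Eventually.of_forall fun x h => absurd h hi
  have hβ : ∀ᶠ x in 𝓝[>] (A.a q), x < eR ∧ ∀ i, i > q → x < A.a i := by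
    refine nhdsWithin_le_nhds ((gt_mem_nhds heR).and ?_)
    refine eventually_all.2 fun i => ?_
    by_cases hi : i > q
    · exact (gt_mem_nhds (A.strictMono_a hi)).mono fun x hx _ => hx
    · exact Eventually.of_forall fun x h => absurd h hi
  obtain ⟨α, ⟨hα1, hα2⟩, hα3⟩ := (hα.and self_mem_nhdsWithin).exists
  obtain ⟨β, ⟨hβ1, hβ2⟩, hβ3⟩ := (hβ.and self_mem_nhdsWithin).exists
  have hpq' := A.strictMono_a hpq
  -- Any continuous interpolation would do; it is used only between the lines `p` and `q`.
  let Ω : Polynomial ℝ := Lagrange.interpolate Finset.univ A.a fun i => signAngle (δ i)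
  have hΩ : ∀ i, Ω.eval (A.a i) = signAngle (δ i) := fun i =>
    Lagrange.eval_interpolate_at_node _ A.strictMono_a.injective.injOn (Finset.mem_univ i)
  set v : ℝ → ℝ := fun x => unitClamp ((x - α) / (A.a p - α)) with hv
  set w : ℝ → ℝ := fun x => unitClamp ((x - A.a q) / (β - A.a q)) with hw
  have hc0 : ∀ y ≤ 0, unitClamp y = 0 := fun y hy => max_eq_left ((min_le_right _ _).trans hy)
  have hc1 : ∀ y ≥ 1, unitClamp y = 1 := fun y hy => by
    rw [unitClamp, min_eq_left hy, max_eq_right zero_le_one]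
  have hv0 : ∀ x ≤ α, v x = 0 := fun x hx =>
    hc0 _ (div_nonpos_of_nonpos_of_nonneg (by linarith) (by linarith))
  have hv1 : ∀ x ≥ A.a p, v x = 1 := fun x hx => hc1 _ ((one_le_div (by linarith)).2 (by linarith))
  have hw0 : ∀ x ≤ A.a q, w x = 0 := fun x hx =>
    hc0 _ (div_nonpos_of_nonpos_of_nonneg (by linarith) (by linarith))
  have hw1 : ∀ x ≥ β, w x = 1 := fun x hx => hc1 _ ((one_le_div (by linarith)).2 (by linarith))
  -- The cutoff `v` makes the function 0 up to `α`, and `w` blends it into π from `β` on. At the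
  -- lines outside the range these constants are the right angles because of their signs.
  refine ⟨fun x => v x * ((1 - w x) * Ω.eval x + w x * Real.pi), α, β, ?_, fun i => ?_, hα1, hα3,
    hα2, fun x hx => by simp only [hv0 x hx, zero_mul], hβ3, hβ1, hβ2, fun x hx => ?_⟩
  · have hΩc := Ω.continuous
    simp only [hv, hw, unitClamp]
    fun_prop
  · rcases lt_or_ge i p with hi | hi
    · simp only [hv0 _ (hα2 i hi).le, hp i hi, signAngle_one, zero_mul]
    have hi' := A.strictMono_a.monotone hi
    rcases lt_or_ge q i with hj | hj
    · simp only [hv1 _ hi', hw1 _ (hβ2 i hj).le, hq i hj, signAngle_neg_one]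
      ring
    · simp only [hv1 _ hi', hw0 _ (A.strictMono_a.monotone hj), hΩ]
      ring
  · simp only [hv1 x (by linarith), hw1 x hx]
    ring

/-- The same interpolation for all the lines. -/
lemma IsAngle.extend {ω : ℝ → ℝ} {eL α β eR : ℝ} (hω : A.IsAngle δ ω eL α p q β eR)
    (hp : IsBot p') (hq : IsTop q') (heL : eL < A.a p') (heR : A.a q' < eR) :
    ∃ α' β', A.IsAngle δ ω eL α' p' q' β' eR := by
  -- With no lines further out, `α'` and `β'` need only lie between the frame and the outermost
  -- lines; moving outwards keeps `ω` constant beyond them.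
  refine ⟨min α ((eL + A.a p') / 2), max β ((A.a q' + eR) / 2), hω.cont, hω.node,
    lt_min hω.eL_lt (by linarith), (min_le_right _ _).trans_lt (by linarith),
    fun i hi => absurd (hp i) (not_le.2 hi), fun x hx => hω.left x (hx.trans (min_le_left _ _)),
    lt_of_lt_of_le (by linarith) (le_max_right _ _), max_lt hω.lt_eR (by linarith),
    fun i hi => absurd (hq i) (not_le.2 hi), fun x hx => hω.right x ((le_max_left _ _).trans hx)⟩

end LineArrangement

/-! ### From isotopies of lifts to isotopies of links -/

lemma smul_mem_tangentConeAt {E : Type*} [NormedAddCommGroup E] [NormedSpace ℝ E] {s : Set E}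
    {x y : E} (a : ℝ) (hy : y ∈ tangentConeAt ℝ s x) : a • y ∈ tangentConeAt ℝ s x := by
  obtain ⟨α, l, hl, c, d, hd, hm, hcd⟩ := exists_fun_of_mem_tangentConeAt hy
  refine mem_tangentConeAt_of_seq l (fun n => a * c n) d hd hm ?_
  simpa only [mul_smul] using hcd.const_smul a

/-- Over the interior the length of the vector is positive, and tangent cones over ℝ are stable
under scaling, so only the direction matters. -/
lemma spherePoint_mem_divideLink_iff {R : ℝ} {e : AngledPoint}
    (he : e.1 ∈ Ioo (-R) R ×ˢ Ioo (-1 : ℝ) 1) (he' : e.1 ∈ rectangle R) (M : Set (ℝ × ℝ)) :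
    spherePoint R e he' ∈ divideLink R M ↔ e ∈ tangentLift M := by
  refine and_congr_right fun _ => ⟨fun h => ?_, fun h => smul_mem_tangentConeAt _ h⟩
  have h' := smul_mem_tangentConeAt (boundaryDist R e.1)⁻¹ h
  have hsm : (spherePoint R e he').1.2 = boundaryDist R e.1 • angleDir e.2 := rfl
  rwa [hsm, smul_smul, inv_mul_cancel₀ (boundaryDist_pos he).ne', one_smul] at h'

lemma mem_tangentLift_congr {M N V : Set (ℝ × ℝ)} (hV : IsOpen V) (h : M ∩ V = N ∩ V)
    {e : AngledPoint} (he : e.1 ∈ V) : e ∈ tangentLift M ↔ e ∈ tangentLift N := by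
  have h1 : tangentConeAt ℝ M e.1 = tangentConeAt ℝ N e.1 := by
    rw [← tangentConeAt_inter_nhds (hV.mem_nhds he), h, tangentConeAt_inter_nhds (hV.mem_nhds he)]
  have h2 : e.1 ∈ M ↔ e.1 ∈ N := by
    constructor <;> intro h3
    · exact (h.subset ⟨h3, he⟩).1
    · exact (h.symm.subset ⟨h3, he⟩).1
  simp only [tangentLift, mem_ofPred_eq, h1, h2]

namespace LineArrangement

variable {n : ℕ} {A : LineArrangement n}

lemma strip_subset : A.strip ⊆ Ioo (-A.R) A.R ×ˢ Ioo (-1 : ℝ) 1 :=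
  prod_mono subset_rfl (Ioo_subset_Ioo (by norm_num) le_rfl)

lemma isOpen_strip : IsOpen A.strip := isOpen_Ioo.prod isOpen_Ioo

lemma isTangentStrand_line (i : Fin n) :
    IsTangentStrand ((fun z => (A.crossing i z, z)) '' Icc 0 1) (fun z => (A.crossing i z, z))
      (fun _ => A.θ i) (Icc 0 1) := by
  refine isTangentStrand_of_hasTangentAngle zero_lt_one continuous_snd (fun _ _ => rfl) ?_ ?_
  · unfold crossing
    fun_prop
  · intro r _
    have hs := (A.sin_pos i).ne'
    refine ⟨fun y => (y - r) / Real.sin (A.θ i), fun _ => A.θ i, fun y _ hy => ⟨?_, ?_⟩,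
      tendsto_const_nhds⟩
    · exact div_ne_zero (sub_ne_zero.2 hy) hs
    · simp only [crossing, Prod.smul_mk, smul_eq_mul, Prod.mk_add_mk, Prod.mk.injEq]
      constructor <;> field_simp <;> ring

/-- Tangent cones are local, and within the open strip the segment coincides with the straight
strand over the heights in [0, 1], whose angle is constant. -/
lemma mem_tangentLift_segment_iff (i : Fin n) {e : AngledPoint} (he : e.1 ∈ A.strip) :
    e ∈ tangentLift (A.segment i) ↔ e ∈ A.lineLift i := by
  have hcongr : A.segment i ∩ A.strip =
      ((fun z => (A.crossing i z, z)) '' Icc (0 : ℝ) 1) ∩ A.strip := by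
    ext x
    refine and_congr_left fun hx => ?_
    constructor
    · intro h
      exact ⟨x.2, Ioo_subset_Icc_self hx.2, Prod.ext (A.form_eq_zero_iff.1 h.1).symm rfl⟩
    · rintro ⟨z, -, rfl⟩
      have := A.strip_subset hx
      exact ⟨A.form_eq_zero_iff.2 rfl, Ioo_subset_Icc_self this.1, Ioo_subset_Icc_self this.2⟩
  rw [mem_tangentLift_congr isOpen_strip hcongr he, (A.isTangentStrand_line i).2.2]
  constructor
  · rintro ⟨z, -, h1, h2⟩
    refine ⟨A.form_eq_zero_iff.2 ?_, he.2, h2⟩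
    rw [h1]
  · rintro ⟨h1, h2, h3⟩
    exact ⟨e.1.2, Ioo_subset_Icc_self h2, Prod.ext (A.form_eq_zero_iff.1 h1) rfl, h3⟩

/-- Each piece is bounded on either side by a line or by a side of the rectangle, and the lines
themselves stay strictly inside by `crossing_mem`. -/
lemma IsJoinedCurve.subset_strip {δ : Fin n → ℤ} {p q : Fin n} (hR₀ : 1 < A.R₀) {h ε : ℝ}
    (hh : ε < h) (hh1 : h < 1 - ε) {γ : Set (ℝ × ℝ)} (H : A.IsJoinedCurve δ h ε p q γ) :
    γ ⊆ A.strip := by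
  obtain ⟨hl, hu, left, right, lower, hbl, hlu, hub, hL, hRt, hlow, rfl⟩ := H
  have hle : ∀ {i : Fin n} {x : ℝ × ℝ}, x.2 ∈ Ioo (0 : ℝ) 1 → A.form i x ≤ 0 → x.1 < A.R :=
    fun {i x} hx hf => lt_of_le_of_lt (not_lt.1 fun h => not_lt.2 hf (A.form_pos_iff.2 h))
      (A.crossing_mem hR₀ i (Ioo_subset_Icc_self hx)).2
  have hge : ∀ {i : Fin n} {x : ℝ × ℝ}, x.2 ∈ Ioo (0 : ℝ) 1 → 0 ≤ A.form i x → -A.R < x.1 :=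
    fun {i x} hx hf => lt_of_lt_of_le (A.crossing_mem hR₀ i (Ioo_subset_Icc_self hx)).1
      (not_lt.1 fun h => not_lt.2 hf (A.form_neg_iff.2 h))
  have hI : ∀ {z}, z ∈ Icc hl hu → z ∈ Ioo (0 : ℝ) 1 := fun hz =>
    ⟨by linarith [hz.1], by linarith [hz.2]⟩
  rintro x (((hx | hx) | hx) | hx)
  · have hx2 := hI (hL.snd_mem hx)
    exact ⟨⟨(hL.2.2 x hx).1, hle hx2 (hL.form_nonpos hx)⟩, hx2⟩
  · obtain ⟨h1, h2⟩ := hx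
    have h2' : x.2 = hu := h2
    have hx2 : x.2 ∈ Ioo (0 : ℝ) 1 := h2' ▸ hI ⟨hlu.le, le_rfl⟩
    have hu2 : hu ∈ Icc (0 : ℝ) 1 := Ioo_subset_Icc_self (hI ⟨hlu.le, le_rfl⟩)
    exact ⟨⟨(A.crossing_mem hR₀ p hu2).1.trans_le h1.1,
      h1.2.trans_lt (A.crossing_mem hR₀ q hu2).2⟩, hx2⟩
  · obtain ⟨i, hi, hx⟩ := mem_iUnion₂.1 hx
    have H := hlow i (next i) hi.1 (next_le hi.2) (next_val hi.2).symm
    have hb := H.2.2 x hx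
    have hx2 : x.2 ∈ Ioo (0 : ℝ) 1 := ⟨by linarith, by linarith⟩
    obtain ⟨h1, h2⟩ := H.form_between (lt_next hi.2)
      (Ioo_subset_Icc_self (hI ⟨le_rfl, hlu.le⟩)) hx
    exact ⟨⟨hge hx2 h1, hle hx2 h2⟩, hx2⟩
  · have hx2 := hI (hRt.snd_mem hx)
    exact ⟨⟨hge hx2 (hRt.form_nonneg hx), (hRt.2.2 x hx).1⟩, hx2⟩

/-- An isotopy of the lifts of two curves relative to the lines gives an isotopy of the links. -/
lemma ambientIsotopic_links {γ γ' : Set (ℝ × ℝ)} (hγ : γ ⊆ A.strip) (hγ' : γ' ⊆ A.strip)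
    (h : IsotopicRel A.strip (range A.lineLift) (tangentLift γ) (tangentLift γ')) :
    AmbientIsotopic (A.links γ) (A.links γ') := by
  obtain ⟨Φ, h1, h2⟩ := h
  refine Φ.ambientIsotopic A.strip_subset (fun k e he hm hm' => ?_) fun k w hw => ?_
  · have he' := (Φ.mem_iff_mem 1 e).2 he
    simp only [links]
    rw [spherePoint_mem_divideLink_iff (A.strip_subset he'),
      spherePoint_mem_divideLink_iff (A.strip_subset he)]
    refine Fin.cases ?_ (fun i => ?_) k
    · exact h1 e
    · simp only [Fin.cons_succ]
      rw [mem_tangentLift_segment_iff i he', mem_tangentLift_segment_iff i he]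
      exact h2 _ ⟨i, rfl⟩ e
  · refine Fin.cases ?_ (fun i => Iff.rfl) k
    -- Off the strip neither curve has points.
    exact ⟨fun h => absurd (hγ' h.1) hw, fun h => absurd (hγ h.1) hw⟩

end LineArrangement

end

theorem proposition4 {n : ℕ} (A : LineArrangement n)
    (C : Set (ℝ × ℝ)) (hC : C ∈ A.chambersF)
    (h ε : ℝ) (hε : 0 < ε) (hh : ε < h) (hh1 : h < 1 - ε)
    (γ γ' : Set (ℝ × ℝ))
    (hγ : A.IsChamberCurve C h ε γ) (hγ' : A.IsReducedChamberCurve C h ε γ') :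
    AmbientIsotopic (A.links γ') (A.links γ) := by
  obtain ⟨p, q, hp, hq, H⟩ := hγ
  obtain ⟨m₁, m₂, hm₁, hm₂, H'⟩ := hγ'
  have hm : m₁ < m₂ := A.lt_of_mem_chambersF hC hm₁ hm₂
  have hpq : p < q := ((hp m₁).trans_lt hm).trans_le (hq m₂)
  have hR₀ : 1 < A.R₀ := A.one_lt_R₀ hC.1 hm hm₁.1 hm₂.1
  obtain ⟨κ, hκ⟩ := A.exists_isSlope
  obtain ⟨dL, eL, eR, dR, hF⟩ := LineArrangement.exists_isFrame hκ hR₀ hp hq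
  -- The angle function is built for the reduced curve: by the choice of `m₁` and `m₂`, the lines
  -- outside their range have the signs 1 on the left and -1 on the right.
  obtain ⟨ω, α, β, hω⟩ := LineArrangement.exists_isAngle (A := A) (δ := A.chamberSign C) hm
    (fun i hi => (A.chamberSign_cases hC.1 i).elim And.left
      fun h' => absurd (hm₁.2 h'.1) (not_le.2 hi))
    (fun i hi => (A.chamberSign_cases hC.1 i).elim
      (fun h' => absurd (hm₂.2 h'.1) (not_le.2 hi)) And.left) (hF.eL_lt m₁) (hF.lt_eR m₂)
  -- The same `ω` serves the full curve, which is what makes the two wedges comparable.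
  obtain ⟨α', β', hω'⟩ := hω.extend hp hq (hF.eL_lt p) (hF.lt_eR q)
  exact LineArrangement.ambientIsotopic_links (H'.subset_strip hR₀ hh hh1)
    (H.subset_strip hR₀ hh hh1) (H'.isotopicRel hR₀ hh hh1 hm hpq H hF hω hω')
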